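/- Let $H$ be a discrete one-dimensional Schrödinger operator $[H\psi](n)=\psi(n+1)+\psi(n-1)+V(n)\psi(n)$ with real potential $V$, acting as a self-adjoint operator (on its natural domain) in $\ell^2(\mathbb Z)$ or in $\ell^2(\mathbb Z_+)$, $\mathbb Z_+=\{1,2,\dots\}$, in the latter case with the Dirichlet condition $\psi(0)=0$. For $T>0$ let $$a(n,T)=\frac2T\int_0^\infty e^{-2t/T}\,|\langle e^{-itH}\delta_1,\delta_n\rangle|^2\,dt,\qquad \langle |X|^p_{\delta_1}\rangle(T)=\sum_n |n|^p a(n,T),$$ and for $p>0$ let $$\beta^-_{\delta_1}(p)=\liminf_{T\to\infty}\frac{\log\langle |X|^p_{\delta_1}\rangle(T)}{\log T}.$$ Let $\mu$ be the spectral measure of $\delta_1$ with respect to $H$, that is, the finite measure with $\langle (H-z)^{-1}\delta_1,\delta_1\rangle=\int\frac{d\mu(x)}{x-z}$ for non-real $z$. For real solutions $u$ of $u(n+1)+u(n-1)+V(n)u(n)=Eu(n)$ (for all $n\in\mathbb Z$, respectively all $n\ge 1$), call $u$ normalized if $|u(0)|^2+|u(1)|^2=1$, and put $\|u\|_L^2=\sum_{n=1}^{[L]}|u(n)|^2+(L-[L])\,|u([L]+1)|^2$.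 Let $A\subseteq\mathbb R$ be a set with $\mu(A)>0$ such that: (a) $\alpha>0$, and there is $C>0$ such that $\|u\|_L^2\le CL^{2\alpha+1}$ for every $E\in A$, every normalized solution $u$ and every $L\ge1$; (b) there are $0<k,\gamma<1$ and $L_0\ge1$ such that $\|u\|_L^2\ge(1+\gamma)\|u\|_{kL}^2$ for every $E\in A$, every solution $u$ and every $L\ge L_0$. Then there is $\kappa>0$ for which the following holds: (c) there are $D>0$ and $L_1\ge1$ such that $\|u\|_L\ge DL^\kappa$ for every $E\in A$, every normalized solution $u$ and every $L\ge L_1$. Moreover, for every $\kappa>0$ for which (c) holds, $$\beta^-_{\delta_1}(p)\ \ge\ \frac{p(p+2\kappa)}{(p+1)(\alpha+\kappa+1/2)}\qquad\text{for } 0<p\le 2\alpha+1,$$ and $$\beta^-_{\delta_1}(p)\ \ge\ \frac{p}{\alpha+1}\qquad\text{for } p>2\alpha+1.$$ -/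

import Mathlib

open scoped ENNReal

/-- `U` is the strongly continuous one-parameter unitary group `t ↦ exp(-itT)` generated by the
(self-adjoint) operator `T`. -/
structure IsUnitaryGroup {E : Type*} [NormedAddCommGroup E] [InnerProductSpace ℂ E]
    (T : E →ₗ.[ℂ] E) (U : ℝ → E →L[ℂ] E) : Prop where
  zero : U 0 = 1
  add : ∀ s t, U (s + t) = U s * U t
  norm_map : ∀ t ψ, ‖U t ψ‖ = ‖ψ‖
  continuous : ∀ ψ, Continuous fun t => U t ψ
  hasDerivAt : ∀ ψ : T.domain, HasDerivAt (fun t => U t (ψ : E)) (-Complex.I • T ψ) 0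

/-- `μ` is the spectral measure of the vector `φ` with respect to the (self-adjoint) operator `T`:
the finite Borel measure on the line whose Borel transform is the function
`z ↦ ⟨(T - z)⁻¹ φ, φ⟩`, `z` non-real. -/
structure IsSpectralMeasure {E : Type*} [NormedAddCommGroup E] [InnerProductSpace ℂ E]
    (T : E →ₗ.[ℂ] E) (φ : E) (μ : MeasureTheory.Measure ℝ) : Prop where
  finite : MeasureTheory.IsFiniteMeasure μ
  borel : ∀ z : ℂ, z.im ≠ 0 → ∃ ψ : T.domain, T ψ - z • (ψ : E) = φ ∧
    inner ℂ φ (ψ : E) = ∫ x : ℝ, 1 / ((x : ℂ) - z) ∂μ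

/-- The bounded operator `R` is the resolvent `(T + ic)⁻¹`, with the properties which it has for
self-adjoint `T`. -/
structure IsResolventAt {E : Type*} [NormedAddCommGroup E] [InnerProductSpace ℂ E]
    [CompleteSpace E] (T : E →ₗ.[ℂ] E) (c : ℝ) (R : E →L[ℂ] E) : Prop where
  pos : 0 < c
  mem : ∀ φ, R φ ∈ T.domain
  right : ∀ φ, T ⟨R φ, mem φ⟩ + (Complex.I * c) • R φ = φ
  left : ∀ ψ : T.domain, R (T ψ + (Complex.I * c) • (ψ : E)) = ψ
  normal : IsStarNormal R
  dense : DenseRange R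
  rel : R - star R = (-2 * Complex.I * c) • (R * star R)

section resolvent

variable {E : Type*} [NormedAddCommGroup E] [InnerProductSpace ℂ E] [CompleteSpace E]
  {T : E →ₗ.[ℂ] E} {c : ℝ} {R : E →L[ℂ] E}

theorem IsResolventAt.spec (h : IsResolventAt T c R) (r : spectrum ℂ R) :
    (r : ℂ) - star (r : ℂ) = (-2 * Complex.I * c) * (r * star (r : ℂ)) := by
  have hn := h.normal
  set ρ : C(spectrum ℂ R, ℂ) := (ContinuousMap.id ℂ).restrict (spectrum ℂ R) with hρ
  have h1 : cfcHom hn ρ = R := cfcHom_id hn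
  have h2 : cfcHom hn (ρ - star ρ) = cfcHom hn ((-2 * Complex.I * c) • (ρ * star ρ)) := by
    rw [map_sub, map_smul, map_mul, map_star, h1, h.rel]
  have h3 := congrArg (fun f : C(spectrum ℂ R, ℂ) => f r) (cfcHom_injective hn h2)
  simpa [hρ] using h3

theorem IsResolventAt.spec_eq (h : IsResolventAt T c R) (r : spectrum ℂ R) (hr : (r : ℂ) ≠ 0) :
    1 / (r : ℂ) = ((1 / (r : ℂ)).re : ℂ) + Complex.I * c := by
  have h1 := h.spec r
  have hr' : star (r : ℂ) ≠ 0 := by simpa using hr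
  have h2 : star (1 / (r : ℂ)) - 1 / (r : ℂ) = -2 * Complex.I * c := by
    rw [star_div₀, star_one]
    field_simp
    linear_combination h1
  have h3 := congrArg Complex.im h2
  have h4 : -(1 / (r : ℂ)).im - (1 / (r : ℂ)).im = -2 * c := by
    rw [Complex.sub_im, Complex.star_def, Complex.conj_im] at h3
    rw [h3]
    simp
  apply Complex.ext
  · simp
  · simp only [Complex.add_im, Complex.ofReal_im, Complex.mul_im, Complex.I_re, Complex.I_im,
      Complex.ofReal_re, zero_mul, one_mul, zero_add]
    linarith

theorem inv_re_mul_le (r : ℂ) : ‖r‖ * |(1 / r).re| ≤ 1 := by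
  rcases eq_or_ne r 0 with rfl | hr
  · simp
  · calc ‖r‖ * |(1 / r).re| ≤ ‖r‖ * ‖1 / r‖ := by gcongr; exact Complex.abs_re_le_norm _
      _ = 1 := by rw [norm_div, norm_one]; field_simp [norm_ne_zero_iff.2 hr]

theorem norm_expI (θ : ℝ) : ‖Complex.exp (Complex.I * θ)‖ = 1 := by
  rw [mul_comm]; exact Complex.norm_exp_ofReal_mul_I θ

/-- The function `r ↦ r exp(-itx)`, `x = Re (1 / r)`. -/
noncomputable def resExp (R : E →L[ℂ] E) (t : ℝ) : C(spectrum ℂ R, ℂ) where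
  toFun r := r * Complex.exp (Complex.I * ((-t * (1 / (r : ℂ)).re : ℝ) : ℂ))
  continuous_toFun := by
    have : ∀ r : ℂ, ContinuousAt
        (fun r : ℂ => r * Complex.exp (Complex.I * ((-t * (1 / r).re : ℝ) : ℂ))) r := by
      intro r
      rcases eq_or_ne r 0 with rfl | hr
      · have h0 : Filter.Tendsto (fun r : ℂ => ‖r‖) (nhds 0) (nhds 0) := by
          simpa using (continuous_norm (E := ℂ)).tendsto 0
        rw [ContinuousAt, zero_mul]
        refine squeeze_zero_norm (fun r => ?_) h0
        rw [norm_mul, norm_expI, mul_one]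
      · have h1 : ContinuousAt (fun r : ℂ => 1 / r) r :=
          continuousAt_const.div continuousAt_id hr
        have h2 : ContinuousAt (fun r : ℂ => (1 / r).re) r :=
          Complex.continuous_re.continuousAt.comp h1
        have h3 : ContinuousAt (fun r : ℂ => (-t * (1 / r).re : ℝ)) r := h2.const_mul _
        have h4 := Complex.continuous_ofReal.continuousAt.comp h3
        exact continuousAt_id.mul (Complex.continuous_exp.continuousAt.comp
          (continuousAt_const.mul h4))
    exact (continuous_iff_continuousAt.2 this).comp continuous_subtype_val

theorem exists_isUnitaryGroup_of_resolvent (h : IsResolventAt T c R) :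
    ∃ U, IsUnitaryGroup T U := by
  have hn := h.normal
  set Φ := cfcHom hn (R := ℂ) with hΦ
  set ρ : C(spectrum ℂ R, ℂ) := (ContinuousMap.id ℂ).restrict (spectrum ℂ R) with hρ
  have hΦρ : Φ ρ = R := cfcHom_id hn
  have hΦn : ∀ f, ‖Φ f‖ ≤ ‖f‖ := fun f => NonUnitalStarAlgHom.norm_apply_le Φ f
  set m := resExp R with hm
  have m_apply : ∀ t r, m t r =
    r * Complex.exp (Complex.I * ((-t * (1 / (r : ℂ)).re : ℝ) : ℂ)) := fun t r => rfl
  have ρ_apply : ∀ r, ρ r = r := fun r => rfl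
  have m0 : m 0 = ρ := by ext r; simp [m_apply, ρ_apply]
  have mm : ∀ s t, m s * m t = ρ * m (s + t) := by
    intro s t
    ext r
    simp only [ContinuousMap.mul_apply, m_apply, ρ_apply]
    rw [mul_mul_mul_comm, ← Complex.exp_add, mul_assoc]
    congr 3
    push_cast
    ring_nf
  have ms : ∀ t, star (m t) * m t = star ρ * ρ := by
    intro t
    ext r
    simp only [ContinuousMap.mul_apply, ContinuousMap.star_apply, m_apply, ρ_apply, star_mul']
    rw [mul_mul_mul_comm]
    have := Complex.conj_mul' (Complex.exp (Complex.I * ((-t * (1 / (r : ℂ)).re : ℝ) : ℂ)))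
    rw [norm_expI] at this
    simp only [Complex.star_def]
    rw [this]
    simp
  have mnorm : ∀ t η, ‖Φ (m t) η‖ = ‖R η‖ := by
    intro t η
    have key : ∀ f, ‖Φ f η‖ ^ 2 = (inner ℂ η (Φ (star f * f) η)).re := by
      intro f
      rw [map_mul, map_star, mul_apply_eq_comp, ContinuousLinearMap.star_eq_adjoint,
        ContinuousLinearMap.adjoint_inner_right, inner_self_eq_norm_sq_to_K]
      norm_cast
    have h1 : ‖Φ (m t) η‖ ^ 2 = ‖R η‖ ^ 2 := by
      rw [key, ms, ← key, hΦρ]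
    exact (sq_eq_sq₀ (norm_nonneg _) (norm_nonneg _)).1 h1
  set U : ℝ → E →L[ℂ] E := fun t =>
    (Φ (m t) : E →ₗ[ℂ] E).extendOfNorm (R : E →ₗ[ℂ] E) with hU
  have hd : DenseRange (R : E →ₗ[ℂ] E) := h.dense
  have UR : ∀ t η, U t (R η) = Φ (m t) η := fun t η =>
    LinearMap.extendOfNorm_eq hd ⟨1, fun x => by simpa using (mnorm t x).le⟩ η
  have Unorm : ∀ t ψ, ‖U t ψ‖ = ‖ψ‖ := by
    intro t ψ
    refine h.dense.induction (P := fun ψ => ‖U t ψ‖ = ‖ψ‖) ?_ (isClosed_eq (by fun_prop) (by fun_prop)) ψ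
    rintro _ ⟨η, rfl⟩
    rw [UR, mnorm]
  have R_comm : ∀ f η, R (Φ f η) = Φ f (R η) := by
    intro f η
    have h1 : Φ ρ * Φ f = Φ f * Φ ρ := by rw [← map_mul, ← map_mul, mul_comm]
    rw [hΦρ] at h1
    exact congrArg (fun A : E →L[ℂ] E => A η) h1
  have U0 : U 0 = 1 := by
    apply ContinuousLinearMap.ext
    refine fun ψ => h.dense.induction (P := fun ψ => U 0 ψ = (1 : E →L[ℂ] E) ψ) ?_
      (isClosed_eq (by fun_prop) (by fun_prop)) ψ
    rintro _ ⟨η, rfl⟩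
    rw [UR, m0, hΦρ]
    rfl
  have hdd : DenseRange (fun η => R (R η)) := h.dense.comp h.dense R.continuous
  have Uadd : ∀ s t, U (s + t) = U s * U t := by
    intro s t
    apply ContinuousLinearMap.ext
    refine fun ψ => hdd.induction (P := fun ψ => U (s + t) ψ = (U s * U t) ψ) ?_
      (isClosed_eq (by fun_prop) (by fun_prop)) ψ
    rintro _ ⟨η, rfl⟩
    rw [mul_apply_eq_comp, UR t, ← R_comm, UR, UR]
    have h1 : Φ (m s) * Φ (m t) = R * Φ (m (s + t)) := by rw [← map_mul, mm, map_mul, hΦρ]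
    rw [← R_comm]
    exact (congrArg (fun A : E →L[ℂ] E => A η) h1).symm
  have lip0 : ∀ t η, ‖U t (R η) - R η‖ ≤ |t| * ‖η‖ := by
    intro t η
    have h1 : ‖m t - ρ‖ ≤ |t| := by
      rw [ContinuousMap.norm_le _ (abs_nonneg _)]
      intro r
      rw [ContinuousMap.sub_apply, m_apply, ρ_apply, ← mul_sub_one, norm_mul]
      calc _ ≤ ‖(r : ℂ)‖ * |-t * (1 / (r : ℂ)).re| := by
            gcongr
            exact Real.norm_exp_I_mul_ofReal_sub_one_le
        _ = |t| * (‖(r : ℂ)‖ * |(1 / (r : ℂ)).re|) := by rw [abs_mul, abs_neg]; ring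
        _ ≤ |t| * 1 := by gcongr; exact inv_re_mul_le _
        _ = |t| := mul_one _
    calc ‖U t (R η) - R η‖ = ‖Φ (m t - ρ) η‖ := by
          rw [UR, map_sub, hΦρ]; rfl
      _ ≤ ‖Φ (m t - ρ)‖ * ‖η‖ := ContinuousLinearMap.le_opNorm _ _
      _ ≤ |t| * ‖η‖ := by gcongr; exact (hΦn _).trans h1
  have tendsto0 : ∀ ψ, Filter.Tendsto (fun t => ‖U t ψ - ψ‖) (nhds 0) (nhds 0) := by
    intro ψ
    rw [Metric.tendsto_nhds]
    intro ε hε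
    obtain ⟨η, hη⟩ := h.dense.exists_dist_lt ψ (show 0 < ε / 3 by positivity)
    have hl : Filter.Tendsto (fun t : ℝ => |t| * ‖η‖) (nhds 0) (nhds 0) := by
      have : Continuous (fun t : ℝ => |t| * ‖η‖) := by fun_prop
      simpa using this.tendsto 0
    filter_upwards [hl.eventually (gt_mem_nhds (show 0 < ε / 3 by positivity))] with t ht
    rw [dist_zero_right, norm_norm]
    rw [dist_eq_norm] at hη
    have e : U t ψ - ψ = U t (ψ - R η) + (U t (R η) - R η) - (ψ - R η) := by
      rw [map_sub]; abel
    calc ‖U t ψ - ψ‖ ≤ ‖U t (ψ - R η)‖ + ‖U t (R η) - R η‖ + ‖ψ - R η‖ := by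
          rw [e]; exact (norm_sub_le _ _).trans (by gcongr; exact norm_add_le _ _)
      _ < ε := by rw [Unorm]; linarith [lip0 t η]
  have Ucont : ∀ ψ, Continuous fun t => U t ψ := by
    intro ψ
    rw [continuous_iff_continuousAt]
    intro s
    rw [ContinuousAt, tendsto_iff_norm_sub_tendsto_zero]
    have h1 : Filter.Tendsto (fun t : ℝ => t - s) (nhds s) (nhds 0) := by
      have : Continuous (fun t : ℝ => t - s) := by fun_prop
      simpa using this.tendsto s
    refine ((tendsto0 ψ).comp h1).congr fun t => ?_
    have : U t ψ - U s ψ = U s (U (t - s) ψ - ψ) := by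
      rw [map_sub, ← mul_apply_eq_comp, ← Uadd]; simp
    rw [this, Unorm]; rfl
  refine ⟨U, U0, Uadd, Unorm, Ucont, ?_⟩
  intro ψ
  set η := T ψ + (Complex.I * c) • (ψ : E) with hη
  have hψ : (ψ : E) = R η := (h.left ψ).symm
  have hTψ : T ψ = η - (Complex.I * c) • R η := by rw [← hψ, hη]; abel
  rw [hTψ, hψ]
  set B : ℝ → E → E := fun t η => U t (R η) - R η - t • (-Complex.I • (η - (Complex.I * c) • R η))
    with hB
  have B_sub : ∀ t η ξ, B t (η - ξ) = B t η - B t ξ := by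
    intro t η ξ
    simp only [hB, map_sub, smul_sub]
    abel
  set K := 1 + (1 + c * ‖R‖) with hK
  have hc := h.pos
  have B1 : ∀ t η, ‖B t η‖ ≤ |t| * (K * ‖η‖) := by
    intro t η
    calc ‖B t η‖ ≤ ‖U t (R η) - R η‖ + ‖t • (-Complex.I • (η - (Complex.I * c) • R η))‖ :=
          norm_sub_le _ _
      _ ≤ |t| * ‖η‖ + |t| * (‖η‖ + c * (‖R‖ * ‖η‖)) := by
          gcongr
          · exact lip0 t η
          · rw [norm_smul, norm_smul, Real.norm_eq_abs, norm_neg, Complex.norm_I, one_mul]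
            gcongr
            refine (norm_sub_le _ _).trans ?_
            gcongr
            rw [norm_smul, norm_mul, Complex.norm_I, one_mul, Complex.norm_real,
              Real.norm_of_nonneg hc.le]
            gcongr
            exact R.le_opNorm _
      _ = |t| * (K * ‖η‖) := by rw [hK]; ring
  have exp2 : ∀ θ : ℝ, ‖Complex.exp (Complex.I * θ) - 1 - Complex.I * θ‖ ≤ 2 * θ ^ 2 := by
    intro θ
    rcases le_total |θ| 1 with h1 | h1
    · have := Complex.norm_exp_sub_one_sub_id_le (x := Complex.I * θ) (by simpa using h1)
      refine this.trans ?_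
      simp
      nlinarith [sq_nonneg θ]
    · calc _ ≤ ‖Complex.exp (Complex.I * θ) - 1‖ + ‖Complex.I * θ‖ := norm_sub_le _ _
        _ ≤ |θ| + |θ| := by
            gcongr
            · exact Real.norm_exp_I_mul_ofReal_sub_one_le
            · simp
        _ ≤ 2 * θ ^ 2 := by nlinarith [sq_abs θ]
  have B2 : ∀ t ξ, ‖B t (R ξ)‖ ≤ 2 * t ^ 2 * ‖ξ‖ := by
    intro t ξ
    set f : C(spectrum ℂ R, ℂ) :=
      m t * ρ - ρ * ρ - (t : ℂ) • (-Complex.I • (ρ - (Complex.I * c) • (ρ * ρ))) with hf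
    have h1 : B t (R ξ) = Φ f ξ := by
      simp only [hf, hB, map_sub, map_smul, map_mul, hΦρ, UR]
      simp
    have h2 : ‖f‖ ≤ 2 * t ^ 2 := by
      rw [ContinuousMap.norm_le _ (by positivity)]
      intro r
      have hfr : f r = (r : ℂ) ^ 2 * (Complex.exp (Complex.I * ((-t * (1 / (r : ℂ)).re : ℝ) : ℂ)) -
          1 - Complex.I * ((-t * (1 / (r : ℂ)).re : ℝ) : ℂ)) := by
        simp only [hf, ContinuousMap.sub_apply, ContinuousMap.smul_apply, ContinuousMap.mul_apply,
          m_apply, ρ_apply, smul_eq_mul]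
        rcases eq_or_ne (r : ℂ) 0 with hr | hr
        · simp [hr]
        · have h3 := h.spec_eq r hr
          have h4 : (1 : ℂ) - Complex.I * c * r = r * ((1 / (r : ℂ)).re : ℂ) := by
            have : (1 : ℂ) = r * (1 / r) := by field_simp
            linear_combination this + r * h3
          push_cast
          linear_combination (t * Complex.I * r) * h4
      rw [hfr, norm_mul, norm_pow]
      calc _ ≤ ‖(r : ℂ)‖ ^ 2 * (2 * (-t * (1 / (r : ℂ)).re) ^ 2) := by
            gcongr
            exact exp2 _
        _ = 2 * t ^ 2 * (‖(r : ℂ)‖ * |(1 / (r : ℂ)).re|) ^ 2 := by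
            rw [mul_pow, mul_pow, sq_abs]; ring
        _ ≤ 2 * t ^ 2 * 1 ^ 2 := by
            gcongr
            exact inv_re_mul_le _
        _ = 2 * t ^ 2 := by ring
    rw [h1]
    exact (ContinuousLinearMap.le_opNorm _ _).trans (by gcongr; exact (hΦn f).trans h2)
  rw [hasDerivAt_iff_isLittleO_nhds_zero]
  have hgoal : (fun t : ℝ => U (0 + t) (R η) - U 0 (R η) -
      t • (-Complex.I • (η - (Complex.I * c) • R η))) = fun t => B t η := by
    funext t
    rw [zero_add, U0]; rfl
  rw [hgoal, Asymptotics.isLittleO_iff]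
  intro ε hε
  have hKpos : 0 < K := by positivity
  obtain ⟨ξ, hξ⟩ := h.dense.exists_dist_lt η (show 0 < ε / (2 * K) by positivity)
  rw [dist_eq_norm] at hξ
  have hl : Filter.Tendsto (fun t : ℝ => 2 * |t| * ‖ξ‖) (nhds 0) (nhds 0) := by
    have : Continuous (fun t : ℝ => 2 * |t| * ‖ξ‖) := by fun_prop
    simpa using this.tendsto 0
  filter_upwards [hl.eventually (gt_mem_nhds (show 0 < ε / 2 by positivity))] with t ht
  have e : B t η = B t (η - R ξ) + B t (R ξ) := by rw [B_sub]; abel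
  have h5 : K * ‖η - R ξ‖ ≤ ε / 2 := by
    have := mul_le_mul_of_nonneg_left hξ.le hKpos.le
    calc _ ≤ _ := this
      _ = ε / 2 := by field_simp
  calc ‖B t η‖ ≤ ‖B t (η - R ξ)‖ + ‖B t (R ξ)‖ := by rw [e]; exact norm_add_le _ _
    _ ≤ |t| * (K * ‖η - R ξ‖) + 2 * t ^ 2 * ‖ξ‖ := add_le_add (B1 _ _) (B2 _ _)
    _ = |t| * (K * ‖η - R ξ‖) + |t| * (2 * |t| * ‖ξ‖) := by rw [← sq_abs t]; ring
    _ ≤ |t| * (ε / 2) + |t| * (ε / 2) := by gcongr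
    _ = ε * ‖t‖ := by rw [Real.norm_eq_abs]; ring

theorem exists_isSpectralMeasure_of_resolvent (h : IsResolventAt T c R) (φ : E) :
    ∃ μ, IsSpectralMeasure T φ μ := by
  have hn := h.normal
  let X := spectrum ℂ R
  let Φ : C(X, ℂ) →⋆ₐ[ℂ] E →L[ℂ] E := cfcHom hn
  set ρ : C(X, ℂ) := (ContinuousMap.id ℂ).restrict X with hρ
  have hΦρ : Φ ρ = R := cfcHom_id (R := ℂ) hn
  have ρ_apply : ∀ r, ρ r = r := fun r => rfl
  have : CompactSpace X := isCompact_iff_compactSpace.1 (spectrum.isCompact R)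
  -- the positive functional of the vector
  let cplx : CompactlySupportedContinuousMap X ℝ → C(X, ℂ) := fun f =>
    ⟨fun r => (f r : ℂ), Complex.continuous_ofReal.comp f.continuous⟩
  have cplx_apply : ∀ f r, cplx f r = (f r : ℂ) := fun f r => rfl
  let L : CompactlySupportedContinuousMap X ℝ →ₗ[ℝ] ℝ :=
    { toFun := fun f => (inner ℂ φ (Φ (cplx f) φ)).re
      map_add' := fun f g => by
        have : cplx (f + g) = cplx f + cplx g := by ext r; simp [cplx_apply]
        rw [this, map_add, add_apply, inner_add_right, Complex.add_re]
      map_smul' := fun a f => by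
        have : cplx (a • f) = (a : ℂ) • cplx f := by ext r; simp [cplx_apply]
        rw [this, map_smul, smul_apply, inner_smul_right]
        simp }
  have hLpos : ∀ f, 0 ≤ f → 0 ≤ L f := by
    intro f hf
    let g : C(X, ℂ) := ⟨fun r => ((Real.sqrt (f r) : ℝ) : ℂ),
      Complex.continuous_ofReal.comp (Real.continuous_sqrt.comp f.continuous)⟩
    have hg : cplx f = star g * g := by
      ext r
      have h0 : (0 : ℝ) ≤ f r := hf r
      change ((f r : ℝ) : ℂ) = star ((Real.sqrt (f r) : ℝ) : ℂ) * ((Real.sqrt (f r) : ℝ) : ℂ)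
      rw [Complex.star_def, Complex.conj_ofReal, ← Complex.ofReal_mul, Real.mul_self_sqrt h0]
    change 0 ≤ (inner ℂ φ (Φ (cplx f) φ)).re
    rw [hg, map_mul, map_star, mul_apply_eq_comp, ContinuousLinearMap.star_eq_adjoint,
        ContinuousLinearMap.adjoint_inner_right]
    exact inner_self_nonneg (𝕜 := ℂ)
  set Λ := PositiveLinearMap.mk₀ L hLpos with hΛ
  set ν := RealRMK.rieszMeasure Λ with hν
  have hint : ∀ f : CompactlySupportedContinuousMap X ℝ,
      ∫ r, f r ∂ν = (inner ℂ φ (Φ (cplx f) φ)).re := fun f => RealRMK.integral_rieszMeasure Λ f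
  have : MeasureTheory.IsFiniteMeasure ν := by
    have : MeasureTheory.IsFiniteMeasureOnCompacts ν := by
      rw [hν]; infer_instance
    infer_instance
  -- the inner products are integrals
  have real_im : ∀ f, (inner ℂ φ (Φ (cplx f) φ)).im = 0 := by
    intro f
    have hs : star (cplx f) = cplx f := by
      ext r; simp [cplx_apply]
    have h1 : inner ℂ φ (Φ (cplx f) φ) = inner ℂ (Φ (cplx f) φ) φ := by
      conv_lhs => rw [← hs, map_star, ContinuousLinearMap.star_eq_adjoint]
      rw [ContinuousLinearMap.adjoint_inner_right]
    have h2 := congrArg Complex.im ((inner_conj_symm (𝕜 := ℂ) φ (Φ (cplx f) φ)).trans h1)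
    rw [← h1] at h2
    have h3 := congrArg Complex.im (inner_conj_symm (𝕜 := ℂ) φ (Φ (cplx f) φ))
    rw [← h1, Complex.conj_im] at h3
    linarith
  have hint' : ∀ q : C(X, ℂ), inner ℂ φ (Φ q φ) = ∫ r, q r ∂ν := by
    intro q
    let q1 : CompactlySupportedContinuousMap X ℝ :=
      ⟨⟨fun r => (q r).re, Complex.continuous_re.comp q.continuous⟩,
        HasCompactSupport.of_compactSpace _⟩
    let q2 : CompactlySupportedContinuousMap X ℝ :=
      ⟨⟨fun r => (q r).im, Complex.continuous_im.comp q.continuous⟩,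
        HasCompactSupport.of_compactSpace _⟩
    have hq : q = cplx q1 + Complex.I • cplx q2 := by
      ext r
      change q r = ((q r).re : ℂ) + Complex.I * ((q r).im : ℂ)
      rw [mul_comm, Complex.re_add_im]
    have hqi : MeasureTheory.Integrable (fun r => q r) ν := by
      exact q.continuous.integrable_of_hasCompactSupport (HasCompactSupport.of_compactSpace _)
    have h1 : inner ℂ φ (Φ (cplx q1) φ) = ((∫ r, q1 r ∂ν : ℝ) : ℂ) :=
      Complex.ext (by rw [hint]; simp) (by rw [real_im]; simp)
    have h2 : inner ℂ φ (Φ (cplx q2) φ) = ((∫ r, q2 r ∂ν : ℝ) : ℂ) :=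
      Complex.ext (by rw [hint]; simp) (by rw [real_im]; simp)
    calc inner ℂ φ (Φ q φ) = inner ℂ φ (Φ (cplx q1) φ) + Complex.I * inner ℂ φ (Φ (cplx q2) φ) := by
          conv_lhs => rw [hq]
          rw [map_add, map_smul, add_apply, smul_apply,
            inner_add_right, inner_smul_right]
      _ = ∫ r, q r ∂ν := by
          rw [h1, h2, mul_comm]
          exact integral_re_add_im (𝕜 := ℂ) hqi
  have hxm : Measurable (fun r : X => (1 / (r : ℂ)).re) :=
    Complex.measurable_re.comp ((measurable_const.div measurable_subtype_coe))
  have h0m : MeasurableSet {r : X | (r : ℂ) ≠ 0} :=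
    (measurable_subtype_coe (measurableSet_singleton (0 : ℂ))).compl
  refine ⟨(ν.restrict {r : X | (r : ℂ) ≠ 0}).map (fun r : X => (1 / (r : ℂ)).re),
    inferInstance, ?_⟩
  intro z hz
  have hden : ∀ r : X, (1 : ℂ) - (z + Complex.I * c) * r ≠ 0 := by
    intro r h0
    have hr : (r : ℂ) ≠ 0 := by rintro hr; simp [hr] at h0
    have h1 := h.spec_eq r hr
    have h2 : z = ((1 / (r : ℂ)).re : ℂ) := by
      have h3 : 1 / (r : ℂ) = z + Complex.I * c := by
        rw [div_eq_iff hr]; linear_combination h0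
      rw [h3] at h1
      rw [h3]
      linear_combination h1
    apply hz
    rw [h2, Complex.ofReal_im]
  let s : C(X, ℂ) := ⟨fun r => 1 / (1 - (z + Complex.I * c) * r),
    continuous_const.div (by fun_prop) hden⟩
  have hs : (1 - (z + Complex.I * c) • ρ) * s = 1 := by
    ext r
    change (1 - (z + Complex.I * c) * r) * (1 / (1 - (z + Complex.I * c) * r)) = (1 : ℂ)
    field_simp [hden r]
  have hs' := congrArg (fun A : E →L[ℂ] E => A φ) (congrArg Φ hs)
  simp only [map_mul, map_sub, map_one, map_smul, hΦρ, mul_apply_eq_comp,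
    sub_apply, one_apply_eq_self,
    smul_apply] at hs'
  refine ⟨⟨R (Φ s φ), h.mem _⟩, ?_, ?_⟩
  · have h1 := h.right (Φ s φ)
    rw [add_smul, ← sub_sub] at hs'
    rw [eq_sub_of_add_eq h1]
    refine Eq.trans ?_ hs'
    simp only
    abel
  · change inner ℂ φ (R (Φ s φ)) = _
    rw [MeasureTheory.integral_map hxm.aemeasurable]
    · have e1 : R (Φ s φ) = Φ (ρ * s) φ := by
        rw [map_mul, hΦρ]; rfl
      rw [e1, hint', ← MeasureTheory.integral_indicator h0m]
      congr 1
      funext r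
      by_cases hr : (r : ℂ) = 0
      · simp [Set.indicator, hr, ρ_apply]
      · rw [Set.indicator_of_mem (by exact hr)]
        have h1 := h.spec_eq r hr
        have h3 : ((1 / (r : ℂ)).re : ℂ) - z = 1 / r - (z + Complex.I * c) := by
          linear_combination -h1
        rw [h3]
        change (r : ℂ) * (1 / (1 - (z + Complex.I * c) * r)) = _
        have h4 : 1 / (r : ℂ) - (z + Complex.I * c) = (1 - (z + Complex.I * c) * r) / r := by
          field_simp
        rw [h4, one_div_div, mul_one_div]
    · have : Measurable (fun x : ℝ => 1 / ((x : ℂ) - z)) :=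
        measurable_const.div (Complex.measurable_ofReal.sub_const z)
      exact this.aestronglyMeasurable

end resolvent

/-- The Hilbert space `ℓ²(S)`, `S ⊆ ℤ`. -/
noncomputable abbrev Ell2 (S : Set ℤ) := lp (fun _ : S => ℂ) 2

/-- Extension by zero of a sequence on `S` to `ℤ`; for `S = {1, 2, …}` this puts the Dirichlet
condition `ψ 0 = 0`. -/
noncomputable def zeroExt {S : Set ℤ} (ψ : S → ℂ) (n : ℤ) : ℂ :=
  open Classical in if h : n ∈ S then ψ ⟨n, h⟩ else 0

/-- The difference expression `(H ψ)(n) = ψ(n + 1) + ψ(n - 1) + V(n) ψ(n)`, `n ∈ S`. -/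
noncomputable def schrodingerExpr {S : Set ℤ} (V : ℤ → ℝ) (ψ : S → ℂ) (n : S) : ℂ :=
  zeroExt ψ (n + 1) + zeroExt ψ (n - 1) + (V n : ℂ) * ψ n

theorem zeroExt_add {S : Set ℤ} (ψ φ : S → ℂ) (n : ℤ) :
    zeroExt (ψ + φ) n = zeroExt ψ n + zeroExt φ n := by
  unfold zeroExt; split_ifs <;> simp

theorem zeroExt_smul {S : Set ℤ} (a : ℂ) (ψ : S → ℂ) (n : ℤ) :
    zeroExt (a • ψ) n = a * zeroExt ψ n := by
  unfold zeroExt; split_ifs <;> simp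

theorem zeroExt_zero {S : Set ℤ} (n : ℤ) : zeroExt (0 : S → ℂ) n = 0 := by
  unfold zeroExt; split_ifs <;> simp

theorem schrodingerExpr_add {S : Set ℤ} (V : ℤ → ℝ) (ψ φ : S → ℂ) :
    schrodingerExpr V (ψ + φ) = schrodingerExpr V ψ + schrodingerExpr V φ := by
  funext n
  simp only [schrodingerExpr, zeroExt_add, Pi.add_apply]
  ring

theorem schrodingerExpr_smul {S : Set ℤ} (V : ℤ → ℝ) (a : ℂ) (ψ : S → ℂ) :
    schrodingerExpr V (a • ψ) = a • schrodingerExpr V ψ := by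
  funext n
  simp only [schrodingerExpr, zeroExt_smul, Pi.smul_apply, smul_eq_mul]
  ring

theorem schrodingerExpr_zero {S : Set ℤ} (V : ℤ → ℝ) :
    schrodingerExpr V (0 : S → ℂ) = 0 := by
  funext n
  simp [schrodingerExpr, zeroExt_zero]

/-- The discrete Schrödinger operator `H` in `ℓ²(S)` with potential `V`, on its natural domain
`{ψ ∈ ℓ²(S) | H ψ ∈ ℓ²(S)}` (which is all of `ℓ²(S)` if `V` is bounded). -/
noncomputable def schrodinger (S : Set ℤ) (V : ℤ → ℝ) : Ell2 S →ₗ.[ℂ] Ell2 S where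
  domain :=
    { carrier := {ψ | Memℓp (schrodingerExpr V ψ) 2}
      zero_mem' := by
        rw [Set.mem_ofPred_eq, lp.coeFn_zero, schrodingerExpr_zero]
        exact zero_memℓp
      add_mem' := by
        intro ψ φ hψ hφ
        rw [Set.mem_ofPred_eq, lp.coeFn_add, schrodingerExpr_add]
        exact hψ.add hφ
      smul_mem' := by
        intro a ψ hψ
        rw [Set.mem_ofPred_eq, lp.coeFn_smul, schrodingerExpr_smul]
        exact hψ.const_smul a }
  toFun :=
    { toFun := fun ψ => ⟨schrodingerExpr V (ψ : Ell2 S), ψ.2⟩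
      map_add' := fun ψ φ => by
        apply lp.ext
        exact schrodingerExpr_add V _ _
      map_smul' := fun a ψ => by
        apply lp.ext
        exact schrodingerExpr_smul V _ _ }

/-- `ψ ∈ ℓ²(S)` is square-summable, and so is every translate of its extension by zero. -/
theorem summable_zeroExt {S : Set ℤ} (ψ : Ell2 S) :
    Summable (fun n : ℤ => ‖zeroExt ψ n‖ ^ (2 : ℝ)) ∧
      ∑' n : ℤ, ‖zeroExt ψ n‖ ^ (2 : ℝ) = ‖ψ‖ ^ (2 : ℝ) := by
  have h1 : HasSum (fun n : S => ‖ψ n‖ ^ (2 : ℝ)) (‖ψ‖ ^ (2 : ℝ)) := by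
    have := lp.hasSum_norm (p := 2) (by norm_num) ψ
    simpa using this
  have h2 : (fun n : S => ‖ψ n‖ ^ (2 : ℝ)) =
      (fun n : ℤ => ‖zeroExt ψ n‖ ^ (2 : ℝ)) ∘ ((↑) : S → ℤ) := by
    funext n
    simp [zeroExt]
  rw [h2] at h1
  have h3 := (Subtype.val_injective.hasSum_iff (f := fun n : ℤ => ‖zeroExt ψ n‖ ^ (2 : ℝ))
    (fun n hn => ?_)).1 h1
  · exact ⟨h3.summable, h3.tsum_eq⟩
  · have : n ∉ S := by simpa using hn
    simp [zeroExt, this]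

theorem summable_shift {S : Set ℤ} (ψ : Ell2 S) (k : ℤ) :
    Summable (fun n : S => ‖zeroExt ψ ((n : ℤ) + k)‖ ^ (2 : ℝ)) ∧
      ∑' n : S, ‖zeroExt ψ ((n : ℤ) + k)‖ ^ (2 : ℝ) ≤ ‖ψ‖ ^ (2 : ℝ) := by
  obtain ⟨h1, h2⟩ := summable_zeroExt ψ
  have hi : Function.Injective (fun n : S => (n : ℤ) + k) := fun a b h => by
    apply Subtype.ext; simpa using h
  have h3 : Summable (fun n : S => ‖zeroExt ψ ((n : ℤ) + k)‖ ^ (2 : ℝ)) := h1.comp_injective hi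
  refine ⟨h3, ?_⟩
  rw [← h2]
  exact h3.tsum_le_tsum_of_inj (fun n : S => (n : ℤ) + k) hi (fun _ _ => by positivity)
    (fun _ => le_rfl) h1

/-- The translation `(A ψ)(n) = ψ(n + k)` (with extension by zero) as a bounded operator. -/
noncomputable def shiftOp (S : Set ℤ) (k : ℤ) : Ell2 S →L[ℂ] Ell2 S :=
  LinearMap.mkContinuous
    { toFun := fun ψ => ⟨fun n => zeroExt ψ ((n : ℤ) + k),
        memℓp_gen (by simpa using (summable_shift ψ k).1)⟩
      map_add' := fun ψ φ => by
        apply lp.ext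
        funext n
        exact zeroExt_add _ _ _
      map_smul' := fun a ψ => by
        apply lp.ext
        funext n
        exact zeroExt_smul _ _ _ } 1 (fun ψ => by
      rw [one_mul]
      refine lp.norm_le_of_tsum_le (by norm_num) (norm_nonneg _) ?_
      simpa using (summable_shift ψ k).2)

theorem shiftOp_apply {S : Set ℤ} (k : ℤ) (ψ : Ell2 S) (n : S) :
    shiftOp S k ψ n = zeroExt ψ ((n : ℤ) + k) := rfl

theorem inner_shiftOp {S : Set ℤ} (k : ℤ) (φ ψ : Ell2 S) :
    inner ℂ φ (shiftOp S k ψ) = inner ℂ (shiftOp S (-k) φ) ψ := by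
  have h1 : ∀ (φ ψ : Ell2 S) (k : ℤ), inner ℂ φ (shiftOp S k ψ) =
      ∑' n : ℤ, inner ℂ (zeroExt φ n) (zeroExt ψ (n + k)) := by
    intro φ ψ k
    rw [lp.inner_eq_tsum]
    have h2 : (fun n : S => inner ℂ (φ n) (shiftOp S k ψ n)) =
        fun n : S => (fun n : ℤ => inner ℂ (zeroExt φ n) (zeroExt ψ (n + k))) n := by
      funext n
      rw [shiftOp_apply]
      simp [zeroExt]
    rw [h2]
    refine tsum_subtype_eq_of_support_subset (s := S)
      (f := fun n : ℤ => inner ℂ (zeroExt φ n) (zeroExt ψ (n + k))) ?_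
    intro n hn
    by_contra hS
    apply hn
    simp [zeroExt, hS]
  rw [h1, ← inner_conj_symm (shiftOp S (-k) φ) ψ, h1, Complex.conj_tsum]
  conv_rhs => rw [← (Equiv.addRight k).tsum_eq]
  refine tsum_congr fun n => ?_
  rw [inner_conj_symm]
  simp

/-- The free part `(Δ ψ)(n) = ψ(n + 1) + ψ(n - 1)`. -/
noncomputable def hopping (S : Set ℤ) : Ell2 S →L[ℂ] Ell2 S := shiftOp S 1 + shiftOp S (-1)

theorem inner_hopping {S : Set ℤ} (φ ψ : Ell2 S) :
    inner ℂ φ (hopping S ψ) = inner ℂ (hopping S φ) ψ := by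
  have h := inner_shiftOp (-1) φ ψ
  rw [neg_neg] at h
  rw [hopping, add_apply, add_apply, inner_add_right, inner_add_left,
    inner_shiftOp 1, h, add_comm]

theorem schrodingerExpr_eq {S : Set ℤ} (V : ℤ → ℝ) (ψ : Ell2 S) (n : S) :
    schrodingerExpr V ψ n = hopping S ψ n + (V n : ℂ) * ψ n := rfl

theorem schrodinger_apply {S : Set ℤ} (V : ℤ → ℝ) (ψ : (schrodinger S V).domain) (n : S) :
    schrodinger S V ψ n = hopping S (ψ : Ell2 S) n + (V n : ℂ) * (ψ : Ell2 S) n := rfl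

theorem schrodinger_symm {S : Set ℤ} {V : ℤ → ℝ} (φ ψ : (schrodinger S V).domain) :
    inner ℂ (φ : Ell2 S) (schrodinger S V ψ) = inner ℂ (schrodinger S V φ) (ψ : Ell2 S) := by
  have h : ∀ φ : (schrodinger S V).domain, ∀ n : S,
      (schrodinger S V φ - hopping S (φ : Ell2 S) : Ell2 S) n = (V n : ℂ) * (φ : Ell2 S) n := by
    intro φ n
    rw [lp.coeFn_sub, Pi.sub_apply, schrodinger_apply]
    ring
  have h1 : inner ℂ (φ : Ell2 S) (schrodinger S V ψ - hopping S (ψ : Ell2 S)) =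
      inner ℂ (schrodinger S V φ - hopping S (φ : Ell2 S)) (ψ : Ell2 S) := by
    rw [lp.inner_eq_tsum, lp.inner_eq_tsum]
    refine tsum_congr fun n => ?_
    rw [h, h]
    simp only [RCLike.inner_apply, map_mul, Complex.conj_ofReal]
    ring
  rw [inner_sub_right, inner_sub_left, inner_hopping] at h1
  exact sub_left_inj.1 h1

/-- The bounded diagonal operator `(V + ic)⁻¹`. -/
theorem exists_diagonal (S : Set ℤ) (V : ℤ → ℝ) (c : ℝ) (hc : c ≠ 0) :
    ∃ M : Ell2 S →L[ℂ] Ell2 S, ‖M‖ ≤ 1 / |c| ∧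
      ∀ ψ n, M ψ n = (1 / ((V n : ℂ) + Complex.I * c)) * ψ n := by
  have hc' : 0 < |c| := abs_pos.2 hc
  have hb : ∀ n : S, ‖1 / ((V n : ℂ) + Complex.I * c)‖ ≤ 1 / |c| := by
    intro n
    rw [norm_div, norm_one]
    refine one_div_le_one_div_of_le hc' ?_
    have := Complex.abs_im_le_norm ((V n : ℂ) + Complex.I * c)
    simpa using this
  have hb' : ∀ (ψ : Ell2 S) (n : S), ‖(1 / ((V n : ℂ) + Complex.I * c)) * ψ n‖ ≤
      ‖((1 / |c| : ℝ) : ℂ) • ψ n‖ := by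
    intro ψ n
    rw [norm_mul, norm_smul, Complex.norm_real, Real.norm_of_nonneg (by positivity)]
    gcongr
    exact hb n
  have hmem : ∀ ψ : Ell2 S, Memℓp (fun n : S => (1 / ((V n : ℂ) + Complex.I * c)) * ψ n) 2 :=
    fun ψ => (lp.memℓp (((1 / |c| : ℝ) : ℂ) • ψ)).mono' (hb' ψ)
  let L : Ell2 S →ₗ[ℂ] Ell2 S :=
    { toFun := fun ψ => ⟨_, hmem ψ⟩
      map_add' := fun ψ φ => by
        apply lp.ext
        funext n
        exact mul_add _ _ _
      map_smul' := fun a ψ => by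
        apply lp.ext
        funext n
        exact mul_left_comm _ _ _ }
  have hL : ∀ ψ, ‖L ψ‖ ≤ 1 / |c| * ‖ψ‖ := by
    intro ψ
    have h1 : ‖L ψ‖ ≤ ‖((1 / |c| : ℝ) : ℂ) • ψ‖ :=
      lp.norm_mono (by norm_num) (fun n => hb' ψ n)
    rwa [norm_smul, Complex.norm_real, Real.norm_of_nonneg (by positivity)] at h1
  exact ⟨L.mkContinuous _ hL, L.mkContinuous_norm_le (by positivity) hL, fun _ _ => rfl⟩

/-- `H + ic` is onto, with bounded right inverse, if `|c|` is large. -/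
theorem exists_rightInverse (S : Set ℤ) (V : ℤ → ℝ) (c : ℝ) (hc : ‖hopping S‖ < |c|) :
    ∃ R : Ell2 S →L[ℂ] Ell2 S, ∀ φ, ∃ h : R φ ∈ (schrodinger S V).domain,
      schrodinger S V ⟨R φ, h⟩ + (Complex.I * c) • R φ = φ := by
  have hc0 : 0 < |c| := (norm_nonneg _).trans_lt hc
  obtain ⟨M, hM, hMa⟩ := exists_diagonal S V c (abs_pos.1 hc0)
  have hlt : ‖-(hopping S * M)‖ < 1 := by
    rw [norm_neg]
    calc ‖hopping S * M‖ ≤ ‖hopping S‖ * ‖M‖ := norm_mul_le _ _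
      _ ≤ ‖hopping S‖ * (1 / |c|) := by gcongr
      _ < 1 := by rw [mul_one_div, div_lt_one hc0]; exact hc
  set N := Units.oneSub (-(hopping S * M)) hlt with hN
  have hNval : (N : Ell2 S →L[ℂ] Ell2 S) = 1 + hopping S * M := by
    rw [hN, Units.val_oneSub, sub_neg_eq_add]
  refine ⟨M * ((N⁻¹ : (Ell2 S →L[ℂ] Ell2 S)ˣ) : Ell2 S →L[ℂ] Ell2 S), fun φ => ?_⟩
  set η := ((N⁻¹ : (Ell2 S →L[ℂ] Ell2 S)ˣ) : Ell2 S →L[ℂ] Ell2 S) φ with hη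
  have hφ : η + hopping S (M η) = φ := by
    have h1 : (N : Ell2 S →L[ℂ] Ell2 S) * ((N⁻¹ : (Ell2 S →L[ℂ] Ell2 S)ˣ) : Ell2 S →L[ℂ] Ell2 S) = 1 :=
      N.mul_inv
    rw [hNval] at h1
    exact congrArg (fun A : Ell2 S →L[ℂ] Ell2 S => A φ) h1
  change ∃ h : M η ∈ (schrodinger S V).domain,
    schrodinger S V ⟨M η, h⟩ + (Complex.I * c) • M η = φ
  have hne : ∀ n : S, (V n : ℂ) + Complex.I * c ≠ 0 := by
    intro n h0
    have := congrArg Complex.im h0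
    simp at this
    exact (abs_pos.1 hc0) this
  have key : schrodingerExpr V (M η) = (φ - (Complex.I * c) • M η : Ell2 S) := by
    funext n
    rw [schrodingerExpr_eq, ← hφ]
    simp only [lp.coeFn_sub, lp.coeFn_add, lp.coeFn_smul, Pi.sub_apply, Pi.add_apply,
      Pi.smul_apply, smul_eq_mul, hMa]
    field_simp [hne n]
    ring
  have hmem : M η ∈ (schrodinger S V).domain := by
    change Memℓp (schrodingerExpr V (M η)) 2
    rw [key]
    exact lp.memℓp _
  refine ⟨hmem, ?_⟩
  have : schrodinger S V ⟨M η, hmem⟩ = φ - (Complex.I * c) • M η := lp.ext key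
  rw [this]
  abel

theorem exists_isResolventAt (S : Set ℤ) (V : ℤ → ℝ) :
    ∃ c R, IsResolventAt (schrodinger S V) c R := by
  set c : ℝ := ‖hopping S‖ + 1 with hc
  have hcpos : 0 < c := by positivity
  have hlt : ‖hopping S‖ < |c| := by rw [abs_of_pos hcpos]; linarith
  obtain ⟨R, hR⟩ := exists_rightInverse S V c hlt
  obtain ⟨Q, hQ⟩ := exists_rightInverse S V (-c) (by rwa [abs_neg])
  choose Rm hR using hR
  choose Qm hQ using hQ
  -- the two right inverses are adjoint to each other
  have adj1 : ∀ φ (ψ : (schrodinger S V).domain), inner ℂ (Q φ) (schrodinger S V ψ + (Complex.I * c) • (ψ : Ell2 S)) =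
      inner ℂ φ (ψ : Ell2 S) := by
    intro φ ψ
    conv_rhs => rw [← hQ φ]
    rw [inner_add_right, inner_add_left, inner_smul_right, inner_smul_left]
    have := schrodinger_symm ⟨Q φ, Qm φ⟩ ψ
    rw [this]
    simp
  have adj2 : ∀ φ (ψ : (schrodinger S V).domain), inner ℂ (R φ) (schrodinger S V ψ + (Complex.I * (-c : ℝ)) • (ψ : Ell2 S)) =
      inner ℂ φ (ψ : Ell2 S) := by
    intro φ ψ
    conv_rhs => rw [← hR φ]
    rw [inner_add_right, inner_add_left, inner_smul_right, inner_smul_left]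
    have := schrodinger_symm ⟨R φ, Rm φ⟩ ψ
    rw [this]
    simp
  have hRQ : star R = Q := by
    apply ContinuousLinearMap.ext
    intro φ
    refine ext_inner_right ℂ fun χ => ?_
    rw [ContinuousLinearMap.star_eq_adjoint, ContinuousLinearMap.adjoint_inner_left]
    have := adj1 φ ⟨R χ, Rm χ⟩
    rw [hR] at this
    exact this.symm
  have left1 : ∀ ψ : (schrodinger S V).domain, R (schrodinger S V ψ + (Complex.I * c) • (ψ : Ell2 S)) = ψ := by
    intro ψ
    refine ext_inner_left ℂ fun χ => ?_
    rw [← adj1 χ ψ, ← hRQ, ContinuousLinearMap.star_eq_adjoint,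
      ContinuousLinearMap.adjoint_inner_left]
  have left2 : ∀ ψ : (schrodinger S V).domain, Q (schrodinger S V ψ + (Complex.I * (-c : ℝ)) • (ψ : Ell2 S)) = ψ := by
    intro ψ
    refine ext_inner_left ℂ fun χ => ?_
    rw [← adj2 χ ψ, ← hRQ, ContinuousLinearMap.star_eq_adjoint,
      ContinuousLinearMap.adjoint_inner_right]
  have rel1 : R - Q = (-2 * Complex.I * c) • (R * Q) := by
    apply ContinuousLinearMap.ext
    intro φ
    have h1 := left1 ⟨Q φ, Qm φ⟩
    have h2 := hQ φ
    have h3 : schrodinger S V ⟨Q φ, Qm φ⟩ + (Complex.I * c) • Q φ = φ + (2 * Complex.I * c) • Q φ := by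
      rw [eq_sub_of_add_eq h2]
      push_cast
      module
    change R φ - Q φ = (-2 * Complex.I * c) • R (Q φ)
    simp only at h1
    rw [h3, map_add, map_smul] at h1
    nth_rewrite 1 [← h1]
    module
  have rel2 : R - Q = (-2 * Complex.I * c) • (Q * R) := by
    apply ContinuousLinearMap.ext
    intro φ
    have h1 := left2 ⟨R φ, Rm φ⟩
    have h2 := hR φ
    have h3 : schrodinger S V ⟨R φ, Rm φ⟩ + (Complex.I * (-c : ℝ)) • R φ = φ - (2 * Complex.I * c) • R φ := by
      rw [eq_sub_of_add_eq h2]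
      push_cast
      module
    change R φ - Q φ = (-2 * Complex.I * c) • Q (R φ)
    simp only at h1
    rw [h3, map_sub, map_smul] at h1
    nth_rewrite 1 [← h1]
    module
  have hne : (-2 * Complex.I * c) ≠ 0 := by
    simp [hcpos.ne']
  refine ⟨c, R, hcpos, Rm, hR, left1, ⟨?_⟩, ?_, ?_⟩
  · rw [hRQ]
    exact (smul_right_injective _ hne (rel1.symm.trans rel2)).symm
  · have h1 : (R : Ell2 S →ₗ[ℂ] Ell2 S).range.topologicalClosure = ⊤ := by
      rw [Submodule.topologicalClosure_eq_top_iff, Submodule.eq_bot_iff]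
      intro χ hχ
      have h2 : Q χ = 0 := by
        refine ext_inner_left ℂ fun φ => ?_
        rw [← hRQ, ContinuousLinearMap.star_eq_adjoint, ContinuousLinearMap.adjoint_inner_right,
          inner_zero_right]
        exact hχ (R φ) ⟨φ, rfl⟩
      have h3 := hQ χ
      have h4 : (⟨Q χ, Qm χ⟩ : (schrodinger S V).domain) = 0 := Subtype.ext h2
      rw [← h3, h4, h2, LinearPMap.map_zero]
      simp
    have h2 := (Submodule.dense_iff_topologicalClosure_eq_top).2 h1
    exact h2
  · rw [hRQ]
    exact rel1

theorem exists_isUnitaryGroup (S : Set ℤ) (V : ℤ → ℝ) :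
    ∃ U, IsUnitaryGroup (schrodinger S V) U := by
  obtain ⟨c, R, h⟩ := exists_isResolventAt S V
  exact exists_isUnitaryGroup_of_resolvent h

theorem exists_isSpectralMeasure (S : Set ℤ) (V : ℤ → ℝ) (φ : Ell2 S) :
    ∃ μ, IsSpectralMeasure (schrodinger S V) φ μ := by
  obtain ⟨c, R, h⟩ := exists_isResolventAt S V
  exact exists_isSpectralMeasure_of_resolvent h φ

/-- The unitary group `t ↦ exp(-itH)` on `ℓ²(S)`. -/
noncomputable def timeEvolution (S : Set ℤ) (V : ℤ → ℝ) : ℝ → Ell2 S →L[ℂ] Ell2 S :=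
  Classical.choose (exists_isUnitaryGroup S V)

theorem isUnitaryGroup_timeEvolution (S : Set ℤ) (V : ℤ → ℝ) :
    IsUnitaryGroup (schrodinger S V) (timeEvolution S V) :=
  Classical.choose_spec (exists_isUnitaryGroup S V)

/-- The spectral measure of the vector `φ ∈ ℓ²(S)` with respect to `H`. -/
noncomputable def spectralMeasure (S : Set ℤ) (V : ℤ → ℝ) (φ : Ell2 S) :
    MeasureTheory.Measure ℝ :=
  Classical.choose (exists_isSpectralMeasure S V φ)

theorem isSpectralMeasure_spectralMeasure (S : Set ℤ) (V : ℤ → ℝ) (φ : Ell2 S) :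
    IsSpectralMeasure (schrodinger S V) φ (spectralMeasure S V φ) :=
  Classical.choose_spec (exists_isSpectralMeasure S V φ)

/-- The unit vector `δ_m ∈ ℓ²(S)`, `m ∈ S` (and `0` if `m ∉ S`). -/
noncomputable def delta (S : Set ℤ) (m : ℤ) : Ell2 S :=
  open Classical in if h : m ∈ S then lp.single 2 (⟨m, h⟩ : S) (1 : ℂ) else 0

/-- The time-averaged probability
`a(n, T) = (2 / T) ∫₀^∞ exp(-2t/T) |⟨exp(-itH) δ₁, δ_n⟩|² dt`. -/
noncomputable def avgProb (S : Set ℤ) (V : ℤ → ℝ) (n : ℤ) (T : ℝ) : ℝ :=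
  2 / T * ∫ t in Set.Ioi (0 : ℝ), Real.exp (-2 * t / T) *
    ‖inner ℂ (delta S n) (timeEvolution S V t (delta S 1))‖ ^ 2

/-- The time-averaged moment `⟨|X|^p⟩(T) = ∑_n |n|^p a(n, T)`, a sum of non-negative terms with
values in `[0, ∞]`. -/
noncomputable def moment (S : Set ℤ) (V : ℤ → ℝ) (p T : ℝ) : ℝ≥0∞ :=
  ∑' n : S, ENNReal.ofReal (|((n : ℤ) : ℝ)| ^ p * avgProb S V n T)

/-- The lower growth exponent `β⁻(p) = liminf_{T → ∞} log ⟨|X|^p⟩(T) / log T`, in `[-∞, ∞]`. -/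
noncomputable def lowerExponent (S : Set ℤ) (V : ℤ → ℝ) (p : ℝ) : EReal :=
  Filter.liminf (fun T : ℝ => ENNReal.log (moment S V p T) / (Real.log T : EReal)) Filter.atTop

/-- `u` is a real solution of the difference equation at energy `E`: the equation holds at all
sites of `S`. (For `S = {1, 2, …}` the values of `u` that matter are `u 0, u 1, …`.) -/
def IsSolution (S : Set ℤ) (V : ℤ → ℝ) (E : ℝ) (u : ℤ → ℝ) : Prop :=
  ∀ n ∈ S, u (n + 1) + u (n - 1) + V n * u n = E * u n

/-- `|u(0)|² + |u(1)|² = 1`. -/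
def IsNormalized (u : ℤ → ℝ) : Prop := |u 0| ^ 2 + |u 1| ^ 2 = 1

/-- `‖u‖_L² = ∑_{n = 1}^{[L]} |u(n)|² + (L - [L]) |u([L] + 1)|²`, for `L ≥ 0`. -/
noncomputable def normSqUpTo (u : ℤ → ℝ) (L : ℝ) : ℝ :=
  ∑ n ∈ Finset.Icc 1 ⌊L⌋₊, |u (n : ℤ)| ^ 2 + (L - ⌊L⌋₊) * |u ((⌊L⌋₊ : ℤ) + 1)| ^ 2

/-- Power-law upper bound with exponent `α` on the set of energies `A`. -/
def PowerLawUpperBound (S : Set ℤ) (V : ℤ → ℝ) (A : Set ℝ) (α : ℝ) : Prop :=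
  ∃ C : ℝ, 0 < C ∧ ∀ E ∈ A, ∀ u : ℤ → ℝ, IsSolution S V E u → IsNormalized u →
    ∀ L : ℝ, 1 ≤ L → normSqUpTo u L ≤ C * L ^ (2 * α + 1)

/-- Scaling lower bound on the set of energies `A`. -/
def ScalingLowerBound (S : Set ℤ) (V : ℤ → ℝ) (A : Set ℝ) : Prop :=
  ∃ k γ L₀ : ℝ, 0 < k ∧ k < 1 ∧ 0 < γ ∧ γ < 1 ∧ 1 ≤ L₀ ∧
    ∀ E ∈ A, ∀ u : ℤ → ℝ, IsSolution S V E u →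
      ∀ L : ℝ, L₀ ≤ L → (1 + γ) * normSqUpTo u (k * L) ≤ normSqUpTo u L

/-- Power-law lower bound with exponent `κ` on the set of energies `A`. (The bound is required for
large `L` only: at `L = 1` it fails for the normalized solution with `u 1 = 0`.) -/
def PowerLawLowerBound (S : Set ℤ) (V : ℤ → ℝ) (A : Set ℝ) (κ : ℝ) : Prop :=
  ∃ D L₁ : ℝ, 0 < D ∧ 1 ≤ L₁ ∧ ∀ E ∈ A, ∀ u : ℤ → ℝ, IsSolution S V E u → IsNormalized u →
    ∀ L : ℝ, L₁ ≤ L → D * L ^ κ ≤ Real.sqrt (normSqUpTo u L)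

/-
Cut the energy line into cells of length `1 / T` and let `μ` be the spectral measure of `δ₁`. If
most of the mass of `A` sits in cells of measure at most `b`, Strichartz' estimate bounds the
time-averaged probability on the first `N` sites by `√(b N)`, up to a constant and to the part of
the state outside these cells, so that a fixed share of the wave packet lies beyond `N ~ 1 / b`.
If most of it sits in cells of larger measure, Plancherel's identity writes the moment as an
integral of `n ^ p |G(n, E + i / T)|²`, where `|G(1, E + i / T)|` is at least of order `μ(cell) T`
and where `G` grows along the sites: the growth of the real solutions persists, up to a length at
which the Gram determinant of two solutions is a small multiple of `T ^ 2`, at every complex energy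
within `O(1 / T)` of `A`. Choosing `b` as the power of `T` which balances the two bounds gives the
exponent for `p ≤ 2 α + 1`, and larger moments are bounded below through the moment of order
`2 α + 1`, because the probabilities add up to `1`.
-/

section L2

open MeasureTheory

variable {α F : Type*} {m : MeasurableSpace α} {μ : Measure α} [NormedAddCommGroup F]
  {f : α → F}

theorem norm_toLp_sq (hf : MemLp f 2 μ) : ‖hf.toLp f‖ ^ 2 = ∫ x, ‖f x‖ ^ 2 ∂μ := by
  rw [Lp.norm_toLp, hf.eLpNorm_eq_integral_rpow_norm two_ne_zero ENNReal.ofNat_ne_top,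
    ENNReal.toReal_ofReal (by positivity), ← Real.rpow_natCast, ← Real.rpow_mul (by positivity)]
  simp

theorem lintegral_enorm_sq_eq_ofReal (hf : MemLp f 2 μ) :
    ∫⁻ x, ‖f x‖ₑ ^ 2 ∂μ = ENNReal.ofReal (∫ x, ‖f x‖ ^ 2 ∂μ) := by
  rw [ofReal_integral_eq_lintegral_ofReal ((memLp_two_iff_integrable_sq_norm hf.1).1 hf)
    (Filter.Eventually.of_forall fun x => by positivity)]
  simp only [ENNReal.ofReal_pow (norm_nonneg _), ofReal_norm]

/-- Schur's test for a symmetric kernel. -/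
theorem lintegral_prod_mul_le_of_symm [SFinite μ] {k : α → α → ℝ≥0∞}
    (hk : Measurable (Function.uncurry k)) (symm : ∀ x y, k x y = k y x) {f : α → NNReal}
    (hf : AEMeasurable f μ) {K : ℝ≥0∞} (hK : ∀ x, ∫⁻ y, k x y ∂μ ≤ K) :
    ∫⁻ p, k p.1 p.2 * (f p.1 * f p.2) ∂(μ.prod μ) ≤ K * ∫⁻ x, (f x : ℝ≥0∞) ^ 2 ∂μ := by
  have hf2 : AEMeasurable (fun x => (f x : ℝ≥0∞) ^ 2) μ := hf.coe_nnreal_ennreal.pow_const 2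
  have hm : AEMeasurable (fun p : α × α => k p.1 p.2 * (f p.1 : ℝ≥0∞) ^ 2) (μ.prod μ) :=
    hk.aemeasurable.mul hf2.comp_fst
  have first : ∫⁻ p, k p.1 p.2 * (f p.1 : ℝ≥0∞) ^ 2 ∂(μ.prod μ) ≤
      K * ∫⁻ x, (f x : ℝ≥0∞) ^ 2 ∂μ := by
    rw [lintegral_prod _ hm, ← lintegral_const_mul'' _ hf2]
    refine lintegral_mono fun x => ?_
    dsimp only
    rw [lintegral_mul_const _ hk.of_uncurry_left]
    gcongr
    exact hK x
  have second : ∫⁻ p, k p.1 p.2 * (f p.2 : ℝ≥0∞) ^ 2 ∂(μ.prod μ) ≤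
      K * ∫⁻ x, (f x : ℝ≥0∞) ^ 2 ∂μ := by
    rw [← lintegral_prod_swap]
    simpa only [Prod.fst_swap, Prod.snd_swap, symm] using! first
  refine (ENNReal.mul_le_mul_iff_right two_ne_zero ENNReal.ofNat_ne_top).1 ?_
  calc 2 * ∫⁻ p, k p.1 p.2 * (f p.1 * f p.2) ∂(μ.prod μ)
      = ∫⁻ p, k p.1 p.2 * (2 * f p.1 * f p.2) ∂(μ.prod μ) := by
        rw [← lintegral_const_mul' _ _ ENNReal.ofNat_ne_top]
        congr with p
        ring
    _ ≤ ∫⁻ p, (k p.1 p.2 * (f p.1 : ℝ≥0∞) ^ 2 + k p.1 p.2 * (f p.2 : ℝ≥0∞) ^ 2) ∂(μ.prod μ) := by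
        refine lintegral_mono fun p => ?_
        rw [← mul_add]
        gcongr
        norm_cast
        exact ENNReal.coe_le_coe.2 (two_mul_le_add_sq (f p.1) (f p.2))
    _ ≤ 2 * (K * ∫⁻ x, (f x : ℝ≥0∞) ^ 2 ∂μ) := by
        rw [lintegral_add_left' hm, two_mul]
        exact add_le_add first second

end L2

section Plancherel

open MeasureTheory FourierTransform
open scoped ContDiff SchwartzMap

variable {V F : Type*} [NormedAddCommGroup V] [InnerProductSpace ℝ V] [FiniteDimensional ℝ V]
  [MeasurableSpace V] [BorelSpace V] [NormedAddCommGroup F] [InnerProductSpace ℂ F]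
  [CompleteSpace F] {f : V → F}

theorem fourier_toLp_ae_eq (h1 : Integrable f) (h2 : MemLp f 2) :
    (𝓕 (h2.toLp f) : Lp F 2 (volume : Measure V)) =ᵐ[volume] 𝓕 f := by
  have hcont : Continuous (𝓕 f) :=
    VectorFourier.fourierIntegral_continuous Real.continuous_fourierChar continuous_inner h1
  refine ae_eq_of_integral_contDiff_smul_eq
    ((Lp.memLp _).locallyIntegrable one_le_two) hcont.locallyIntegrable fun φ φ_smooth φ_supp => ?_
  have hψ₁ : HasCompactSupport (Complex.ofRealCLM ∘ φ) := φ_supp.comp_left rfl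
  have hψ₂ : ContDiff ℝ ∞ (Complex.ofRealCLM ∘ φ) := by fun_prop
  set ψ : 𝓢(V, ℂ) := hψ₁.toSchwartzMap hψ₂
  have hψφ : ∀ x, ψ x = φ x := fun x => rfl
  calc ∫ x, φ x • (𝓕 (h2.toLp f) : Lp F 2 (volume : Measure V)) x
      = Lp.toTemperedDistribution (𝓕 (h2.toLp f)) ψ := by simp [hψφ]
    _ = ∫ x, 𝓕 (ψ : V → ℂ) x • h2.toLp f x := by
        rw [← Lp.fourier_toTemperedDistribution_eq, TemperedDistribution.fourier_apply,
          Lp.toTemperedDistribution_apply, SchwartzMap.fourier_coe]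
    _ = ∫ x, 𝓕 (ψ : V → ℂ) x • f x :=
        integral_congr_ae (h2.coeFn_toLp.mono fun x hx => by simp only [hx])
    _ = ∫ x, ψ x • 𝓕 f x := by
        simpa using! VectorFourier.integral_fourierIntegral_smul_eq_flip (L := innerₗ V)
          Real.continuous_fourierChar continuous_inner ψ.integrable h1
    _ = ∫ x, φ x • 𝓕 f x := by simp [hψφ]

theorem memLp_two_fourier (h1 : Integrable f) (h2 : MemLp f 2) : MemLp (𝓕 f) 2 :=
  (memLp_congr_ae (fourier_toLp_ae_eq h1 h2)).1 (Lp.memLp _)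

theorem integral_norm_sq_fourier (h1 : Integrable f) (h2 : MemLp f 2) :
    ∫ ξ, ‖𝓕 f ξ‖ ^ 2 = ∫ x, ‖f x‖ ^ 2 := by
  rw [← norm_toLp_sq h2, ← Lp.norm_fourier_eq, ← norm_toLp_sq (memLp_two_fourier h1 h2)]
  congr 2
  exact Lp.ext ((MemLp.coeFn_toLp _).trans (fourier_toLp_ae_eq h1 h2).symm)

end Plancherel

section FourierStieltjes

open MeasureTheory
open scoped FourierTransform

/-- The Fourier–Stieltjes transform of the complex measure `h dμ` on the line, normalized with a
positive sign and no factor `2π` in the exponent. -/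
noncomputable def fourierStieltjes (μ : Measure ℝ) (h : ℝ → ℂ) (t : ℝ) : ℂ :=
  ∫ x : ℝ, Complex.exp (Complex.I * (t * x)) * h x ∂μ

theorem norm_exp_I_mul_mul (s t : ℝ) : ‖Complex.exp (Complex.I * (s * t))‖ = 1 := by
  exact_mod_cast norm_expI (s * t)

variable {μ : Measure ℝ} {h : ℝ → ℂ}

theorem integrable_exp_I_mul (h1 : Integrable h μ) (t : ℝ) :
    Integrable (fun x : ℝ => Complex.exp (Complex.I * (t * x)) * h x) μ :=
  h1.bdd_mul (c := 1) (by fun_prop)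
    (Filter.Eventually.of_forall fun x => (norm_exp_I_mul_mul t x).le)

theorem norm_fourierStieltjes_le (μ : Measure ℝ) (h : ℝ → ℂ) (t : ℝ) :
    ‖fourierStieltjes μ h t‖ ≤ ∫ x, ‖h x‖ ∂μ := by
  refine (norm_integral_le_integral_norm _).trans_eq ?_
  simp only [norm_mul, norm_exp_I_mul_mul, one_mul]

theorem continuous_fourierStieltjes (h1 : Integrable h μ) : Continuous (fourierStieltjes μ h) := by
  refine continuous_of_dominated (fun t => (integrable_exp_I_mul h1 t).aestronglyMeasurable)
    (fun t => Filter.Eventually.of_forall fun x => ?_) h1.norm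
    (Filter.Eventually.of_forall fun x => by fun_prop)
  rw [norm_mul, norm_exp_I_mul_mul, one_mul]

theorem star_fourierStieltjes (μ : Measure ℝ) (h : ℝ → ℂ) (t : ℝ) :
    star (fourierStieltjes μ h t) = fourierStieltjes μ (fun x => star (h x)) (-t) := by
  rw [fourierStieltjes, Complex.star_def, ← integral_conj]
  refine integral_congr_ae (Filter.Eventually.of_forall fun x => ?_)
  simp only [map_mul, ← Complex.exp_conj, Complex.conj_I, Complex.conj_ofReal]
  push_cast
  ring_nf

theorem fourierStieltjes_volume_eq_fourier (h : ℝ → ℂ) (t : ℝ) :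
    fourierStieltjes volume h t = 𝓕 h (-(2 * Real.pi)⁻¹ * t) := by
  rw [Real.fourier_real_eq_integral_exp_smul]
  refine integral_congr_ae (Filter.Eventually.of_forall fun x => ?_)
  simp only [smul_eq_mul]
  congr 2
  push_cast
  field_simp

theorem integrable_norm_sq_fourierStieltjes_volume (h1 : Integrable h) (h2 : MemLp h 2) :
    Integrable fun t => ‖fourierStieltjes volume h t‖ ^ 2 := by
  simp only [fourierStieltjes_volume_eq_fourier]
  exact ((memLp_two_iff_integrable_sq_norm (memLp_two_fourier h1 h2).1).1
    (memLp_two_fourier h1 h2)).comp_mul_left' (by simp [Real.pi_ne_zero])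

theorem integral_norm_sq_fourierStieltjes_volume (h1 : Integrable h) (h2 : MemLp h 2) :
    ∫ t, ‖fourierStieltjes volume h t‖ ^ 2 = 2 * Real.pi * ∫ x, ‖h x‖ ^ 2 := by
  simp only [fourierStieltjes_volume_eq_fourier]
  rw [Measure.integral_comp_mul_left fun ξ => ‖𝓕 h ξ‖ ^ 2, integral_norm_sq_fourier h1 h2, inv_neg,
    inv_inv, abs_neg, abs_of_pos Real.two_pi_pos, smul_eq_mul]

variable {w : ℝ → ℝ}

theorem integrable_mul_norm_sq_fourierStieltjes (hw : Integrable w) (h1 : Integrable h μ) :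
    Integrable fun t => w t * ‖fourierStieltjes μ h t‖ ^ 2 := by
  refine hw.mul_bdd (c := (∫ x, ‖h x‖ ∂μ) ^ 2)
    ((continuous_fourierStieltjes h1).norm.pow 2).aestronglyMeasurable
    (Filter.Eventually.of_forall fun t => ?_)
  rw [norm_pow, norm_norm]
  gcongr
  exact norm_fourierStieltjes_le μ h t

theorem norm_sq_fourierStieltjes_eq_integral_prod [SFinite μ] (t : ℝ) :
    ((‖fourierStieltjes μ h t‖ ^ 2 : ℝ) : ℂ) =
      ∫ p : ℝ × ℝ, Complex.exp (Complex.I * (t * (p.1 - p.2))) * (h p.1 * star (h p.2))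
        ∂(μ.prod μ) := by
  rw [Complex.ofReal_pow, ← Complex.mul_conj', ← Complex.star_def, star_fourierStieltjes,
    fourierStieltjes, fourierStieltjes, ← integral_prod_mul]
  refine integral_congr_ae (Filter.Eventually.of_forall fun p => ?_)
  dsimp only
  rw [mul_mul_mul_comm, ← Complex.exp_add]
  push_cast
  ring_nf

theorem integral_mul_norm_sq_fourierStieltjes [SFinite μ] (hw : Integrable w)
    (h1 : Integrable h μ) :
    ((∫ t, w t * ‖fourierStieltjes μ h t‖ ^ 2 : ℝ) : ℂ) =
      ∫ p : ℝ × ℝ, fourierStieltjes volume (fun t => (w t : ℂ)) (p.1 - p.2) *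
        (h p.1 * star (h p.2)) ∂(μ.prod μ) := by
  have hstar : Integrable (fun x => star (h x)) μ :=
    Complex.conjCLE.toContinuousLinearMap.integrable_comp h1
  have hker : Integrable (fun q : ℝ × (ℝ × ℝ) => Complex.exp (Complex.I * (q.1 * (q.2.1 - q.2.2))) *
      ((w q.1 : ℂ) * (h q.2.1 * star (h q.2.2)))) (volume.prod (μ.prod μ)) := by
    refine (hw.ofReal.mul_prod (h1.mul_prod hstar)).bdd_mul (c := 1)
      (by apply Continuous.aestronglyMeasurable; fun_prop)
      (Filter.Eventually.of_forall fun q => ?_)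
    exact_mod_cast (norm_expI (q.1 * (q.2.1 - q.2.2))).le
  calc ((∫ t, w t * ‖fourierStieltjes μ h t‖ ^ 2 : ℝ) : ℂ)
      = ∫ t : ℝ, ∫ p : ℝ × ℝ, Complex.exp (Complex.I * (t * (p.1 - p.2))) *
          ((w t : ℂ) * (h p.1 * star (h p.2))) ∂(μ.prod μ) := by
        rw [← integral_complex_ofReal]
        refine integral_congr_ae (Filter.Eventually.of_forall fun t => ?_)
        simp only [mul_left_comm _ (w t : ℂ)]
        rw [Complex.ofReal_mul, norm_sq_fourierStieltjes_eq_integral_prod, integral_const_mul]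
    _ = ∫ p : ℝ × ℝ, (∫ t : ℝ, Complex.exp (Complex.I * (t * (p.1 - p.2))) *
          ((w t : ℂ) * (h p.1 * star (h p.2)))) ∂(μ.prod μ) := integral_integral_swap hker
    _ = _ := by
        refine integral_congr_ae (Filter.Eventually.of_forall fun p => ?_)
        simp only [← mul_assoc, integral_mul_const, fourierStieltjes]
        push_cast
        congr with t
        ring_nf

theorem integral_mul_norm_sq_fourierStieltjes_le [SFinite μ] (hw : Integrable w)
    (h1 : Integrable h μ) (h2 : MemLp h 2 μ) {K : ℝ} (hK0 : 0 ≤ K)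
    (hK : ∀ x : ℝ, ∫⁻ y, ‖fourierStieltjes volume (fun t => (w t : ℂ)) (x - y)‖ₑ ∂μ ≤
      ENNReal.ofReal K) :
    ∫ t, w t * ‖fourierStieltjes μ h t‖ ^ 2 ≤ K * ∫ x, ‖h x‖ ^ 2 ∂μ := by
  set W := fourierStieltjes volume (fun t => (w t : ℂ))
  have W_meas : Measurable (Function.uncurry fun x y : ℝ => ‖W (x - y)‖ₑ) :=
    ((continuous_fourierStieltjes hw.ofReal).measurable.comp
      (measurable_fst.sub measurable_snd)).enorm
  have W_symm : ∀ x y : ℝ, ‖W (x - y)‖ₑ = ‖W (y - x)‖ₑ := by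
    intro x y
    have : star (W (x - y)) = W (y - x) := by simp [W, star_fourierStieltjes]
    rw [← this, enorm_eq_iff_norm_eq, norm_star]
  have _ : 0 ≤ ∫ x, ‖h x‖ ^ 2 ∂μ := integral_nonneg fun x => by positivity
  have bound : ‖∫ p : ℝ × ℝ, W (p.1 - p.2) * (h p.1 * star (h p.2)) ∂(μ.prod μ)‖ₑ ≤
      ENNReal.ofReal (K * ∫ x, ‖h x‖ ^ 2 ∂μ) :=
    calc _ ≤ ∫⁻ p : ℝ × ℝ, ‖W (p.1 - p.2)‖ₑ * (‖h p.1‖ₑ * ‖h p.2‖ₑ) ∂(μ.prod μ) := by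
          refine (enorm_integral_le_lintegral_enorm _).trans_eq (lintegral_congr fun p => ?_)
          rw [enorm_mul, enorm_mul, enorm_eq_iff_norm_eq.2 (norm_star (h p.2))]
      _ ≤ ENNReal.ofReal K * ∫⁻ x, ‖h x‖ₑ ^ 2 ∂μ :=
          lintegral_prod_mul_le_of_symm W_meas W_symm h1.1.nnnorm.aemeasurable hK
      _ = ENNReal.ofReal (K * ∫ x, ‖h x‖ ^ 2 ∂μ) := by
          rw [lintegral_enorm_sq_eq_ofReal h2, ENNReal.ofReal_mul hK0]
  rw [← integral_mul_norm_sq_fourierStieltjes hw h1, ← ofReal_norm, Complex.norm_real,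
    ENNReal.ofReal_le_ofReal_iff (by positivity)] at bound
  exact (le_abs_self _).trans bound

end FourierStieltjes

section Poisson

open MeasureTheory

theorem integrable_exp_neg_mul_abs {a : ℝ} (ha : 0 < a) :
    Integrable fun t : ℝ => Real.exp (-a * |t|) := by
  rw [← integrableOn_univ, ← Set.Iic_union_Ioi (a := (0 : ℝ))]
  refine IntegrableOn.union ?_ ?_
  · refine (integrableOn_exp_mul_Iic ha 0).congr_fun (fun t ht => ?_) measurableSet_Iic
    rw [abs_of_nonpos ht, neg_mul_neg]
  · refine (integrableOn_exp_mul_Ioi (neg_lt_zero.2 ha) 0).congr_fun (fun t ht => ?_)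
      measurableSet_Ioi
    rw [abs_of_pos ht]

theorem fourierStieltjes_exp_neg_mul_abs {a : ℝ} (ha : 0 < a) (s : ℝ) :
    fourierStieltjes volume (fun t => (Real.exp (-a * |t|) : ℂ)) s =
      ((2 * a / (a ^ 2 + s ^ 2) : ℝ) : ℂ) := by
  have hre : ∀ σ : ℝ, 0 < ((a : ℂ) + σ * Complex.I).re := by simpa using ha
  have hker : Integrable fun t : ℝ =>
      Complex.exp (Complex.I * (s * t)) * (Real.exp (-a * |t|) : ℂ) :=
    integrable_exp_I_mul (integrable_exp_neg_mul_abs ha).ofReal s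
  have left : ∫ t : ℝ in Set.Iic 0, Complex.exp (Complex.I * (s * t)) *
      (Real.exp (-a * |t|) : ℂ) = 1 / (a + s * Complex.I) := by
    rw [← Complex.exp_zero, ← mul_zero ((a : ℂ) + s * Complex.I), ← Complex.ofReal_zero,
      ← integral_exp_mul_complex_Iic (hre s) 0]
    refine setIntegral_congr_fun measurableSet_Iic fun t ht => ?_
    rw [abs_of_nonpos ht, Complex.ofReal_exp, ← Complex.exp_add]
    push_cast
    ring_nf
  have right : ∫ t : ℝ in Set.Ioi 0, Complex.exp (Complex.I * (s * t)) *
      (Real.exp (-a * |t|) : ℂ) = 1 / (a - s * Complex.I) := by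
    have := integral_exp_mul_complex_Ioi (a := -(a : ℂ) + s * Complex.I) (by simpa using ha) 0
    rw [Complex.ofReal_zero, mul_zero, Complex.exp_zero, ← neg_div_neg_eq, neg_neg, neg_add,
      neg_neg, ← sub_eq_add_neg] at this
    rw [← this]
    refine setIntegral_congr_fun measurableSet_Ioi fun t ht => ?_
    rw [abs_of_pos ht, Complex.ofReal_exp, ← Complex.exp_add]
    push_cast
    ring_nf
  have ne_left : (a : ℂ) + s * Complex.I ≠ 0 := fun h0 => by simpa [h0] using hre s
  have ne_right : (a : ℂ) - s * Complex.I ≠ 0 := fun h0 => by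
    simpa [← sub_eq_add_neg, h0] using hre (-s)
  have ne_prod : (a : ℂ) ^ 2 + s ^ 2 ≠ 0 := by exact_mod_cast (by positivity : a ^ 2 + s ^ 2 ≠ 0)
  rw [fourierStieltjes,
    ← intervalIntegral.integral_Iic_add_Ioi hker.integrableOn hker.integrableOn, left, right]
  push_cast
  rw [div_add_div _ _ ne_left ne_right, div_eq_div_iff (mul_ne_zero ne_left ne_right) ne_prod]
  linear_combination (2 * (a : ℂ) * s ^ 2) * Complex.I_sq

theorem summable_one_div_one_add_int_sq : Summable fun k : ℤ => 1 / (1 + (k : ℝ) ^ 2) := by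
  refine Summable.of_norm_bounded_eventually (Real.summable_one_div_int_pow.2 one_lt_two) ?_
  filter_upwards [(Set.finite_singleton (0 : ℤ)).compl_mem_cofinite] with k hk
  have : (k : ℝ) ≠ 0 := by exact_mod_cast hk
  rw [Real.norm_of_nonneg (by positivity)]
  gcongr
  linarith

theorem sum_one_div_one_add_sub_sq_le (i : ℤ) (J : Finset ℤ) :
    ∑ j ∈ J, 1 / (1 + ((i - j : ℤ) : ℝ) ^ 2) ≤ ∑' k : ℤ, 1 / (1 + (k : ℝ) ^ 2) := by
  rw [← (Equiv.subLeft i).tsum_eq fun k : ℤ => 1 / (1 + (k : ℝ) ^ 2)]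
  exact ((Equiv.subLeft i).summable_iff.2 summable_one_div_one_add_int_sq).sum_le_tsum J
    fun j _ => by positivity

end Poisson

section Strichartz

open MeasureTheory

/-- The `j`-th cell of the partition of the line into intervals of length `1 / T`. -/
def cell (T : ℝ) (j : ℤ) : Set ℝ := Set.Ico (j / T) ((j + 1) / T)

variable {T : ℝ}

theorem measurableSet_cell (T : ℝ) (j : ℤ) : MeasurableSet (cell T j) := measurableSet_Ico

theorem mem_cell_iff_floor_eq (hT : 0 < T) {j : ℤ} {x : ℝ} : x ∈ cell T j ↔ ⌊x * T⌋ = j := by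
  rw [cell, Set.mem_Ico, div_le_iff₀ hT, lt_div_iff₀ hT, Int.floor_eq_iff]

theorem pairwise_disjoint_cell (hT : 0 < T) : Pairwise (Function.onFun Disjoint (cell T)) :=
  fun _ _ hij => Set.disjoint_left.2 fun _ hi hj =>
    hij (((mem_cell_iff_floor_eq hT).1 hi).symm.trans ((mem_cell_iff_floor_eq hT).1 hj))

theorem poisson_le_of_mem_cell (hT : 0 < T) {i j : ℤ} {x y : ℝ} (hx : x ∈ cell T i)
    (hy : y ∈ cell T j) : 2 * (2 / T) / ((2 / T) ^ 2 + (x - y) ^ 2) ≤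
      8 * T * (1 / (1 + ((i - j : ℤ) : ℝ) ^ 2)) := by
  rw [cell, Set.mem_Ico, div_le_iff₀ hT, lt_div_iff₀ hT] at hx hy
  set d := (x - y) * T
  have rescale : 2 * (2 / T) / ((2 / T) ^ 2 + (x - y) ^ 2) = 4 * T / (4 + d ^ 2) := by
    rw [div_eq_div_iff (by positivity) (by positivity)]
    field_simp
    ring
  have near : ((i : ℝ) - j - d) ^ 2 ≤ 1 := by
    rw [sq_le_one_iff_abs_le_one, abs_le]
    constructor <;> linarith [show d = (x - y) * T from rfl]
  have spread : ((i - j : ℤ) : ℝ) ^ 2 ≤ 2 + 2 * d ^ 2 := by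
    push_cast
    linarith [sq_nonneg ((i : ℝ) - j - 2 * d)]
  rw [rescale, mul_one_div, div_le_div_iff₀ (by positivity) (by positivity)]
  nlinarith

theorem lintegral_poisson_le {μ : Measure ℝ} (hT : 0 < T) (J : Finset ℤ) {b : ℝ} (hb0 : 0 ≤ b)
    (hb : ∀ j ∈ J, μ (cell T j) ≤ ENNReal.ofReal b) (x : ℝ) :
    ∫⁻ y in ⋃ j ∈ J, cell T j, ENNReal.ofReal (2 * (2 / T) / ((2 / T) ^ 2 + (x - y) ^ 2)) ∂μ ≤
      ENNReal.ofReal (8 * T * b * ∑' k : ℤ, 1 / (1 + (k : ℝ) ^ 2)) := by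
  have hx : x ∈ cell T ⌊x * T⌋ := (mem_cell_iff_floor_eq hT).2 rfl
  rw [lintegral_biUnion_finset ((pairwise_disjoint_cell hT).set_pairwise _)
    (fun j _ => measurableSet_cell T j)]
  calc _ ≤ ∑ j ∈ J, ENNReal.ofReal (8 * T * b * (1 / (1 + ((⌊x * T⌋ - j : ℤ) : ℝ) ^ 2))) := by
        refine Finset.sum_le_sum fun j hj => ?_
        refine (setLIntegral_mono measurable_const fun y hy =>
          ENNReal.ofReal_le_ofReal (poisson_le_of_mem_cell hT hx hy)).trans ?_
        rw [setLIntegral_const, mul_right_comm (8 * T) b, ENNReal.ofReal_mul' hb0]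
        gcongr
        exact hb j hj
    _ ≤ _ := by
        rw [← ENNReal.ofReal_sum_of_nonneg (fun j _ => by positivity), ← Finset.mul_sum]
        exact ENNReal.ofReal_le_ofReal
          (mul_le_mul_of_nonneg_left (sum_one_div_one_add_sub_sq_le _ J) (by positivity))

/-- The exponentially weighted average of `f` over positive times of order `T`. -/
noncomputable def abelMean (T : ℝ) (f : ℝ → ℝ) : ℝ :=
  2 / T * ∫ t in Set.Ioi (0 : ℝ), Real.exp (-2 * t / T) * f t

/-- The constant in Strichartz' estimate `abelMean_norm_sq_fourierStieltjes_le`. -/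
noncomputable def strichartzConst : ℝ := 16 * ∑' k : ℤ, 1 / (1 + (k : ℝ) ^ 2)

theorem strichartzConst_pos : 0 < strichartzConst := by
  refine mul_pos (by norm_num) ?_
  exact summable_one_div_one_add_int_sq.tsum_pos (fun k => by positivity) 0 (by norm_num)

theorem abelMean_norm_sq_fourierStieltjes_le {μ : Measure ℝ} [IsFiniteMeasure μ] (hT : 0 < T)
    (J : Finset ℤ) {b : ℝ} (hb0 : 0 ≤ b) (hb : ∀ j ∈ J, μ (cell T j) ≤ ENNReal.ofReal b)
    {g : ℝ → ℂ} (hg : MemLp g 2 (μ.restrict (⋃ j ∈ J, cell T j))) :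
    abelMean T (fun t => ‖fourierStieltjes (μ.restrict (⋃ j ∈ J, cell T j)) g t‖ ^ 2) ≤
      strichartzConst * b * ∫ x in ⋃ j ∈ J, cell T j, ‖g x‖ ^ 2 ∂μ := by
  set ν := μ.restrict (⋃ j ∈ J, cell T j)
  have hT2 : 0 < 2 / T := by positivity
  have hg1 : Integrable g ν := hg.integrable one_le_two
  have hw := integrable_exp_neg_mul_abs hT2
  have kernel_le (x : ℝ) : ∫⁻ y,
      ‖fourierStieltjes volume (fun t => (Real.exp (-(2 / T) * |t|) : ℂ)) (x - y)‖ₑ ∂ν ≤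
        ENNReal.ofReal (8 * T * b * ∑' k : ℤ, 1 / (1 + (k : ℝ) ^ 2)) := by
    refine le_of_eq_of_le (lintegral_congr fun y => ?_) (lintegral_poisson_le hT J hb0 hb x)
    rw [fourierStieltjes_exp_neg_mul_abs hT2, ← ofReal_norm, Complex.norm_real,
      Real.norm_of_nonneg (by positivity)]
  have half_line : ∫ t in Set.Ioi (0 : ℝ), Real.exp (-2 * t / T) * ‖fourierStieltjes ν g t‖ ^ 2 ≤
      ∫ t : ℝ, Real.exp (-(2 / T) * |t|) * ‖fourierStieltjes ν g t‖ ^ 2 := by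
    refine le_of_eq_of_le (setIntegral_congr_fun measurableSet_Ioi fun t ht => ?_)
      (setIntegral_le_integral (integrable_mul_norm_sq_fourierStieltjes hw hg1)
        (Filter.Eventually.of_forall fun t => by positivity))
    rw [abs_of_pos ht]
    congr 2
    ring
  calc _ ≤ 2 / T * (8 * T * b * (∑' k : ℤ, 1 / (1 + (k : ℝ) ^ 2)) * ∫ x, ‖g x‖ ^ 2 ∂ν) := by
        rw [abelMean]
        gcongr
        refine half_line.trans (integral_mul_norm_sq_fourierStieltjes_le hw hg1 hg ?_ kernel_le)
        exact mul_nonneg (by positivity) (tsum_nonneg fun k => by positivity)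
    _ = _ := by
        rw [strichartzConst]
        field_simp
        ring

end Strichartz

section FourierLaplace

open MeasureTheory Filter Set

/-- The Fourier–Laplace transform `z ↦ ∫₀^∞ e^{izt} f(t) dt`, used for `z` in the upper half
plane. -/
noncomputable def fourierLaplace (f : ℝ → ℂ) (z : ℂ) : ℂ :=
  ∫ t in Ioi (0 : ℝ), Complex.exp (Complex.I * z * t) * f t

variable {f g : ℝ → ℂ} {M N : ℝ} {z : ℂ}

theorem norm_exp_I_mul_mul_ofReal (z : ℂ) (t : ℝ) :
    ‖Complex.exp (Complex.I * z * t)‖ = Real.exp (-(z.im * t)) := by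
  simp [Complex.norm_exp]

theorem integrableOn_exp_I_mul_mul (hf : Continuous f) (hM : ∀ t, ‖f t‖ ≤ M) (hz : 0 < z.im) :
    IntegrableOn (fun t : ℝ => Complex.exp (Complex.I * z * t) * f t) (Ioi 0) :=
  (integrableOn_exp_mul_complex_Ioi (a := Complex.I * z) (by simpa using hz) 0).mul_bdd
    hf.aestronglyMeasurable (Eventually.of_forall hM)

theorem tendsto_exp_I_mul_mul_atTop (hM : ∀ t, ‖f t‖ ≤ M) (hz : 0 < z.im) :
    Tendsto (fun t : ℝ => Complex.exp (Complex.I * z * t) * f t) atTop (nhds 0) := by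
  have decay : Tendsto (fun t : ℝ => Real.exp (-(z.im * t)) * M) atTop (nhds 0) := by
    simpa using! (Real.tendsto_exp_neg_atTop_nhds_zero.comp
      (tendsto_id.const_mul_atTop hz)).mul_const M
  refine squeeze_zero_norm (fun t => ?_) decay
  rw [norm_mul, norm_exp_I_mul_mul_ofReal]
  gcongr
  exact hM t

theorem fourierLaplace_deriv (hf : Continuous f) (hM : ∀ t, ‖f t‖ ≤ M) (hg : Continuous g)
    (hN : ∀ t, ‖g t‖ ≤ N) (hderiv : ∀ t, HasDerivAt f (g t) t) (hz : 0 < z.im) :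
    fourierLaplace g z = -f 0 - Complex.I * z * fourierLaplace f z := by
  have hexp (t : ℝ) : HasDerivAt (fun t : ℝ => Complex.exp (Complex.I * z * t))
      (Complex.exp (Complex.I * z * t) * (Complex.I * z)) t := by
    simpa using ((Complex.ofRealCLM.hasDerivAt (x := t)).const_mul (Complex.I * z)).cexp
  have hker := (integrableOn_exp_I_mul_mul hf hM hz).const_mul (Complex.I * z)
  have := integral_Ioi_of_hasDerivAt_of_tendsto' (a := 0) (fun t _ => (hexp t).mul (hderiv t))
    ((hker.add (integrableOn_exp_I_mul_mul hg hN hz)).congr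
      (Eventually.of_forall fun t => by simp only [Pi.add_apply]; ring))
    (tendsto_exp_I_mul_mul_atTop hM hz)
  simp only [mul_assoc _ (Complex.I * z), mul_left_comm _ (Complex.I * z)] at this
  rw [integral_add hker (integrableOn_exp_I_mul_mul hg hN hz), integral_const_mul] at this
  simp only [Pi.mul_apply, Complex.ofReal_zero, mul_zero, Complex.exp_zero, one_mul,
    zero_sub] at this
  rw [fourierLaplace, fourierLaplace]
  linear_combination this

theorem fourierLaplace_fourierStieltjes (μ : Measure ℝ) [IsFiniteMeasure μ] (hz : 0 < z.im) :
    Complex.I * fourierLaplace (fun t => fourierStieltjes μ 1 (-t)) z =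
      ∫ x : ℝ, 1 / ((x : ℂ) - z) ∂μ := by
  have hker : Integrable (fun q : ℝ × ℝ => Complex.exp (Complex.I * (z - q.2) * q.1))
      ((volume.restrict (Ioi 0)).prod μ) := by
    refine (Integrable.mul_prod (f := fun t : ℝ => Complex.exp (Complex.I * z * t))
      (integrableOn_exp_mul_complex_Ioi (a := Complex.I * z) (by simpa using hz) 0)
      (integrable_const (1 : ℂ))).mono (by apply Continuous.aestronglyMeasurable; fun_prop)
      (Eventually.of_forall fun q => ?_)
    rw [mul_one, norm_exp_I_mul_mul_ofReal, norm_exp_I_mul_mul_ofReal, Complex.sub_im,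
      Complex.ofReal_im, sub_zero]
  calc Complex.I * fourierLaplace (fun t => fourierStieltjes μ 1 (-t)) z
      = Complex.I * ∫ t in Ioi (0 : ℝ), ∫ x : ℝ, Complex.exp (Complex.I * (z - x) * t) ∂μ := by
        congr 1
        refine integral_congr_ae (Eventually.of_forall fun t => ?_)
        simp only [fourierStieltjes, ← integral_const_mul, Pi.one_apply, mul_one,
          ← Complex.exp_add]
        push_cast
        ring_nf
    _ = ∫ x : ℝ, Complex.I * (∫ t : ℝ in Ioi 0, Complex.exp (Complex.I * (z - x) * t)) ∂μ := by
        rw [integral_integral_swap hker, integral_const_mul]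
    _ = ∫ x : ℝ, 1 / ((x : ℂ) - z) ∂μ := by
        congr with x
        have hne : z - x ≠ 0 := fun h => hz.ne' (by simpa using congrArg Complex.im h)
        have hne' : (x : ℂ) - z ≠ 0 := by simpa [sub_eq_zero, eq_comm] using hne
        rw [integral_exp_mul_complex_Ioi (by simpa using hz), Complex.ofReal_zero, mul_zero,
          Complex.exp_zero]
        field_simp
        ring

theorem eq_zero_of_fourierLaplace_eq_zero (hf : Continuous f) (hM : ∀ t, ‖f t‖ ≤ M)
    (h0 : ∀ z : ℂ, 0 < z.im → fourierLaplace f z = 0) {t : ℝ} (ht : 0 < t) : f t = 0 := by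
  set F : ℝ → ℂ := (Ioi 0).indicator fun t => Complex.exp (Complex.I * Complex.I * t) * f t
  have F_int : Integrable F := (integrable_indicator_iff measurableSet_Ioi).2
    (integrableOn_exp_I_mul_mul hf hM (by simp))
  have fourier_F : FourierTransform.fourier F = (0 : ℝ → ℂ) := by
    funext ξ
    rw [Pi.zero_apply, ← h0 (-2 * Real.pi * ξ + Complex.I) (by simp), fourierLaplace,
      ← integral_indicator measurableSet_Ioi, Real.fourier_real_eq_integral_exp_smul]
    congr with v
    by_cases hv : v ∈ Ioi (0 : ℝ)
    · simp only [F, indicator_of_mem hv, smul_eq_mul, ← mul_assoc, ← Complex.exp_add]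
      push_cast
      ring_nf
    · simp only [F, indicator_of_notMem hv, smul_zero]
  have F_cont : ContinuousAt F t := by
    refine (by fun_prop : ContinuousAt (fun t : ℝ =>
      Complex.exp (Complex.I * Complex.I * t) * f t) t).congr ?_
    filter_upwards [Ioi_mem_nhds ht] with s hs
    simp only [F, indicator_of_mem hs]
  have inversion := F_int.fourierInv_fourier_eq
    (fourier_F ▸ integrable_zero ℝ ℂ volume) F_cont
  rw [fourier_F, Real.fourierInv_eq'] at inversion
  simp only [Pi.zero_apply, smul_zero, integral_zero, F, indicator_of_mem (mem_Ioi.2 ht)]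
    at inversion
  exact (mul_eq_zero.1 inversion.symm).resolve_left (Complex.exp_ne_zero _)

theorem eq_of_fourierLaplace_eq (hf : Continuous f) (hM : ∀ t, ‖f t‖ ≤ M)
    (f_symm : ∀ t, f (-t) = star (f t)) (hg : Continuous g) (hN : ∀ t, ‖g t‖ ≤ N)
    (g_symm : ∀ t, g (-t) = star (g t))
    (h : ∀ z : ℂ, 0 < z.im → fourierLaplace f z = fourierLaplace g z) : f = g := by
  have pos : EqOn f g (Ioi 0) := fun t ht => sub_eq_zero.1 <|
    eq_zero_of_fourierLaplace_eq_zero (f := f - g) (hf.sub hg)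
      (fun t => (norm_sub_le _ _).trans (add_le_add (hM t) (hN t)))
      (fun z hz => by
        simp only [fourierLaplace, Pi.sub_apply, mul_sub]
        rw [integral_sub (integrableOn_exp_I_mul_mul hf hM hz)
          (integrableOn_exp_I_mul_mul hg hN hz)]
        exact sub_eq_zero.2 (h z hz)) ht
  have nonneg : EqOn f g (Ici 0) := closure_Ioi (0 : ℝ) ▸ pos.closure hf hg
  funext t
  rcases le_total 0 t with ht | ht
  · exact nonneg ht
  · rw [← neg_neg t, f_symm, g_symm, nonneg (neg_nonneg.2 ht)]

end FourierLaplace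

section FourierUniqueness

open MeasureTheory

variable {μ : Measure ℝ}

theorem charFun_withDensity_ofReal {r : ℝ → ℝ} (hr : Integrable r μ) (t : ℝ) :
    charFun (μ.withDensity fun x => ENNReal.ofReal (r x)) t =
      fourierStieltjes μ (fun x => ((max (r x) 0 : ℝ) : ℂ)) t := by
  rw [charFun_apply_real, integral_withDensity_eq_integral_toReal_smul₀
    hr.aestronglyMeasurable.aemeasurable.ennreal_ofReal
    (Filter.Eventually.of_forall fun x => ENNReal.ofReal_lt_top), fourierStieltjes]
  congr with x
  rw [ENNReal.toReal_ofReal', Complex.real_smul, mul_comm]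
  ring_nf

theorem ae_eq_zero_of_fourierStieltjes_ofReal_eq_zero {r : ℝ → ℝ}
    (hr : Integrable r μ) (h : ∀ t, fourierStieltjes μ (fun x => (r x : ℂ)) t = 0) :
    r =ᵐ[μ] 0 := by
  have hr' : Integrable (fun x => -r x) μ := hr.neg
  have pos_part_int (r : ℝ → ℝ) (hr : Integrable r μ) :
      Integrable (fun x => ((max (r x) 0 : ℝ) : ℂ)) μ := hr.pos_part.ofReal
  have := isFiniteMeasure_withDensity_ofReal hr.2
  have := isFiniteMeasure_withDensity_ofReal hr'.2
  have densities_eq : (μ.withDensity fun x => ENNReal.ofReal (r x)) =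
      μ.withDensity fun x => ENNReal.ofReal (-r x) := by
    refine Measure.ext_of_charFun (funext fun t => ?_)
    rw [charFun_withDensity_ofReal hr, charFun_withDensity_ofReal hr', ← sub_eq_zero, ← h t,
      fourierStieltjes, fourierStieltjes, fourierStieltjes,
      ← integral_sub (integrable_exp_I_mul (pos_part_int _ hr) t)
        (integrable_exp_I_mul (pos_part_int _ hr') t)]
    congr with x
    rw [← mul_sub, ← Complex.ofReal_sub, max_zero_sub_max_neg_zero_eq_self]
  rw [withDensity_eq_iff hr.aestronglyMeasurable.aemeasurable.ennreal_ofReal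
    hr'.aestronglyMeasurable.aemeasurable.ennreal_ofReal hr.lintegral_lt_top.ne] at densities_eq
  filter_upwards [densities_eq] with x hx
  have hmax := congrArg ENNReal.toReal hx
  rw [ENNReal.toReal_ofReal', ENNReal.toReal_ofReal'] at hmax
  rw [Pi.zero_apply, ← max_zero_sub_max_neg_zero_eq_self (r x), sub_eq_zero]
  exact hmax

theorem re_ae_eq_zero_of_fourierStieltjes_eq_zero {g : ℝ → ℂ}
    (hg : Integrable g μ) (h : ∀ t, fourierStieltjes μ g t = 0) : (fun x => (g x).re) =ᵐ[μ] 0 := by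
  refine ae_eq_zero_of_fourierStieltjes_ofReal_eq_zero hg.re fun t => ?_
  have hstar : Integrable (fun x => star (g x)) μ :=
    Complex.conjCLE.toContinuousLinearMap.integrable_comp hg
  have conj_eq_zero : fourierStieltjes μ (fun x => star (g x)) t = 0 := by
    rw [← neg_neg t, ← star_fourierStieltjes, h, star_zero]
  calc fourierStieltjes μ (fun x => ((g x).re : ℂ)) t
      = 2⁻¹ * (fourierStieltjes μ g t + fourierStieltjes μ (fun x => star (g x)) t) := by
        rw [fourierStieltjes, fourierStieltjes, fourierStieltjes,
          ← integral_add (integrable_exp_I_mul hg t) (integrable_exp_I_mul hstar t),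
          ← integral_const_mul]
        congr with x
        rw [Complex.re_eq_add_conj, Complex.star_def]
        ring
    _ = 0 := by rw [h, conj_eq_zero, add_zero, mul_zero]

theorem ae_eq_zero_of_fourierStieltjes_eq_zero {g : ℝ → ℂ}
    (hg : Integrable g μ) (h : ∀ t, fourierStieltjes μ g t = 0) : g =ᵐ[μ] 0 := by
  have im_zero := re_ae_eq_zero_of_fourierStieltjes_eq_zero (hg.const_mul (-Complex.I)) fun t => by
    simp only [fourierStieltjes, mul_left_comm _ (-Complex.I), integral_const_mul]
    rw [← fourierStieltjes, h, mul_zero]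
  filter_upwards [re_ae_eq_zero_of_fourierStieltjes_eq_zero hg h, im_zero] with x hre him
  exact Complex.ext hre (by simpa using him)

end FourierUniqueness

section UnitaryGroup

open MeasureTheory

variable {E : Type*} [NormedAddCommGroup E] [InnerProductSpace ℂ E] {T : E →ₗ.[ℂ] E}
  {U : ℝ → E →L[ℂ] E}

theorem IsUnitaryGroup.inner_map_map (hU : IsUnitaryGroup T U) (t : ℝ) (φ ψ : E) :
    inner ℂ (U t φ) (U t ψ) = inner ℂ φ ψ :=
  LinearIsometry.inner_map_map (⟨(U t : E →ₗ[ℂ] E), hU.norm_map t⟩ : E →ₗᵢ[ℂ] E) φ ψ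

theorem IsUnitaryGroup.inner_map_eq (hU : IsUnitaryGroup T U) (s t : ℝ) (φ ψ : E) :
    inner ℂ (U s φ) (U t ψ) = inner ℂ φ (U (t - s) ψ) := by
  rw [← hU.inner_map_map s φ, ← mul_apply_eq_comp, ← hU.add,
    add_sub_cancel]

theorem IsUnitaryGroup.norm_inner_le (hU : IsUnitaryGroup T U) (χ φ : E) (t : ℝ) :
    ‖inner ℂ χ (U t φ)‖ ≤ ‖χ‖ * ‖φ‖ := by
  simpa only [hU.norm_map] using norm_inner_le_norm (𝕜 := ℂ) χ (U t φ)

theorem IsUnitaryGroup.continuous_inner (hU : IsUnitaryGroup T U) (χ φ : E) :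
    Continuous fun t => inner ℂ χ (U t φ) :=
  continuous_const.inner (hU.continuous φ)

theorem IsUnitaryGroup.hasDerivAt_inner (hU : IsUnitaryGroup T U) (χ : E) (ψ : T.domain) (t : ℝ) :
    HasDerivAt (fun t => inner ℂ χ (U t (ψ : E))) (-Complex.I * inner ℂ χ (U t (T ψ))) t := by
  have deriv_at_zero : HasDerivAt (fun s => U s (ψ : E)) (-Complex.I • T ψ) (t - t) := by
    simpa only [sub_self] using hU.hasDerivAt ψ
  have deriv_shift : HasDerivAt (fun s => U (s - t) (ψ : E)) (-Complex.I • T ψ) t := by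
    simpa only [one_smul] using!
      deriv_at_zero.scomp (h := fun s => s - t) t ((hasDerivAt_id t).sub_const t)
  have deriv_orbit := ((U t).restrictScalars ℝ).hasFDerivAt.comp_hasDerivAt t deriv_shift
  have group_law : (U t).restrictScalars ℝ ∘ (fun s => U (s - t) (ψ : E)) =
      fun s => U s (ψ : E) := by
    funext s
    change U t (U (s - t) (ψ : E)) = _
    rw [← mul_apply_eq_comp, ← hU.add, add_sub_cancel]
  rw [group_law] at deriv_orbit
  simpa [inner_smul_right] using (hasDerivAt_const t χ).inner ℂ deriv_orbit

theorem IsUnitaryGroup.inner_resolvent (hU : IsUnitaryGroup T U) (χ φ : E) {z : ℂ} (hz : 0 < z.im)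
    (ψ : T.domain) (hψ : T ψ - z • (ψ : E) = φ) :
    inner ℂ χ (ψ : E) = Complex.I * fourierLaplace (fun t => inner ℂ χ (U t φ)) z := by
  have deriv_transform := fourierLaplace_deriv (hU.continuous_inner χ ψ) (hU.norm_inner_le χ ψ)
    (g := fun t => -Complex.I * inner ℂ χ (U t (T ψ)))
    (continuous_const.mul (hU.continuous_inner χ (T ψ)))
    (fun t => by simpa using hU.norm_inner_le χ (T ψ) t) (hU.hasDerivAt_inner χ ψ) hz
  have split : fourierLaplace (fun t => -Complex.I * inner ℂ χ (U t (T ψ))) z =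
      -Complex.I * (fourierLaplace (fun t => inner ℂ χ (U t φ)) z +
        z * fourierLaplace (fun t => inner ℂ χ (U t (ψ : E))) z) := by
    simp only [fourierLaplace]
    rw [← integral_const_mul z, ← integral_add
      (integrableOn_exp_I_mul_mul (hU.continuous_inner χ φ) (hU.norm_inner_le χ φ) hz)
      ((integrableOn_exp_I_mul_mul (hU.continuous_inner χ ψ) (hU.norm_inner_le χ ψ)
        hz).const_mul z), ← integral_const_mul]
    congr with t
    rw [← hψ, map_sub, map_smul, inner_sub_right, inner_smul_right]
    ring
  rw [split] at deriv_transform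
  simp only [hU.zero, one_apply_eq_self] at deriv_transform
  linear_combination deriv_transform

theorem IsUnitaryGroup.inner_self_eq (hU : IsUnitaryGroup T U) {φ : E} {μ : Measure ℝ}
    (hμ : IsSpectralMeasure T φ μ) (t : ℝ) :
    inner ℂ φ (U t φ) = fourierStieltjes μ 1 (-t) := by
  have := hμ.finite
  refine congrFun (eq_of_fourierLaplace_eq (f := fun t => inner ℂ φ (U t φ))
    (hU.continuous_inner φ φ) (hU.norm_inner_le φ φ) (fun t => ?_)
    (g := fun t => fourierStieltjes μ 1 (-t))
    ((continuous_fourierStieltjes (integrable_const (1 : ℂ))).comp continuous_neg)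
    (fun t => norm_fourierStieltjes_le μ 1 (-t)) (fun t => ?_) fun z hz => ?_) t
  · rw [Complex.star_def, inner_conj_symm, ← zero_sub t, ← hU.inner_map_eq t, hU.zero,
      one_apply_eq_self]
  · rw [star_fourierStieltjes]
    simp [Pi.one_def]
  · obtain ⟨ψ, resolvent_eq, borel_eq⟩ := hμ.borel z hz.ne'
    rw [hU.inner_resolvent φ φ hz ψ resolvent_eq, ← fourierLaplace_fourierStieltjes μ hz]
      at borel_eq
    exact mul_left_cancel₀ Complex.I_ne_zero borel_eq

end UnitaryGroup

section CyclicSubspace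

open MeasureTheory

theorem memLp_exp (μ : Measure ℝ) [IsFiniteMeasure μ] (t : ℝ) :
    MemLp (fun x : ℝ => Complex.exp (Complex.I * ((-t : ℝ) * x))) 2 μ :=
  MemLp.of_bound (by apply Continuous.aestronglyMeasurable; fun_prop) 1
    (Filter.Eventually.of_forall fun x => (norm_exp_I_mul_mul (-t) x).le)

/-- The function `x ↦ e^{-itx}` as an element of `L²(μ)`; it represents the state at time `t`. -/
noncomputable def expLp (μ : Measure ℝ) [IsFiniteMeasure μ] (t : ℝ) : Lp ℂ 2 μ :=
  (memLp_exp μ t).toLp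

variable {μ : Measure ℝ} [IsFiniteMeasure μ]

theorem inner_expLp_left (t : ℝ) (g : Lp ℂ 2 μ) :
    inner ℂ (expLp μ t) g = fourierStieltjes μ g t := by
  rw [L2.inner_def]
  refine integral_congr_ae ?_
  filter_upwards [(memLp_exp μ t).coeFn_toLp] with x hx
  rw [expLp, hx, RCLike.inner_apply', ← Complex.exp_conj]
  simp

theorem inner_expLp_expLp (s t : ℝ) :
    inner ℂ (expLp μ s) (expLp μ t) = fourierStieltjes μ 1 (s - t) := by
  rw [inner_expLp_left]
  refine integral_congr_ae ?_
  filter_upwards [(memLp_exp μ t).coeFn_toLp] with x hx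
  rw [expLp, hx, ← Complex.exp_add, Pi.one_apply, mul_one]
  push_cast
  ring_nf

theorem denseRange_linearCombination_expLp :
    DenseRange (Finsupp.linearCombination ℂ (expLp μ)) := by
  refine Submodule.dense_iff_topologicalClosure_eq_top (s := LinearMap.range _).2 ?_
  rw [Submodule.topologicalClosure_eq_top_iff, Submodule.eq_bot_iff]
  refine fun g hg => (Lp.eq_zero_iff_ae_eq_zero).2 <|
    ae_eq_zero_of_fourierStieltjes_eq_zero ((Lp.memLp g).integrable one_le_two) fun t => ?_
  rw [← inner_expLp_left]
  exact hg _ ⟨Finsupp.single t 1, by simp⟩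

theorem norm_linearCombination_eq {ι E F : Type*} [NormedAddCommGroup E] [InnerProductSpace ℂ E]
    [NormedAddCommGroup F] [InnerProductSpace ℂ F] {v : ι → E} {w : ι → F}
    (h : ∀ i j, inner ℂ (v i) (v j) = inner ℂ (w i) (w j)) (a : ι →₀ ℂ) :
    ‖Finsupp.linearCombination ℂ v a‖ = ‖Finsupp.linearCombination ℂ w a‖ := by
  rw [← sq_eq_sq₀ (norm_nonneg _) (norm_nonneg _), ← inner_self_eq_norm_sq (𝕜 := ℂ),
    ← inner_self_eq_norm_sq (𝕜 := ℂ)]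
  simp only [Finsupp.linearCombination_apply, Finsupp.sum, sum_inner, inner_sum, inner_smul_left,
    inner_smul_right, h]

variable {E : Type*} [NormedAddCommGroup E] [InnerProductSpace ℂ E] [CompleteSpace E]
  {T : E →ₗ.[ℂ] E} {U : ℝ → E →L[ℂ] E} {φ : E}

theorem IsUnitaryGroup.exists_isometry (hU : IsUnitaryGroup T U) (hμ : IsSpectralMeasure T φ μ) :
    ∃ W : Lp ℂ 2 μ →ₗᵢ[ℂ] E, ∀ t, W (expLp μ t) = U t φ := by
  let e := Finsupp.linearCombination ℂ (expLp μ)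
  let f := Finsupp.linearCombination ℂ (fun t => U t φ)
  have e_dense : DenseRange e := denseRange_linearCombination_expLp
  have norm_eq (a : ℝ →₀ ℂ) : ‖f a‖ = ‖e a‖ := norm_linearCombination_eq (fun s t => by
    rw [hU.inner_map_eq, hU.inner_self_eq hμ, inner_expLp_expLp, neg_sub]) a
  have extend_eq (a : ℝ →₀ ℂ) : f.extendOfNorm e (e a) = f a :=
    LinearMap.extendOfNorm_eq e_dense ⟨1, fun x => by rw [norm_eq, one_mul]⟩ a
  refine ⟨⟨f.extendOfNorm e, fun g => ?_⟩, fun t => ?_⟩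
  · refine e_dense.induction (P := fun g => ‖f.extendOfNorm e g‖ = ‖g‖) ?_
      (isClosed_eq (by fun_prop) (by fun_prop)) g
    rintro _ ⟨a, rfl⟩
    rw [extend_eq, norm_eq]
  · simpa [e, f] using! extend_eq (Finsupp.single t 1)

variable {W : Lp ℂ 2 μ →ₗᵢ[ℂ] E}

theorem IsUnitaryGroup.adjoint_map_ae_eq (hU : IsUnitaryGroup T U)
    (hW : ∀ t, W (expLp μ t) = U t φ) (χ : E) (t : ℝ) :
    W.toContinuousLinearMap.adjoint (U (-t) χ) =ᵐ[μ]
      fun x => Complex.exp (Complex.I * (t * x)) * W.toContinuousLinearMap.adjoint χ x := by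
  have integrable_coe (g : Lp ℂ 2 μ) : Integrable g μ := (Lp.memLp g).integrable one_le_two
  have modulated_int := integrable_exp_I_mul (integrable_coe (W.toContinuousLinearMap.adjoint χ)) t
  have same_transform (s : ℝ) :
      fourierStieltjes μ (W.toContinuousLinearMap.adjoint (U (-t) χ)) s =
        fourierStieltjes μ
          (fun x => Complex.exp (Complex.I * (t * x)) * W.toContinuousLinearMap.adjoint χ x) s :=
    calc fourierStieltjes μ (W.toContinuousLinearMap.adjoint (U (-t) χ)) s
        = inner ℂ (U s φ) (U (-t) χ) := by
          rw [← inner_expLp_left, ContinuousLinearMap.adjoint_inner_right, ← hW]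
          rfl
      _ = inner ℂ (U (s + t) φ) (U 0 χ) := by
          rw [hU.inner_map_eq, hU.inner_map_eq]
          ring_nf
      _ = fourierStieltjes μ (W.toContinuousLinearMap.adjoint χ) (s + t) := by
          rw [← inner_expLp_left, ContinuousLinearMap.adjoint_inner_right, ← hW, hU.zero]
          rfl
      _ = _ := by
          simp only [fourierStieltjes, ← mul_assoc, ← Complex.exp_add]
          push_cast
          ring_nf
  have diff_zero := ae_eq_zero_of_fourierStieltjes_eq_zero
    ((integrable_coe (W.toContinuousLinearMap.adjoint (U (-t) χ))).sub modulated_int) fun s => by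
      simp only [fourierStieltjes, Pi.sub_apply, mul_sub]
      rw [integral_sub (integrable_exp_I_mul (integrable_coe _) s)
        (integrable_exp_I_mul modulated_int s)]
      exact sub_eq_zero.2 (same_transform s)
  filter_upwards [diff_zero] with x hx using sub_eq_zero.1 hx

theorem IsUnitaryGroup.inner_map_indicator (hU : IsUnitaryGroup T U)
    (hW : ∀ t, W (expLp μ t) = U t φ) {A : Set ℝ} (hA : MeasurableSet A) (χ : E) (t : ℝ) :
    inner ℂ χ (U t (W (indicatorConstLp 2 hA (measure_ne_top μ A) (1 : ℂ)))) =
      star (fourierStieltjes (μ.restrict A) (W.toContinuousLinearMap.adjoint χ) t) := by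
  set a := indicatorConstLp 2 hA (measure_ne_top μ A) (1 : ℂ)
  calc inner ℂ χ (U t (W a)) = inner ℂ (U (-t) χ) (U 0 (W a)) := by
        rw [hU.inner_map_eq, zero_sub, neg_neg]
    _ = inner ℂ (W.toContinuousLinearMap.adjoint (U (-t) χ)) a := by
        rw [ContinuousLinearMap.adjoint_inner_left, hU.zero]
        rfl
    _ = star (∫ x in A, W.toContinuousLinearMap.adjoint (U (-t) χ) x ∂μ) := by
        rw [← inner_conj_symm, L2.inner_indicatorConstLp_one, Complex.star_def]
    _ = star (fourierStieltjes (μ.restrict A) (W.toContinuousLinearMap.adjoint χ) t) := by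
        rw [integral_congr_ae (ae_restrict_of_ae (hU.adjoint_map_ae_eq hW χ t)),
          fourierStieltjes]

theorem IsUnitaryGroup.abelMean_norm_sq_inner_le (hU : IsUnitaryGroup T U)
    (hW : ∀ t, W (expLp μ t) = U t φ) {τ : ℝ} (hτ : 0 < τ) (J : Finset ℤ) {b : ℝ} (hb0 : 0 ≤ b)
    (hb : ∀ j ∈ J, μ (cell τ j) ≤ ENNReal.ofReal b) (hJ : MeasurableSet (⋃ j ∈ J, cell τ j))
    (χ : E) :
    abelMean τ (fun t => ‖inner ℂ χ
        (U t (W (indicatorConstLp 2 hJ (measure_ne_top μ _) (1 : ℂ))))‖ ^ 2) ≤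
      strichartzConst * b * ‖χ‖ ^ 2 := by
  simp only [hU.inner_map_indicator hW hJ, norm_star]
  set h := W.toContinuousLinearMap.adjoint χ
  have norm_h_le : ‖h‖ ≤ ‖χ‖ :=
    (W.toContinuousLinearMap.adjoint.le_of_opNorm_le
      ((LinearIsometryEquiv.norm_map _ _).trans_le W.norm_toContinuousLinearMap_le) χ).trans_eq
      (one_mul _)
  refine (abelMean_norm_sq_fourierStieltjes_le hτ J hb0 hb ((Lp.memLp h).restrict _)).trans ?_
  have := strichartzConst_pos
  gcongr
  calc ∫ x in ⋃ j ∈ J, cell τ j, ‖h x‖ ^ 2 ∂μ ≤ ∫ x, ‖h x‖ ^ 2 ∂μ :=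
        setIntegral_le_integral
          ((memLp_two_iff_integrable_sq_norm (Lp.aestronglyMeasurable h)).1 (Lp.memLp h))
          (Filter.Eventually.of_forall fun x => by positivity)
    _ = ‖h‖ ^ 2 := by rw [← norm_toLp_sq (Lp.memLp h), Lp.toLp_coeFn]
    _ ≤ ‖χ‖ ^ 2 := by gcongr

end CyclicSubspace

section TruncatedSums

/-- The weight of the site `n` in the truncated norm `‖·‖_L`: it is `1` up to `L`, `0` from `L + 1`
on, and linear in between. -/
noncomputable def cutoff (L : ℝ) (n : ℕ) : ℝ := max 0 (min 1 (L + 1 - n))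

/-- The sum of `f 1, f 2, …` truncated at the real length `L`, as in the definition of `‖·‖_L`. -/
noncomputable def truncSum (f : ℕ → ℝ) (L : ℝ) : ℝ :=
  ∑ n ∈ Finset.Icc 1 (⌊L⌋₊ + 1), cutoff L n * f n

variable {f g : ℕ → ℝ} {K L : ℝ} {m n N : ℕ}

theorem cutoff_nonneg (L : ℝ) (n : ℕ) : 0 ≤ cutoff L n := le_max_left _ _

theorem cutoff_le_one (L : ℝ) (n : ℕ) : cutoff L n ≤ 1 := max_le zero_le_one (min_le_left _ _)

theorem cutoff_mono (h : K ≤ L) (n : ℕ) : cutoff K n ≤ cutoff L n := by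
  unfold cutoff
  gcongr

theorem cutoff_eq_one (h : (n : ℝ) ≤ L) : cutoff L n = 1 := by
  rw [cutoff, min_eq_left (by linarith), max_eq_right zero_le_one]

theorem cutoff_eq_zero (h : L + 1 ≤ n) : cutoff L n = 0 :=
  max_eq_left ((min_le_right _ _).trans (by linarith))

theorem lt_add_one_of_cutoff_ne_zero (h : cutoff L n ≠ 0) : (n : ℝ) < L + 1 := by
  contrapose! h
  exact cutoff_eq_zero h

theorem truncSum_eq_sum (f : ℕ → ℝ) (hN : ⌊L⌋₊ + 1 ≤ N) :
    truncSum f L = ∑ n ∈ Finset.Icc 1 N, cutoff L n * f n := by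
  refine Finset.sum_subset (Finset.Icc_subset_Icc_right hN) fun n hn hn' => ?_
  have : ⌊L⌋₊ + 1 < n := by
    rw [Finset.mem_Icc] at hn hn'
    omega
  have : ((⌊L⌋₊ + 1 : ℕ) : ℝ) + 1 ≤ n := by exact_mod_cast this
  push_cast at this
  rw [cutoff_eq_zero (by linarith [Nat.lt_floor_add_one L]), zero_mul]

theorem truncSum_nonneg (hf : ∀ n, 0 ≤ f n) (L : ℝ) : 0 ≤ truncSum f L :=
  Finset.sum_nonneg fun n _ => mul_nonneg (cutoff_nonneg L n) (hf n)

theorem truncSum_le_truncSum (hfg : ∀ n, f n ≤ g n) (L : ℝ) : truncSum f L ≤ truncSum g L :=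
  Finset.sum_le_sum fun n _ => mul_le_mul_of_nonneg_left (hfg n) (cutoff_nonneg L n)

theorem truncSum_mono (hf : ∀ n, 0 ≤ f n) (h : K ≤ L) : truncSum f K ≤ truncSum f L := by
  rw [truncSum_eq_sum f (Nat.succ_le_succ (Nat.floor_mono h)), truncSum]
  exact Finset.sum_le_sum fun n _ => mul_le_mul_of_nonneg_right (cutoff_mono h n) (hf n)

theorem truncSum_add (f g : ℕ → ℝ) (L : ℝ) :
    truncSum (fun n => f n + g n) L = truncSum f L + truncSum g L := by
  simp only [truncSum, mul_add, Finset.sum_add_distrib]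

theorem truncSum_const_mul (c : ℝ) (f : ℕ → ℝ) (L : ℝ) :
    truncSum (fun n => c * f n) L = c * truncSum f L := by
  simp only [truncSum, mul_left_comm _ c, Finset.mul_sum]

theorem truncSum_one (f : ℕ → ℝ) : truncSum f 1 = f 1 := by
  rw [truncSum, Nat.floor_one, Finset.sum_eq_single_of_mem 1 (by simp) fun n hn hn' => ?_,
    cutoff_eq_one (by simp), one_mul]
  obtain rfl : n = 2 := by
    rw [Finset.mem_Icc] at hn
    omega
  rw [cutoff_eq_zero (by norm_num), zero_mul]

theorem continuousOn_truncSum (f : ℕ → ℝ) (M : ℝ) : ContinuousOn (truncSum f) (Set.Iic M) := by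
  have : Continuous fun L => ∑ n ∈ Finset.Icc 1 (⌊M⌋₊ + 1), cutoff L n * f n := by
    unfold cutoff
    fun_prop
  exact this.continuousOn.congr fun L hL =>
    truncSum_eq_sum f (Nat.succ_le_succ (Nat.floor_mono (Set.mem_Iic.1 hL)))

theorem sum_Ico_le_truncSum (hf : ∀ n, 0 ≤ f n) (hn : cutoff L n ≠ 0) :
    ∑ m ∈ Finset.Ico 1 n, f m ≤ truncSum f L := by
  have n_lt := lt_add_one_of_cutoff_ne_zero hn
  have m_le {m : ℕ} (hm : m ∈ Finset.Ico 1 n) : (m : ℝ) ≤ L := by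
    have : (m : ℝ) + 1 ≤ n := by exact_mod_cast (Finset.mem_Ico.1 hm).2
    linarith
  calc ∑ m ∈ Finset.Ico 1 n, f m = ∑ m ∈ Finset.Ico 1 n, cutoff L m * f m :=
        Finset.sum_congr rfl fun m hm => by rw [cutoff_eq_one (m_le hm), one_mul]
    _ ≤ truncSum f L := Finset.sum_le_sum_of_subset_of_nonneg
        (fun m hm => Finset.mem_Icc.2
          ⟨(Finset.mem_Ico.1 hm).1, (Nat.le_floor (m_le hm)).trans (Nat.le_succ _)⟩)
        fun m _ _ => mul_nonneg (cutoff_nonneg L m) (hf m)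

theorem rpow_mul_truncSum_sub_le {p : ℝ} (hp : 0 ≤ p) (hK : 0 ≤ K) (hKL : K ≤ L)
    (hf : ∀ n, 0 ≤ f n) :
    K ^ p * (truncSum f L - truncSum f K) ≤ ∑ n ∈ Finset.Icc 1 (⌊L⌋₊ + 1), (n : ℝ) ^ p * f n := by
  rw [truncSum_eq_sum f (Nat.succ_le_succ (Nat.floor_mono hKL)), truncSum,
    ← Finset.sum_sub_distrib, Finset.mul_sum]
  refine Finset.sum_le_sum fun n _ => ?_
  rw [← sub_mul, ← mul_assoc]
  refine mul_le_mul_of_nonneg_right ?_ (hf n)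
  rcases le_or_gt (n : ℝ) K with h | h
  · rw [cutoff_eq_one h, cutoff_eq_one (h.trans hKL), sub_self, mul_zero]
    positivity
  · have : cutoff L n - cutoff K n ≤ 1 := by linarith [cutoff_le_one L n, cutoff_nonneg K n]
    calc K ^ p * (cutoff L n - cutoff K n) ≤ K ^ p * 1 := by gcongr
      _ ≤ (n : ℝ) ^ p := by
        rw [mul_one]
        gcongr

theorem truncSum_norm_add_sq_le (a b : ℕ → ℂ) {δ : ℝ} (hδ : 0 < δ) (L : ℝ) :
    truncSum (fun n => ‖a n + b n‖ ^ 2) L ≤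
      (1 + δ) * truncSum (fun n => ‖a n‖ ^ 2) L +
        (1 + 1 / δ) * truncSum (fun n => ‖b n‖ ^ 2) L := by
  rw [← truncSum_const_mul, ← truncSum_const_mul, ← truncSum_add]
  refine truncSum_le_truncSum (fun n => ?_) L
  have cross : 2 * ‖a n‖ * ‖b n‖ ≤ δ * ‖a n‖ ^ 2 + 1 / δ * ‖b n‖ ^ 2 := by
    have : δ * ‖a n‖ ^ 2 + 1 / δ * ‖b n‖ ^ 2 - 2 * ‖a n‖ * ‖b n‖ =
        (δ * ‖a n‖ - ‖b n‖) ^ 2 / δ := by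
      field_simp
      ring
    linarith [show 0 ≤ (δ * ‖a n‖ - ‖b n‖) ^ 2 / δ by positivity]
  calc ‖a n + b n‖ ^ 2 ≤ (‖a n‖ + ‖b n‖) ^ 2 := by
        gcongr
        exact norm_add_le _ _
    _ ≤ (1 + δ) * ‖a n‖ ^ 2 + (1 + 1 / δ) * ‖b n‖ ^ 2 := by linarith

/-- The arithmetic behind `truncSum_scaling_of_deviation_le`: `P`, `P'` (`F`, `F'`) stand for the
square norms of the perturbed (unperturbed) sequence at the larger and at the smaller length, and
`X` for the error. -/
theorem scaling_of_perturbation_le {P P' F F' X δ : ℝ} (hδ : 0 < δ) (hδ1 : δ < 1 / 8) (hP : 0 ≤ P)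
    (hP' : P' ≤ (1 + δ) * F' + X) (hF : F ≤ (1 + δ) * P + X) (hX : X ≤ δ / 4 * P)
    (hF' : (1 + 8 * δ) * F' ≤ F) : δ / 2 * F ≤ P - P' := by
  have F_le : F ≤ (1 + 5 / 4 * δ) * P := by linarith
  have P'_le : P' ≤ (1 - δ) * P := by
    refine le_of_mul_le_mul_left (a := 1 + 8 * δ) ?_ (by positivity)
    calc (1 + 8 * δ) * P' ≤ (1 + 8 * δ) * ((1 + δ) * F' + δ / 4 * P) := by
          gcongr
          linarith
      _ = (1 + δ) * ((1 + 8 * δ) * F') + (1 + 8 * δ) * (δ / 4 * P) := by ring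
      _ ≤ (1 + δ) * ((1 + 5 / 4 * δ) * P) + (1 + 8 * δ) * (δ / 4 * P) := by
          have := mul_le_mul_of_nonneg_left (hF'.trans F_le) (by positivity : 0 ≤ 1 + δ)
          linarith
      _ = ((1 + δ) * (1 + 5 / 4 * δ) + (1 + 8 * δ) * (δ / 4)) * P := by ring
      _ ≤ ((1 + 8 * δ) * (1 - δ)) * P := by
          gcongr
          nlinarith
      _ = (1 + 8 * δ) * ((1 - δ) * P) := by ring
  calc δ / 2 * F ≤ δ / 2 * (2 * P) := by
        gcongr
        exact F_le.trans (mul_le_mul_of_nonneg_right (by linarith) hP)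
    _ ≤ P - P' := by linarith

theorem truncSum_scaling_of_deviation_le {ψ φ : ℕ → ℂ} {γ : ℝ} (hKL : K ≤ L) (hγ : 0 < γ)
    (hγ1 : γ < 1)
    (hdev : truncSum (fun n => ‖ψ n - φ n‖ ^ 2) L ≤
      γ ^ 2 / 512 * truncSum (fun n => ‖ψ n‖ ^ 2) L)
    (hφ : (1 + γ) * truncSum (fun n => ‖φ n‖ ^ 2) K ≤ truncSum (fun n => ‖φ n‖ ^ 2) L) :
    γ / 16 * truncSum (fun n => ‖φ n‖ ^ 2) L ≤
      truncSum (fun n => ‖ψ n‖ ^ 2) L - truncSum (fun n => ‖ψ n‖ ^ 2) K := by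
  set P := truncSum (fun n => ‖ψ n‖ ^ 2) L
  set W := truncSum (fun n => ‖ψ n - φ n‖ ^ 2) L
  obtain ⟨δ, rfl⟩ : ∃ δ, γ = 8 * δ := ⟨γ / 8, by ring⟩
  have hδ : 0 < δ := by linarith
  have P_nonneg : 0 ≤ P := truncSum_nonneg (fun n => by positivity) L
  have error_le : (1 + 1 / δ) * W ≤ δ / 4 * P :=
    calc (1 + 1 / δ) * W ≤ (1 + 1 / δ) * ((8 * δ) ^ 2 / 512 * P) := by gcongr
      _ = (δ + 1) * (δ / 8 * P) := by
        field_simp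
        ring
      _ ≤ 2 * (δ / 8 * P) := by
        gcongr
        linarith
      _ = δ / 4 * P := by ring
  have small_scale := truncSum_norm_add_sq_le φ (fun n => ψ n - φ n) hδ K
  have large_scale := truncSum_norm_add_sq_le ψ (fun n => φ n - ψ n) hδ L
  simp only [add_sub_cancel, norm_sub_rev (φ _)] at small_scale large_scale
  have W_mono := truncSum_mono (f := fun n => ‖ψ n - φ n‖ ^ 2) (fun n => by positivity) hKL
  have := scaling_of_perturbation_le hδ (by linarith) P_nonneg
    (small_scale.trans (by gcongr)) large_scale error_le hφ
  linarith

end TruncatedSums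

section Recurrence

/-- The solution of `f (n + 2) = q (n + 1) f (n + 1) - f n` with `f 0 = a` and `f 1 = b`. -/
def recSol (q : ℕ → ℝ) (a b : ℝ) : ℕ → ℝ
  | 0 => a
  | 1 => b
  | n + 2 => q (n + 1) * recSol q a b (n + 1) - recSol q a b n

/-- The squared truncated norm `‖f‖_L²` of the solution `f` with `f 0 = a` and `f 1 = b`. -/
noncomputable def solNormSq (q : ℕ → ℝ) (a b L : ℝ) : ℝ :=
  truncSum (fun n => recSol q a b n ^ 2) L

/-- The Gram determinant, in the truncated inner product, of the solutions with initial values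
`(0, 1)` and `(1, 0)`. -/
noncomputable def gram (q : ℕ → ℝ) (L : ℝ) : ℝ :=
  solNormSq q 0 1 L * solNormSq q 1 0 L -
    truncSum (fun n => recSol q 0 1 n * recSol q 1 0 n) L ^ 2

variable {q : ℕ → ℝ} {L : ℝ}

theorem recSol_eq_add (q : ℕ → ℝ) (a b : ℝ) (n : ℕ) :
    recSol q a b n = a * recSol q 1 0 n + b * recSol q 0 1 n := by
  induction n using Nat.twoStepInduction with
  | zero => simp [recSol]
  | one => simp [recSol]
  | more _ ih ih' =>
    rw [recSol, ih, ih', recSol, recSol]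
    ring

theorem recSol_mul (q : ℕ → ℝ) (r a b : ℝ) (n : ℕ) :
    recSol q (r * a) (r * b) n = r * recSol q a b n := by
  rw [recSol_eq_add, recSol_eq_add q a b]
  ring

theorem solNormSq_nonneg (q : ℕ → ℝ) (a b L : ℝ) : 0 ≤ solNormSq q a b L :=
  truncSum_nonneg (fun _ => sq_nonneg _) L

theorem solNormSq_eq (q : ℕ → ℝ) (a b L : ℝ) :
    solNormSq q a b L = a ^ 2 * solNormSq q 1 0 L +
      2 * (a * b) * truncSum (fun n => recSol q 0 1 n * recSol q 1 0 n) L +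
      b ^ 2 * solNormSq q 0 1 L := by
  simp only [solNormSq, ← truncSum_const_mul, ← truncSum_add]
  congr with n
  rw [recSol_eq_add]
  ring

theorem mul_le_solNormSq {m : ℝ} (h : ∀ a b, a ^ 2 + b ^ 2 = 1 → m ≤ solNormSq q a b L) (a b : ℝ) :
    m * (a ^ 2 + b ^ 2) ≤ solNormSq q a b L := by
  set r := √(a ^ 2 + b ^ 2)
  have r_sq : r ^ 2 = a ^ 2 + b ^ 2 := Real.sq_sqrt (by positivity)
  rcases eq_or_ne r 0 with hr | hr
  · rw [← r_sq, hr, zero_pow two_ne_zero, mul_zero]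
    exact solNormSq_nonneg q a b L
  · have normalized : (r⁻¹ * a) ^ 2 + (r⁻¹ * b) ^ 2 = 1 := by
      rw [mul_pow, mul_pow, ← mul_add, ← r_sq, ← mul_pow, inv_mul_cancel₀ hr, one_pow]
    have := h _ _ normalized
    simp only [solNormSq, recSol_mul, mul_pow, truncSum_const_mul] at this
    rw [inv_pow, le_inv_mul_iff₀ (by positivity)] at this
    rwa [mul_comm, ← r_sq]

theorem wronskian_recSol (q : ℕ → ℝ) (n : ℕ) :
    recSol q 0 1 (n + 1) * recSol q 1 0 n - recSol q 1 0 (n + 1) * recSol q 0 1 n = 1 := by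
  induction n with
  | zero => simp [recSol]
  | succ n ih =>
    rw [recSol, recSol]
    linarith

theorem variation_of_constants {w r : ℕ → ℂ} (h0 : w 0 = 0) (h1 : w 1 = 0)
    (hw : ∀ n, w (n + 2) = q (n + 1) * w (n + 1) - w n + r (n + 1)) (n : ℕ) :
    w n = ∑ m ∈ Finset.Ico 1 n,
      ((recSol q 0 1 n * recSol q 1 0 m - recSol q 1 0 n * recSol q 0 1 m : ℝ) : ℂ) * r m := by
  induction n using Nat.twoStepInduction with
  | zero => simpa using h0
  | one => simpa using h1
  | more n ih ih' =>
    have wronskian : recSol q 0 1 (n + 2) * recSol q 1 0 (n + 1) -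
        recSol q 1 0 (n + 2) * recSol q 0 1 (n + 1) = 1 := wronskian_recSol q (n + 1)
    have extend : w n = ∑ m ∈ Finset.Ico 1 (n + 1),
        ((recSol q 0 1 n * recSol q 1 0 m - recSol q 1 0 n * recSol q 0 1 m : ℝ) : ℂ) * r m := by
      rcases Nat.eq_zero_or_pos n with rfl | hn
      · simpa using h0
      · rw [Finset.sum_Ico_succ_top hn, ← ih, mul_comm (recSol q 1 0 n), sub_self,
          Complex.ofReal_zero, zero_mul, add_zero]
    rw [Finset.sum_Ico_succ_top (by omega), wronskian, Complex.ofReal_one, one_mul, hw, ih',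
      extend, Finset.mul_sum, ← Finset.sum_sub_distrib, add_left_inj]
    refine Finset.sum_congr rfl fun m _ => ?_
    rw [recSol, recSol]
    push_cast
    ring

theorem norm_sum_ofReal_mul_sq_le {ι : Type*} (s : Finset ι) (a : ι → ℝ) (r : ι → ℂ) :
    ‖∑ m ∈ s, (a m : ℂ) * r m‖ ^ 2 ≤ (∑ m ∈ s, a m ^ 2) * ∑ m ∈ s, ‖r m‖ ^ 2 :=
  calc ‖∑ m ∈ s, (a m : ℂ) * r m‖ ^ 2 ≤ (∑ m ∈ s, |a m| * ‖r m‖) ^ 2 := by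
        gcongr
        refine norm_sum_le_of_le s fun m _ => ?_
        rw [norm_mul, Complex.norm_real, Real.norm_eq_abs]
    _ ≤ (∑ m ∈ s, a m ^ 2) * ∑ m ∈ s, ‖r m‖ ^ 2 := by
        simpa only [sq_abs] using
          Finset.sum_mul_sq_le_sq_mul_sq s (fun m => |a m|) (fun m => ‖r m‖)

theorem truncSum_truncSum_wronskian_sq (q : ℕ → ℝ) (L : ℝ) :
    truncSum (fun n => truncSum (fun m => (recSol q 0 1 n * recSol q 1 0 m -
      recSol q 1 0 n * recSol q 0 1 m) ^ 2) L) L = 2 * gram q L := by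
  have expand (n : ℕ) : truncSum (fun m => (recSol q 0 1 n * recSol q 1 0 m -
      recSol q 1 0 n * recSol q 0 1 m) ^ 2) L =
        solNormSq q 1 0 L * recSol q 0 1 n ^ 2 + solNormSq q 0 1 L * recSol q 1 0 n ^ 2 +
        -2 * truncSum (fun n => recSol q 0 1 n * recSol q 1 0 n) L *
          (recSol q 0 1 n * recSol q 1 0 n) :=
    calc _ = truncSum (fun m => recSol q 0 1 n ^ 2 * recSol q 1 0 m ^ 2 +
          recSol q 1 0 n ^ 2 * recSol q 0 1 m ^ 2 +
          -2 * (recSol q 0 1 n * recSol q 1 0 n) * (recSol q 0 1 m * recSol q 1 0 m)) L := by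
            congr with m
            ring
      _ = _ := by
            simp only [truncSum_add, truncSum_const_mul, solNormSq]
            ring
  simp only [expand, truncSum_add, truncSum_const_mul, gram, solNormSq]
  ring

theorem truncSum_deviation_le {ψ w : ℕ → ℂ} {ζ : ℂ} (h0 : w 0 = 0) (h1 : w 1 = 0)
    (hw : ∀ n, w (n + 2) = q (n + 1) * w (n + 1) - w n + ζ * ψ (n + 1)) (L : ℝ) :
    truncSum (fun n => ‖w n‖ ^ 2) L ≤
      ‖ζ‖ ^ 2 * (2 * gram q L) * truncSum (fun n => ‖ψ n‖ ^ 2) L := by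
  set P := truncSum (fun n => ‖ψ n‖ ^ 2) L
  let W (n m : ℕ) : ℝ := recSol q 0 1 n * recSol q 1 0 m - recSol q 1 0 n * recSol q 0 1 m
  have w_eq (n : ℕ) : w n = ζ * ∑ m ∈ Finset.Ico 1 n, (W n m : ℂ) * ψ m := by
    rw [variation_of_constants (r := fun n => ζ * ψ n) h0 h1 hw n, Finset.mul_sum]
    exact Finset.sum_congr rfl fun m _ => by ring
  have _ : 0 ≤ P := truncSum_nonneg (fun n => by positivity) L
  rw [← truncSum_truncSum_wronskian_sq, mul_right_comm, ← truncSum_const_mul]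
  refine Finset.sum_le_sum fun n _ => ?_
  by_cases hn : cutoff L n = 0
  · rw [hn, zero_mul, zero_mul]
  refine mul_le_mul_of_nonneg_left ?_ (cutoff_nonneg L n)
  calc ‖w n‖ ^ 2 ≤ ‖ζ‖ ^ 2 * ((∑ m ∈ Finset.Ico 1 n, W n m ^ 2) *
        ∑ m ∈ Finset.Ico 1 n, ‖ψ m‖ ^ 2) := by
        rw [w_eq, norm_mul, mul_pow]
        gcongr
        exact norm_sum_ofReal_mul_sq_le _ _ _
    _ ≤ ‖ζ‖ ^ 2 * (truncSum (fun m => W n m ^ 2) L * P) := by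
        gcongr
        · exact truncSum_nonneg (fun m => sq_nonneg _) L
        · exact sum_Ico_le_truncSum (fun m => sq_nonneg _) hn
        · exact sum_Ico_le_truncSum (fun m => by positivity) hn
    _ = ‖ζ‖ ^ 2 * P * truncSum (fun m => W n m ^ 2) L := by ring

end Recurrence

section Gram

variable {q : ℕ → ℝ} {L : ℝ}

theorem gram_one (q : ℕ → ℝ) : gram q 1 = 0 := by
  rw [gram, solNormSq, solNormSq, truncSum_one, truncSum_one, truncSum_one]
  ring

theorem continuousOn_gram (q : ℕ → ℝ) (M : ℝ) : ContinuousOn (gram q) (Set.Iic M) :=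
  ((continuousOn_truncSum _ M).mul (continuousOn_truncSum _ M)).sub
    ((continuousOn_truncSum _ M).pow 2)

theorem gram_le (q : ℕ → ℝ) (L : ℝ) : gram q L ≤ solNormSq q 0 1 L * solNormSq q 1 0 L :=
  sub_le_self _ (sq_nonneg _)

theorem sq_le_gram {m : ℝ} (hm : 0 < m) (h : ∀ a b, m * (a ^ 2 + b ^ 2) ≤ solNormSq q a b L) :
    m ^ 2 ≤ gram q L := by
  rw [gram]
  set A := solNormSq q 0 1 L
  set C := solNormSq q 1 0 L
  set B := truncSum (fun n => recSol q 0 1 n * recSol q 1 0 n) L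
  have le_A : m ≤ A := by simpa using h 0 1
  have minimizer := h A (-B)
  rw [solNormSq_eq] at minimizer
  have le_of_minimizer : m * A ≤ A * C - B ^ 2 := by
    refine le_of_mul_le_mul_left (a := A) ?_ (hm.trans_le le_A)
    linarith [show 0 ≤ m * B ^ 2 by positivity]
  nlinarith

theorem gram_mul_le (q : ℕ → ℝ) (a b L : ℝ) :
    gram q L * (a ^ 2 + b ^ 2) ≤ (solNormSq q 0 1 L + solNormSq q 1 0 L) * solNormSq q a b L := by
  rw [gram, solNormSq_eq q a b]
  set A := solNormSq q 0 1 L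
  set C := solNormSq q 1 0 L
  set B := truncSum (fun n => recSol q 0 1 n * recSol q 1 0 n) L
  nlinarith [sq_nonneg (b * A + a * B), sq_nonneg (b * B + a * C)]

theorem exists_gram_eq
    (hunbounded : ∀ m, ∃ L, 1 ≤ L ∧ ∀ a b, m * (a ^ 2 + b ^ 2) ≤ solNormSq q a b L)
    {τ : ℝ} (hτ : 0 ≤ τ) : ∃ L, 1 ≤ L ∧ gram q L = τ := by
  obtain ⟨M, hM, hsol⟩ := hunbounded (1 + τ)
  have τ_le : τ ≤ gram q M := by nlinarith [sq_le_gram (by positivity) hsol]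
  obtain ⟨L, hL, gram_eq⟩ := intermediate_value_Icc hM
    ((continuousOn_gram q M).mono fun L hL => hL.2) ⟨(gram_one q).trans_le hτ, τ_le⟩
  exact ⟨L, hL.1, gram_eq⟩

theorem truncSum_norm_sq_eq (q : ℕ → ℝ) (a b : ℂ) (L : ℝ) :
    truncSum (fun n => ‖a * (recSol q 1 0 n : ℂ) + b * (recSol q 0 1 n : ℂ)‖ ^ 2) L =
      solNormSq q a.re b.re L + solNormSq q a.im b.im L := by
  rw [solNormSq, solNormSq, ← truncSum_add]
  congr with n
  rw [recSol_eq_add q a.re, recSol_eq_add q a.im, Complex.sq_norm, Complex.normSq_apply]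
  simp only [Complex.add_re, Complex.mul_re, Complex.ofReal_re, Complex.ofReal_im, Complex.add_im,
    Complex.mul_im]
  ring

theorem mul_le_truncSum_sub_of_perturbation {K γ G : ℝ} {ζ : ℂ} {ψ : ℕ → ℂ} (hKL : K ≤ L)
    (hγ : 0 < γ) (hγ1 : γ < 1) (hψ : ∀ n, ψ (n + 2) = (q (n + 1) + ζ) * ψ (n + 1) - ψ n)
    (hζ : ‖ζ‖ ^ 2 * (2 * gram q L) ≤ γ ^ 2 / 512)
    (hscale : ∀ a b, (1 + γ) * solNormSq q a b K ≤ solNormSq q a b L)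
    (hG : ∀ a b, G * (a ^ 2 + b ^ 2) ≤ solNormSq q a b L) :
    γ / 16 * (G * (‖ψ 0‖ ^ 2 + ‖ψ 1‖ ^ 2)) ≤
      truncSum (fun n => ‖ψ n‖ ^ 2) L - truncSum (fun n => ‖ψ n‖ ^ 2) K := by
  set φ : ℕ → ℂ := fun n => ψ 0 * (recSol q 1 0 n : ℂ) + ψ 1 * (recSol q 0 1 n : ℂ) with hφ
  have deviation := truncSum_deviation_le (q := q) (w := fun n => ψ n - φ n) (ψ := ψ) (ζ := ζ)
    (by simp [hφ, recSol]) (by simp [hφ, recSol])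
    (fun n => by
      simp only [hφ]
      rw [hψ, recSol, recSol]
      push_cast
      ring) L
  refine le_trans ?_ (truncSum_scaling_of_deviation_le hKL hγ hγ1
    (deviation.trans (mul_le_mul_of_nonneg_right hζ (truncSum_nonneg (fun n => by positivity) L)))
    ?_)
  · gcongr
    rw [truncSum_norm_sq_eq, Complex.sq_norm, Complex.sq_norm, Complex.normSq_apply,
      Complex.normSq_apply]
    linarith [hG (ψ 0).re (ψ 1).re, hG (ψ 0).im (ψ 1).im]
  · rw [truncSum_norm_sq_eq, truncSum_norm_sq_eq, mul_add]
    exact add_le_add (hscale _ _) (hscale _ _)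

end Gram

section ResolventMoments

variable {α κ p T L d e : ℝ}

theorem min_mul_rpow_le_rpow_mul_max (hs : 0 < α + κ + 1 / 2) (hpκ : 0 ≤ p + 2 * κ)
    (hpα : p ≤ 2 * α + 1) (hT : 0 < T) (hL : 0 < L) (hd : 0 ≤ d) (he : 0 ≤ e) :
    min d e * T ^ ((p + 2 * κ) / (α + κ + 1 / 2)) ≤
      L ^ p * max (d * L ^ (2 * κ)) (e * T ^ 2 / L ^ (2 * α + 1)) := by
  set s := (p + 2 * κ) / (α + κ + 1 / 2) with hs_def
  set X := T ^ (1 / (α + κ + 1 / 2)) with hX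
  have _ : 0 < X := Real.rpow_pos_of_pos hT _
  rcases le_total X L with h | h
  · calc min d e * T ^ s ≤ d * T ^ s := by
          gcongr
          exact min_le_left _ _
      _ = d * X ^ (p + 2 * κ) := by
          rw [hX, ← Real.rpow_mul hT.le, one_div_mul_eq_div]
      _ ≤ d * L ^ (p + 2 * κ) := by gcongr
      _ = L ^ p * (d * L ^ (2 * κ)) := by
          rw [Real.rpow_add hL]
          ring
      _ ≤ _ := by
          gcongr
          exact le_max_left _ _
  · calc min d e * T ^ s ≤ e * T ^ s := by
          gcongr
          exact min_le_right _ _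
      _ = e * (T ^ 2 * X ^ (p - (2 * α + 1))) := by
          rw [hX, ← Real.rpow_mul hT.le, ← Real.rpow_natCast T 2, ← Real.rpow_add hT, hs_def,
            Nat.cast_ofNat]
          congr 2
          rw [div_eq_iff hs.ne', add_mul, mul_right_comm, one_div_mul_cancel hs.ne']
          ring
      _ ≤ e * (T ^ 2 * L ^ (p - (2 * α + 1))) := by
          have := Real.rpow_le_rpow_of_nonpos hL h (sub_nonpos.2 hpα)
          gcongr
      _ = L ^ p * (e * T ^ 2 / L ^ (2 * α + 1)) := by
          rw [Real.rpow_sub hL]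
          field_simp
      _ ≤ _ := by
          gcongr
          exact le_max_right _ _

variable {q : ℕ → ℝ} {C D L₀ L₁ k γ : ℝ}

theorem exists_mul_le_solNormSq (hκ : 0 < κ) (hD : 0 < D)
    (hlow : ∀ a b L, L₁ ≤ L → D * L ^ κ * (a ^ 2 + b ^ 2) ≤ solNormSq q a b L) (m : ℝ) :
    ∃ L, 1 ≤ L ∧ ∀ a b, m * (a ^ 2 + b ^ 2) ≤ solNormSq q a b L := by
  have growth : Filter.Tendsto (fun L : ℝ => D * L ^ κ) Filter.atTop Filter.atTop :=
    (tendsto_rpow_atTop hκ).const_mul_atTop hD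
  obtain ⟨L, hm, hL, hL₁⟩ := ((growth.eventually_ge_atTop m).and
    ((Filter.eventually_ge_atTop 1).and (Filter.eventually_ge_atTop L₁))).exists
  exact ⟨L, hL, fun a b => le_trans (by gcongr) (hlow a b L hL₁)⟩

theorem exists_ge_gram_eq {s M τ : ℝ} (hs : 0 ≤ s) (hC : 0 ≤ C) (hκ : 0 < κ) (hD : 0 < D)
    (hup : ∀ a b L, a ^ 2 + b ^ 2 = 1 → 1 ≤ L → solNormSq q a b L ≤ C * L ^ s)
    (hlow : ∀ a b L, L₁ ≤ L → D * L ^ κ * (a ^ 2 + b ^ 2) ≤ solNormSq q a b L)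
    (hM : (C * M ^ s) ^ 2 < τ) : ∃ L, 1 ≤ L ∧ M ≤ L ∧ gram q L = τ := by
  obtain ⟨L, hL, rfl⟩ := exists_gram_eq (exists_mul_le_solNormSq hκ hD hlow)
    ((sq_nonneg _).trans hM.le)
  refine ⟨L, hL, ?_, rfl⟩
  by_contra! hLM
  have sol_le (a b : ℝ) (hab : a ^ 2 + b ^ 2 = 1) : solNormSq q a b L ≤ C * M ^ s :=
    (hup a b L hab hL).trans (by gcongr)
  refine hM.not_ge ((gram_le q L).trans ?_)
  rw [pow_two]
  exact mul_le_mul (sol_le 0 1 (by norm_num)) (sol_le 1 0 (by norm_num))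
    (solNormSq_nonneg q 1 0 L) ((solNormSq_nonneg q 0 1 L).trans (sol_le 0 1 (by norm_num)))

theorem gram_div_mul_le_solNormSq {F : ℝ} (hF : 0 < F)
    (hup : ∀ a b, a ^ 2 + b ^ 2 = 1 → solNormSq q a b L ≤ F) (a b : ℝ) :
    gram q L / (2 * F) * (a ^ 2 + b ^ 2) ≤ solNormSq q a b L := by
  rw [div_mul_eq_mul_div, div_le_iff₀ (by positivity), mul_comm _ (2 * F)]
  refine (gram_mul_le q a b L).trans (mul_le_mul_of_nonneg_right ?_ (solNormSq_nonneg q a b L))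
  linarith [hup 0 1 (by norm_num), hup 1 0 (by norm_num)]

/-- The length `L` is chosen so that the Gram determinant is a small multiple of `T ^ 2`: the
perturbation `ζ` is then just weak enough to be harmless up to the length `L`. -/
theorem exists_moment_ge (hκ : 0 < κ) (hC : 0 < C) (hD : 0 < D) (hk : 0 < k)
    (hk1 : k < 1) (hγ : 0 < γ) (hγ1 : γ < 1) (hL₀ : 1 ≤ L₀) (hp : 0 < p) (hpα : p ≤ 2 * α + 1)
    (hT : 64 * C * (max L₀ L₁) ^ (2 * α + 1) / γ < T)
    (hup : ∀ a b L, a ^ 2 + b ^ 2 = 1 → 1 ≤ L → solNormSq q a b L ≤ C * L ^ (2 * α + 1))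
    (hscale : ∀ a b L, L₀ ≤ L → (1 + γ) * solNormSq q a b (k * L) ≤ solNormSq q a b L)
    (hlow : ∀ a b L, L₁ ≤ L → D * L ^ (2 * κ) * (a ^ 2 + b ^ 2) ≤ solNormSq q a b L) :
    ∃ N : ℕ, ∀ (ζ : ℂ) (ψ : ℕ → ℂ), ‖ζ‖ ^ 2 ≤ 2 / T ^ 2 →
      (∀ n, ψ (n + 2) = (q (n + 1) + ζ) * ψ (n + 1) - ψ n) →
      k ^ p * (γ / 16) * min D (γ ^ 2 / (4096 * C)) * T ^ ((p + 2 * κ) / (α + κ + 1 / 2)) *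
        (‖ψ 0‖ ^ 2 + ‖ψ 1‖ ^ 2) ≤ ∑ n ∈ Finset.Icc 1 N, (n : ℝ) ^ p * ‖ψ n‖ ^ 2 := by
  have L₀_pos : 0 < max L₀ L₁ := (zero_lt_one.trans_le hL₀).trans_le (le_max_left _ _)
  have T_pos : 0 < T := lt_of_le_of_lt (by positivity) hT
  have T_large : (C * (max L₀ L₁) ^ (2 * α + 1)) ^ 2 < γ ^ 2 / 2048 * T ^ 2 := by
    rw [div_lt_iff₀ hγ] at hT
    have := pow_lt_pow_left₀ hT (by positivity) two_ne_zero
    have : 0 < (C * (max L₀ L₁) ^ (2 * α + 1)) ^ 2 := by positivity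
    linarith
  obtain ⟨L, hL, L_large, gram_eq⟩ :=
    exists_ge_gram_eq (hp.le.trans hpα) hC.le (by positivity) hD hup hlow T_large
  have L_pos : 0 < L := by linarith
  have kL_le : k * L ≤ L := mul_le_of_le_one_left L_pos.le hk1.le
  set G := max (D * L ^ (2 * κ)) (γ ^ 2 / (4096 * C) * T ^ 2 / L ^ (2 * α + 1))
  have le_sol (a b : ℝ) : G * (a ^ 2 + b ^ 2) ≤ solNormSq q a b L := by
    rw [max_mul_of_nonneg _ _ (by positivity)]
    refine max_le (hlow a b L ((le_max_right _ _).trans L_large)) (le_trans (le_of_eq ?_)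
      (gram_div_mul_le_solNormSq (by positivity) (fun a b hab => hup a b L hab hL) a b))
    rw [gram_eq]
    field_simp
    ring
  refine ⟨⌊L⌋₊ + 1, fun ζ ψ hζ hψ => ?_⟩
  have weak : ‖ζ‖ ^ 2 * (2 * gram q L) ≤ γ ^ 2 / 512 := by
    rw [gram_eq]
    calc _ ≤ 2 / T ^ 2 * (2 * (γ ^ 2 / 2048 * T ^ 2)) := by gcongr
      _ = γ ^ 2 / 512 := by
        field_simp
        norm_num
  set s := (p + 2 * κ) / (α + κ + 1 / 2)
  calc _ = k ^ p * (γ / 16) * (min D (γ ^ 2 / (4096 * C)) * T ^ s) *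
        (‖ψ 0‖ ^ 2 + ‖ψ 1‖ ^ 2) := by ring
    _ ≤ k ^ p * (γ / 16) * (L ^ p * G) * (‖ψ 0‖ ^ 2 + ‖ψ 1‖ ^ 2) := by
        have := min_mul_rpow_le_rpow_mul_max (show 0 < α + κ + 1 / 2 by linarith)
          (by positivity) hpα T_pos L_pos hD.le (show 0 ≤ γ ^ 2 / (4096 * C) by positivity)
        gcongr ?_ * ?_ * ?_
    _ = (k * L) ^ p * (γ / 16 * (G * (‖ψ 0‖ ^ 2 + ‖ψ 1‖ ^ 2))) := by
        rw [Real.mul_rpow hk.le L_pos.le]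
        ring
    _ ≤ (k * L) ^ p * (truncSum (fun n => ‖ψ n‖ ^ 2) L -
          truncSum (fun n => ‖ψ n‖ ^ 2) (k * L)) := by
        gcongr
        exact mul_le_truncSum_sub_of_perturbation kL_le hγ hγ1 hψ weak
          (fun a b => hscale a b L ((le_max_left _ _).trans L_large)) le_sol
    _ ≤ _ := rpow_mul_truncSum_sub_le hp.le (by positivity) kL_le fun n => by positivity

end ResolventMoments

section LineSolutions

variable {S : Set ℤ} {V : ℤ → ℝ} {E K L : ℝ}

/-- The solution at the energy `E` on the whole line with `u 0 = a` and `u 1 = b`. The recurrence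
is run to the right from the sites `0, 1` and, after the reflection `n ↦ 1 - n`, to the left. -/
def lineSol (V : ℤ → ℝ) (E a b : ℝ) (n : ℤ) : ℝ :=
  if 0 ≤ n then recSol (fun m => E - V m) a b n.toNat
  else recSol (fun m => E - V (1 - m)) b a (1 - n).toNat

theorem lineSol_natCast (V : ℤ → ℝ) (E a b : ℝ) (n : ℕ) :
    lineSol V E a b n = recSol (fun m => E - V m) a b n := by
  simp [lineSol]

theorem lineSol_one_sub_natCast (V : ℤ → ℝ) (E a b : ℝ) (n : ℕ) :
    lineSol V E a b (1 - n) = recSol (fun m => E - V (1 - m)) b a n := by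
  unfold lineSol
  split_ifs with h
  · have : n = 0 ∨ n = 1 := by omega
    rcases this with rfl | rfl <;> simp [recSol]
  · congr 1
    omega

theorem lineSol_zero (V : ℤ → ℝ) (E a b : ℝ) : lineSol V E a b 0 = a :=
  lineSol_natCast V E a b 0

theorem lineSol_one (V : ℤ → ℝ) (E a b : ℝ) : lineSol V E a b 1 = b :=
  lineSol_natCast V E a b 1

theorem isSolution_lineSol (S : Set ℤ) (V : ℤ → ℝ) (E a b : ℝ) :
    IsSolution S V E (lineSol V E a b) := by
  intro n _
  rcases le_or_gt 1 n with h | h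
  · obtain ⟨m, rfl⟩ : ∃ m : ℕ, n = (m : ℤ) + 1 := ⟨(n - 1).toNat, by omega⟩
    have at_succ := lineSol_natCast V E a b (m + 1)
    have at_succ_succ := lineSol_natCast V E a b (m + 2)
    push_cast at at_succ at_succ_succ
    rw [add_sub_cancel_right, add_assoc (m : ℤ), one_add_one_eq_two, lineSol_natCast, at_succ,
      at_succ_succ, recSol]
    push_cast
    ring
  · obtain ⟨m, rfl⟩ : ∃ m : ℕ, n = 1 - ((m + 1 : ℕ) : ℤ) := ⟨(-n).toNat, by omega⟩
    rw [show (1 : ℤ) - (m + 1 : ℕ) + 1 = 1 - m by push_cast; ring,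
      show (1 : ℤ) - (m + 1 : ℕ) - 1 = 1 - (m + 2 : ℕ) by push_cast; ring,
      lineSol_one_sub_natCast, lineSol_one_sub_natCast, lineSol_one_sub_natCast, recSol]
    ring

theorem isNormalized_lineSol {a b : ℝ} (h : a ^ 2 + b ^ 2 = 1) :
    IsNormalized (lineSol V E a b) := by
  rwa [IsNormalized, lineSol_zero, lineSol_one, sq_abs, sq_abs]

theorem normSqUpTo_eq_truncSum (u : ℤ → ℝ) (hL : 0 ≤ L) :
    normSqUpTo u L = truncSum (fun n => u n ^ 2) L := by
  have floor_le := Nat.floor_le hL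
  have lt_floor := Nat.lt_floor_add_one L
  have cutoff_last : cutoff L (⌊L⌋₊ + 1) = L - ⌊L⌋₊ := by
    unfold cutoff
    push_cast
    rw [min_eq_right (by linarith), max_eq_right (by linarith)]
    ring
  rw [truncSum, Finset.sum_Icc_succ_top (by omega), normSqUpTo, cutoff_last, sq_abs]
  push_cast
  congr 1
  refine Finset.sum_congr rfl fun n hn => ?_
  have : (n : ℝ) ≤ ⌊L⌋₊ := by exact_mod_cast (Finset.mem_Icc.1 hn).2
  rw [cutoff_eq_one (this.trans floor_le), one_mul, sq_abs]

theorem normSqUpTo_mono (u : ℤ → ℝ) (hK : 0 ≤ K) (h : K ≤ L) :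
    normSqUpTo u K ≤ normSqUpTo u L := by
  rw [normSqUpTo_eq_truncSum u hK, normSqUpTo_eq_truncSum u (hK.trans h)]
  exact truncSum_mono (fun _ => sq_nonneg _) h

theorem normSqUpTo_two (u : ℤ → ℝ) : normSqUpTo u 2 = u 1 ^ 2 + u 2 ^ 2 := by
  simp [normSqUpTo, Finset.sum_Icc_succ_top]

theorem normSqUpTo_lineSol (V : ℤ → ℝ) (E a b : ℝ) (hL : 0 ≤ L) :
    normSqUpTo (lineSol V E a b) L = solNormSq (fun m => E - V m) a b L := by
  simp only [normSqUpTo_eq_truncSum _ hL, lineSol_natCast, solNormSq]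

theorem mul_rpow_mul_le_solNormSq {D κ : ℝ} (hD : 0 ≤ D) (hL : 0 ≤ L)
    (h : ∀ u, IsSolution S V E u → IsNormalized u → D * L ^ κ ≤ √(normSqUpTo u L)) (a b : ℝ) :
    D ^ 2 * L ^ (2 * κ) * (a ^ 2 + b ^ 2) ≤ solNormSq (fun m => E - V m) a b L := by
  refine mul_le_solNormSq (fun a b hab => ?_) a b
  have sqrt_bound := h _ (isSolution_lineSol S V E a b) (isNormalized_lineSol hab)
  rw [normSqUpTo_lineSol V E a b hL,
    Real.le_sqrt (by positivity) (solNormSq_nonneg _ a b L)] at sqrt_bound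
  rwa [mul_pow, ← Real.rpow_mul_natCast hL, mul_comm κ] at sqrt_bound

end LineSolutions

section Scaling

variable {S : Set ℤ} {V : ℤ → ℝ} {A : Set ℝ} {α : ℝ}

theorem pow_mul_le_of_scaling {F : ℝ → ℝ} {k γ M : ℝ} (hk : 0 < k) (hk1 : k < 1) (hγ : 0 < γ)
    (hM : 0 < M) (hF : MonotoneOn F (Set.Ici M))
    (hscale : ∀ L, M ≤ L → (1 + γ) * F (k * L) ≤ F L) (j : ℕ) :
    ∀ L, M ≤ k ^ j * L → (1 + γ) ^ j * F M ≤ F L := by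
  induction j with
  | zero =>
    intro L hL
    rw [pow_zero, one_mul] at hL ⊢
    exact hF Set.self_mem_Ici hL hL
  | succ j ih =>
    intro L hL
    have L_pos : 0 < L := pos_of_mul_pos_right (hM.trans_le hL) (by positivity)
    have L_ge : M ≤ L :=
      hL.trans (mul_le_of_le_one_left L_pos.le (pow_le_one₀ hk.le hk1.le))
    calc (1 + γ) ^ (j + 1) * F M = (1 + γ) * ((1 + γ) ^ j * F M) := by ring
      _ ≤ (1 + γ) * F (k * L) := by
          gcongr
          exact ih (k * L) (by rwa [← mul_assoc, ← pow_succ])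
      _ ≤ F L := hscale L L_ge

-- The exponent solves `k ^ (-ρ) = 1 + γ`.
theorem mul_rpow_le_of_scaling {F : ℝ → ℝ} {k γ M L : ℝ} (hk : 0 < k) (hk1 : k < 1) (hγ : 0 < γ)
    (hM : 0 < M) (hF : MonotoneOn F (Set.Ici M)) (hFM : 0 ≤ F M)
    (hscale : ∀ L, M ≤ L → (1 + γ) * F (k * L) ≤ F L) (hL : M ≤ L) :
    F M / (1 + γ) * (L / M) ^ (Real.log (1 + γ) / -Real.log k) ≤ F L := by
  have L_pos : 0 < L := hM.trans_le hL
  have log_k_neg : Real.log k < 0 := Real.log_neg hk hk1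
  set x := Real.log (L / M) / -Real.log k with hx
  have x_nonneg : 0 ≤ x :=
    div_nonneg (Real.log_nonneg ((one_le_div hM).2 hL)) (neg_pos.2 log_k_neg).le
  have k_rpow_x : k ^ x = M / L := by
    rw [Real.rpow_def_of_pos hk, hx, div_neg, mul_neg, mul_div_cancel₀ _ log_k_neg.ne,
      ← Real.log_inv, inv_div, Real.exp_log (by positivity)]
  have M_le : M ≤ k ^ ⌊x⌋₊ * L := by
    calc M = k ^ x * L := by rw [k_rpow_x, div_mul_cancel₀ _ L_pos.ne']
      _ ≤ k ^ (⌊x⌋₊ : ℝ) * L := by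
          gcongr ?_ * L
          exact Real.rpow_le_rpow_of_exponent_ge hk hk1.le (Nat.floor_le x_nonneg)
      _ = k ^ ⌊x⌋₊ * L := by rw [Real.rpow_natCast]
  have growth : (L / M) ^ (Real.log (1 + γ) / -Real.log k) ≤ (1 + γ) * (1 + γ) ^ ⌊x⌋₊ := by
    calc (L / M) ^ (Real.log (1 + γ) / -Real.log k) = (1 + γ) ^ x := by
          rw [Real.rpow_def_of_pos (by positivity), Real.rpow_def_of_pos (by linarith), hx,
            mul_div_left_comm]
      _ ≤ (1 + γ) ^ ((⌊x⌋₊ + 1 : ℕ) : ℝ) := by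
          apply Real.rpow_le_rpow_of_exponent_le (by linarith)
          exact_mod_cast (Nat.lt_floor_add_one x).le
      _ = (1 + γ) * (1 + γ) ^ ⌊x⌋₊ := by rw [Real.rpow_natCast, pow_succ']
  calc F M / (1 + γ) * (L / M) ^ (Real.log (1 + γ) / -Real.log k) ≤
        F M / (1 + γ) * ((1 + γ) * (1 + γ) ^ ⌊x⌋₊) := by gcongr
    _ = (1 + γ) ^ ⌊x⌋₊ * F M := by field_simp
    _ ≤ F L := pow_mul_le_of_scaling hk hk1 hγ hM hF hscale ⌊x⌋₊ L M_le

theorem PowerLawUpperBound.exists_abs_sub_le (h : PowerLawUpperBound S V A α)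
    (h1 : (1 : ℤ) ∈ S) : ∃ W, ∀ E ∈ A, |E - V 1| ≤ W := by
  obtain ⟨C, _, upper⟩ := h
  refine ⟨√(C * 2 ^ (2 * α + 1)), fun E hE => Real.abs_le_sqrt ?_⟩
  have sol := isSolution_lineSol S V E 0 1
  have at_two := upper E hE _ sol (isNormalized_lineSol (by norm_num)) 2 one_le_two
  have at_one := sol 1 h1
  norm_num only [lineSol_zero, lineSol_one] at at_one
  rw [normSqUpTo_two, lineSol_one] at at_two
  rw [show E - V 1 = lineSol V E 0 1 2 by linarith]
  linarith

theorem IsSolution.le_normSqUpTo_two {E W : ℝ} {u : ℤ → ℝ} (hu : IsSolution S V E u)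
    (h1 : (1 : ℤ) ∈ S) (hW : |E - V 1| ≤ W) (hn : IsNormalized u) :
    1 / (2 * W ^ 2 + 2) ≤ normSqUpTo u 2 := by
  have at_one := hu 1 h1
  norm_num only at at_one
  have u_zero : u 0 = (E - V 1) * u 1 - u 2 := by linarith
  have sq_le : (E - V 1) ^ 2 ≤ W ^ 2 := sq_le_sq' (abs_le.1 hW).1 (abs_le.1 hW).2
  rw [IsNormalized, sq_abs, sq_abs, u_zero] at hn
  rw [normSqUpTo_two, div_le_iff₀ (by positivity)]
  nlinarith [sq_nonneg ((E - V 1) * u 1 + u 2), mul_le_mul_of_nonneg_right sq_le (sq_nonneg (u 1)),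
    mul_nonneg (sq_nonneg W) (sq_nonneg (u 2)), sq_nonneg (u 1)]

theorem ScalingLowerBound.exists_powerLawLowerBound (hb : ScalingLowerBound S V A)
    (ha : PowerLawUpperBound S V A α) (h1 : (1 : ℤ) ∈ S) :
    ∃ κ : ℝ, 0 < κ ∧ PowerLawLowerBound S V A κ := by
  obtain ⟨W, hW⟩ := ha.exists_abs_sub_le h1
  obtain ⟨k, γ, L₀, hk, hk1, hγ, _, hL₀, scale⟩ := hb
  set M := max L₀ 2
  set ρ := Real.log (1 + γ) / -Real.log k
  set c := 1 / (2 * W ^ 2 + 2)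
  have M_pos : 0 < M := lt_max_of_lt_right two_pos
  have c_pos : 0 < c := by positivity
  have ρ_pos : 0 < ρ := div_pos (Real.log_pos (by linarith)) (neg_pos.2 (Real.log_neg hk hk1))
  refine ⟨ρ / 2, by positivity, √(c / (1 + γ) / M ^ ρ), M, by positivity,
    hL₀.trans (le_max_left _ _), fun E hE u hu hn L hL => ?_⟩
  have L_pos : 0 < L := M_pos.trans_le hL
  have le_at_M : c ≤ normSqUpTo u M :=
    (hu.le_normSqUpTo_two h1 (hW E hE) hn).trans (normSqUpTo_mono u zero_le_two (le_max_right _ _))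
  have mono : MonotoneOn (normSqUpTo u) (Set.Ici M) := fun K hK _ _ h =>
    normSqUpTo_mono u (M_pos.le.trans hK) h
  apply Real.le_sqrt_of_sq_le
  calc (√(c / (1 + γ) / M ^ ρ) * L ^ (ρ / 2)) ^ 2 = c / (1 + γ) * (L / M) ^ ρ := by
        rw [mul_pow, Real.sq_sqrt (by positivity), ← Real.rpow_mul_natCast L_pos.le,
          Real.div_rpow L_pos.le M_pos.le]
        push_cast
        rw [div_mul_cancel₀ ρ two_ne_zero]
        ring
    _ ≤ normSqUpTo u M / (1 + γ) * (L / M) ^ ρ := by gcongr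
    _ ≤ normSqUpTo u L :=
        mul_rpow_le_of_scaling hk hk1 hγ M_pos mono (c_pos.le.trans le_at_M)
          (fun L hL => scale E hE u hu L ((le_max_left _ _).trans hL)) hL

theorem PowerLawLowerBound.two_mul_add_one_pos {κ : ℝ} (hlow : PowerLawLowerBound S V A κ)
    (ha : PowerLawUpperBound S V A α) (hκ : 0 < κ) (hA : A.Nonempty) : 0 < 2 * α + 1 := by
  obtain ⟨E, hE⟩ := hA
  obtain ⟨C, hC, upper⟩ := ha
  obtain ⟨D, L₁, hD, hL₁, lower⟩ := hlow
  by_contra! hα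
  obtain ⟨L, hL, large⟩ := ((Filter.eventually_ge_atTop L₁).and
    ((tendsto_rpow_atTop hκ).eventually_gt_atTop (√C / D))).exists
  have L_ge_one : 1 ≤ L := hL₁.trans hL
  have sol := isSolution_lineSol S V E 0 1
  have normalized : IsNormalized (lineSol V E 0 1) := isNormalized_lineSol (by norm_num)
  refine (lower E hE _ sol normalized L hL).not_gt ?_
  calc √(normSqUpTo (lineSol V E 0 1) L) ≤ √C := by
        refine Real.sqrt_le_sqrt ((upper E hE _ sol normalized L L_ge_one).trans ?_)
        exact mul_le_of_le_one_right hC.le (Real.rpow_le_one_of_one_le_of_nonpos L_ge_one hα)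
    _ < D * L ^ κ := by rwa [div_lt_iff₀' hD] at large

end Scaling

section Orthonormal

variable {𝕜 E ι : Type*} [RCLike 𝕜] [NormedAddCommGroup E] [InnerProductSpace 𝕜 E] {e : ι → E}

theorem norm_sum_inner_smul_sq_of_orthonormal (he : Orthonormal 𝕜 e) (F : Finset ι) (v : E) :
    ‖∑ n ∈ F, inner 𝕜 (e n) v • e n‖ ^ 2 = ∑ n ∈ F, ‖inner 𝕜 (e n) v‖ ^ 2 := by
  rw [← inner_self_eq_norm_sq (𝕜 := 𝕜), he.inner_sum, map_sum]
  refine Finset.sum_congr rfl fun n _ => ?_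
  rw [RCLike.conj_mul]
  norm_cast

theorem norm_sub_sum_inner_smul_sq_of_orthonormal (he : Orthonormal 𝕜 e) (F : Finset ι)
    (v : E) :
    ‖v - ∑ n ∈ F, inner 𝕜 (e n) v • e n‖ ^ 2 = ‖v‖ ^ 2 - ∑ n ∈ F, ‖inner 𝕜 (e n) v‖ ^ 2 := by
  have inner_eq : inner 𝕜 v (∑ n ∈ F, inner 𝕜 (e n) v • e n) =
      ((∑ n ∈ F, ‖inner 𝕜 (e n) v‖ ^ 2 : ℝ) : 𝕜) := by
    rw [inner_sum]
    push_cast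
    refine Finset.sum_congr rfl fun n _ => ?_
    rw [inner_smul_right, ← inner_conj_symm v, RCLike.mul_conj]
  rw [norm_sub_sq (𝕜 := 𝕜), inner_eq, RCLike.ofReal_re,
    norm_sum_inner_smul_sq_of_orthonormal he]
  ring

theorem norm_inner_sq_le_of_orthonormal (he : Orthonormal 𝕜 e) (F : Finset ι) (w : E)
    {v : E} (hv : ‖v‖ = 1) :
    ‖inner 𝕜 w v‖ ^ 2 ≤ 2 * ∑ n ∈ F, ‖inner 𝕜 (e n) w‖ ^ 2 +
      2 * ‖w‖ ^ 2 * (1 - ∑ n ∈ F, ‖inner 𝕜 (e n) v‖ ^ 2) := by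
  set P := fun x => ∑ n ∈ F, inner 𝕜 (e n) x • e n
  have symm : inner 𝕜 (P w) v = inner 𝕜 w (P v) := by
    simp only [P, sum_inner, inner_sum, inner_smul_left, inner_smul_right, inner_conj_symm,
      mul_comm]
  have split : inner 𝕜 w v = inner 𝕜 (P w) v + inner 𝕜 w (v - P v) := by
    rw [symm, ← inner_add_right, add_sub_cancel]
  calc ‖inner 𝕜 w v‖ ^ 2 ≤ (‖P w‖ + ‖w‖ * ‖v - P v‖) ^ 2 := by
        rw [split]
        gcongr
        refine norm_add_le_of_le ?_ (norm_inner_le_norm _ _)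
        simpa only [hv, mul_one] using norm_inner_le_norm (𝕜 := 𝕜) (P w) v
    _ ≤ 2 * (‖P w‖ ^ 2 + (‖w‖ * ‖v - P v‖) ^ 2) := add_sq_le
    _ = _ := by
        rw [mul_pow, norm_sum_inner_smul_sq_of_orthonormal he,
          norm_sub_sum_inner_smul_sq_of_orthonormal he, hv]
        ring

end Orthonormal

section AbelMeans

open MeasureTheory ProbabilityTheory

variable {T : ℝ}

theorem abelMean_eq_integral (hT : 0 < T) (f : ℝ → ℝ) :
    abelMean T f = ∫ t, f t ∂expMeasure (2 / T) := by
  have density_ae : ∀ᵐ t ∂volume.restrict (Set.Ici (0 : ℝ)),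
      (exponentialPDF (2 / T) t).toReal • f t = 2 / T * (Real.exp (-2 * t / T) * f t) := by
    filter_upwards [ae_restrict_mem measurableSet_Ici] with t ht
    rw [exponentialPDF_of_nonneg ht, ENNReal.toReal_ofReal (by positivity), smul_eq_mul, mul_assoc]
    ring_nf
  have density_neg (t : ℝ) (ht : t ∉ Set.Ici (0 : ℝ)) :
      (exponentialPDF (2 / T) t).toReal • f t = 0 := by
    rw [exponentialPDF_of_neg (not_le.1 ht), ENNReal.toReal_zero, zero_smul]
  have density_measurable : Measurable (exponentialPDF (2 / T)) :=
    (measurable_exponentialPDFReal (2 / T)).ennreal_ofReal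
  change _ = ∫ t, f t ∂volume.withDensity (exponentialPDF (2 / T))
  rw [integral_withDensity_eq_integral_toReal_smul density_measurable
      (Filter.Eventually.of_forall fun _ => ENNReal.ofReal_lt_top),
    ← setIntegral_eq_integral_of_forall_compl_eq_zero density_neg, integral_congr_ae density_ae,
    integral_Ici_eq_integral_Ioi, integral_const_mul, abelMean]

theorem abelMean_nonneg {f : ℝ → ℝ} (hT : 0 < T) (hf : ∀ t, 0 ≤ f t) : 0 ≤ abelMean T f := by
  rw [abelMean_eq_integral hT]
  exact integral_nonneg hf

variable {E : Type*} [NormedAddCommGroup E] [InnerProductSpace ℂ E] {H : E →ₗ.[ℂ] E}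
  {U : ℝ → E →L[ℂ] E}

theorem IsUnitaryGroup.integrable_norm_sq_inner (hU : IsUnitaryGroup H U)
    (χ φ : E) (ν : Measure ℝ) [IsFiniteMeasure ν] :
    Integrable (fun t => ‖inner ℂ χ (U t φ)‖ ^ 2) ν := by
  refine Integrable.of_bound ((hU.continuous_inner χ φ).norm.pow 2).aestronglyMeasurable
    ((‖χ‖ * ‖φ‖) ^ 2) (Filter.Eventually.of_forall fun t => ?_)
  rw [norm_pow, norm_norm]
  gcongr
  exact hU.norm_inner_le χ φ t

theorem IsUnitaryGroup.norm_sq_inner_le_abelMean (hU : IsUnitaryGroup H U)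
    (hT : 0 < T) {ι : Type*} {e : ι → E} (he : Orthonormal ℂ e) (F : Finset ι) (ξ : E) {φ : E}
    (hφ : ‖φ‖ = 1) :
    ‖inner ℂ ξ φ‖ ^ 2 ≤ 2 * ∑ n ∈ F, abelMean T (fun t => ‖inner ℂ (e n) (U t ξ)‖ ^ 2) +
      2 * ‖ξ‖ ^ 2 * (1 - ∑ n ∈ F, abelMean T (fun t => ‖inner ℂ (e n) (U t φ)‖ ^ 2)) := by
  have := isProbabilityMeasure_expMeasure (div_pos two_pos hT)
  have integrable_sum (χ : E) : Integrable (fun t => ∑ n ∈ F, ‖inner ℂ (e n) (U t χ)‖ ^ 2)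
      (expMeasure (2 / T)) :=
    integrable_finsetSum F fun n _ => hU.integrable_norm_sq_inner (e n) χ _
  have mean_sum (χ : E) : ∑ n ∈ F, abelMean T (fun t => ‖inner ℂ (e n) (U t χ)‖ ^ 2) =
      ∫ t, ∑ n ∈ F, ‖inner ℂ (e n) (U t χ)‖ ^ 2 ∂expMeasure (2 / T) := by
    simp only [abelMean_eq_integral hT]
    exact (integral_finsetSum F fun n _ => hU.integrable_norm_sq_inner (e n) χ _).symm
  have pointwise (t : ℝ) : ‖inner ℂ ξ φ‖ ^ 2 ≤ 2 * ∑ n ∈ F, ‖inner ℂ (e n) (U t ξ)‖ ^ 2 +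
      2 * ‖ξ‖ ^ 2 * (1 - ∑ n ∈ F, ‖inner ℂ (e n) (U t φ)‖ ^ 2) := by
    have bound := norm_inner_sq_le_of_orthonormal he F (U t ξ) (v := U t φ)
      (by rw [hU.norm_map, hφ])
    rwa [hU.inner_map_map, hU.norm_map] at bound
  rw [mean_sum, mean_sum]
  have right_integrable := ((integrable_const (1 : ℝ)).sub (integrable_sum φ)).const_mul
    (2 * ‖ξ‖ ^ 2)
  have averaged := integral_mono (integrable_const (‖inner ℂ ξ φ‖ ^ 2))
    (((integrable_sum ξ).const_mul 2).add right_integrable) pointwise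
  rwa [integral_const, probReal_univ, one_smul,
    integral_add' ((integrable_sum ξ).const_mul 2) right_integrable, integral_const_mul,
    integral_const_mul, integral_sub' (integrable_const 1) (integrable_sum φ), integral_const,
    probReal_univ, one_smul] at averaged

end AbelMeans

section DeltaVectors

variable {S : Set ℤ}

theorem inner_delta (n : ℤ) (ψ : Ell2 S) : inner ℂ (delta S n) ψ = zeroExt ψ n := by
  unfold delta zeroExt
  split_ifs with h
  · rw [lp.inner_single_left]
    simp
  · simp

theorem orthonormal_delta : Orthonormal ℂ fun n : S => delta S n := by
  classical
  rw [orthonormal_iff_ite]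
  intro i j
  rw [inner_delta]
  simp only [zeroExt, delta, dif_pos i.2, dif_pos j.2, Subtype.coe_eta]
  rw [lp.single_apply, Pi.single_apply]

theorem norm_delta {n : ℤ} (hn : n ∈ S) : ‖delta S n‖ = 1 :=
  orthonormal_delta.norm_eq_one ⟨n, hn⟩

theorem tsum_ofReal_norm_inner_delta_sq (ψ : Ell2 S) :
    ∑' n : S, ENNReal.ofReal (‖inner ℂ (delta S n) ψ‖ ^ 2) = ENNReal.ofReal (‖ψ‖ ^ 2) := by
  have hasSum : HasSum (fun n : S => ‖ψ n‖ ^ 2) (‖ψ‖ ^ 2) := by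
    simpa using lp.hasSum_norm (p := 2) (by norm_num) ψ
  have inner_eq (n : S) : inner ℂ (delta S n) ψ = ψ n := by
    rw [inner_delta, zeroExt, dif_pos n.2]
  simp_rw [inner_eq]
  rw [← ENNReal.ofReal_tsum_of_nonneg (fun n => by positivity) hasSum.summable, hasSum.tsum_eq]

end DeltaVectors

section Moments

open MeasureTheory

variable {S : Set ℤ} {V : ℤ → ℝ} {T : ℝ}

theorem avgProb_eq_abelMean (S : Set ℤ) (V : ℤ → ℝ) (n : ℤ) (T : ℝ) : avgProb S V n T =
    abelMean T fun t => ‖inner ℂ (delta S n) (timeEvolution S V t (delta S 1))‖ ^ 2 := rfl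

theorem avgProb_nonneg (hT : 0 < T) (n : ℤ) : 0 ≤ avgProb S V n T :=
  abelMean_nonneg hT fun _ => sq_nonneg _

theorem tsum_avgProb (h1 : (1 : ℤ) ∈ S) (hT : 0 < T) :
    ∑' n : S, ENNReal.ofReal (avgProb S V n T) = 1 := by
  have hU := isUnitaryGroup_timeEvolution S V
  have := ProbabilityTheory.isProbabilityMeasure_expMeasure (div_pos two_pos hT)
  have as_lintegral (n : S) : ENNReal.ofReal (avgProb S V n T) =
      ∫⁻ t, ENNReal.ofReal (‖inner ℂ (delta S n) (timeEvolution S V t (delta S 1))‖ ^ 2)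
        ∂ProbabilityTheory.expMeasure (2 / T) := by
    rw [avgProb_eq_abelMean, abelMean_eq_integral hT]
    exact ofReal_integral_eq_lintegral_ofReal (hU.integrable_norm_sq_inner _ _ _)
      (Filter.Eventually.of_forall fun _ => sq_nonneg _)
  have measurable_term (n : S) : AEMeasurable (fun t => ENNReal.ofReal
      (‖inner ℂ (delta S n) (timeEvolution S V t (delta S 1))‖ ^ 2))
      (ProbabilityTheory.expMeasure (2 / T)) :=
    ((hU.continuous_inner _ _).norm.pow 2).measurable.ennreal_ofReal.aemeasurable
  simp_rw [as_lintegral]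
  rw [← lintegral_tsum measurable_term]
  simp_rw [tsum_ofReal_norm_inner_delta_sq, hU.norm_map, norm_delta h1]
  simp

theorem ofReal_le_moment {p R : ℝ} (hp : 0 ≤ p) (hR : 0 ≤ R) (h1 : (1 : ℤ) ∈ S) (hT : 0 < T)
    (F : Finset S) (hF : ∀ n : S, n ∉ F → R ≤ |((n : ℤ) : ℝ)|) :
    ENNReal.ofReal (R ^ p * (1 - ∑ n ∈ F, avgProb S V n T)) ≤ moment S V p T := by
  classical
  have Rp_nonneg : 0 ≤ R ^ p := Real.rpow_nonneg hR p
  have split : ENNReal.ofReal (R ^ p) ≤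
      ∑ n ∈ F, ENNReal.ofReal (R ^ p * avgProb S V n T) + moment S V p T := by
    calc ENNReal.ofReal (R ^ p) = ∑' n : S, ENNReal.ofReal (R ^ p * avgProb S V n T) := by
          simp_rw [ENNReal.ofReal_mul Rp_nonneg]
          rw [ENNReal.tsum_mul_left, tsum_avgProb h1 hT, mul_one]
      _ ≤ ∑' n : S, ((if n ∈ F then ENNReal.ofReal (R ^ p * avgProb S V n T) else 0) +
            ENNReal.ofReal (|((n : ℤ) : ℝ)| ^ p * avgProb S V n T)) := by
          refine ENNReal.tsum_le_tsum fun n => ?_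
          split_ifs with h
          · exact le_self_add
          · rw [zero_add]
            exact ENNReal.ofReal_le_ofReal (mul_le_mul_of_nonneg_right
              (Real.rpow_le_rpow hR (hF n h) hp) (avgProb_nonneg hT _))
      _ = _ := by
          rw [ENNReal.tsum_add, moment, tsum_eq_sum (s := F) fun n hn => if_neg hn,
            Finset.sum_congr rfl fun n hn => if_pos hn]
  rw [← ENNReal.ofReal_sum_of_nonneg fun n _ => mul_nonneg Rp_nonneg (avgProb_nonneg hT _),
    ← Finset.mul_sum] at split
  rw [mul_sub, mul_one, ENNReal.ofReal_sub _
    (mul_nonneg Rp_nonneg (Finset.sum_nonneg fun n _ => avgProb_nonneg hT _))]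
  exact tsub_le_iff_left.2 split

theorem inner_map_indicatorConstLp {E : Type*} [NormedAddCommGroup E] [InnerProductSpace ℂ E]
    {μ : Measure ℝ} [IsFiniteMeasure μ] (W : Lp ℂ 2 μ →ₗᵢ[ℂ] E) {B : Set ℝ}
    (hB : MeasurableSet B) :
    inner ℂ (W (indicatorConstLp 2 hB (measure_ne_top μ B) 1)) (W (expLp μ 0)) = μ.real B := by
  rw [W.inner_map_map, ← inner_conj_symm, inner_expLp_left, fourierStieltjes]
  simp only [Complex.ofReal_zero, zero_mul, mul_zero, Complex.exp_zero, one_mul]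
  rw [integral_indicatorConstLp]
  simp

theorem norm_map_indicatorConstLp_sq {E : Type*} [NormedAddCommGroup E] [InnerProductSpace ℂ E]
    {μ : Measure ℝ} [IsFiniteMeasure μ] (W : Lp ℂ 2 μ →ₗᵢ[ℂ] E) {B : Set ℝ}
    (hB : MeasurableSet B) :
    ‖W (indicatorConstLp 2 hB (measure_ne_top μ B) 1)‖ ^ 2 = μ.real B := by
  rw [W.norm_map, norm_indicatorConstLp two_ne_zero ENNReal.ofNat_ne_top, norm_one, one_mul,
    ENNReal.toReal_ofNat, ← Real.sqrt_eq_rpow, Real.sq_sqrt measureReal_nonneg]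

theorem quarter_measureReal_le_one_sub_sum_avgProb {b : ℝ} (h1 : (1 : ℤ) ∈ S) (hT : 0 < T)
    (J : Finset ℤ) (hb0 : 0 ≤ b)
    (hb : ∀ j ∈ J, spectralMeasure S V (delta S 1) (cell T j) ≤ ENNReal.ofReal b) {m : ℝ}
    (hm0 : 0 < m) (hm : (spectralMeasure S V (delta S 1)).real (⋃ j ∈ J, cell T j) = m)
    (F : Finset S) (hF : 4 * strichartzConst * b * F.card ≤ m ^ 2) :
    m / 4 ≤ 1 - ∑ n ∈ F, avgProb S V n T := by
  have hU := isUnitaryGroup_timeEvolution S V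
  have hμ := isSpectralMeasure_spectralMeasure S V (delta S 1)
  have := hμ.finite
  obtain ⟨W, hW⟩ := hU.exists_isometry hμ
  have hB : MeasurableSet (⋃ j ∈ J, cell T j) :=
    Finset.measurableSet_biUnion _ fun j _ => measurableSet_cell T j
  have W_exp : W (expLp _ 0) = delta S 1 := by
    rw [hW, hU.zero]
    rfl
  have overlap := inner_map_indicatorConstLp W hB
  have norm_sq := norm_map_indicatorConstLp_sq W hB
  rw [W_exp, hm] at overlap
  rw [hm] at norm_sq
  have inside : ∑ n ∈ F, abelMean T (fun t => ‖inner ℂ (delta S n) (timeEvolution S V t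
      (W (indicatorConstLp 2 hB (measure_ne_top _ _) 1)))‖ ^ 2) ≤ m ^ 2 / 4 := by
    refine (Finset.sum_le_sum fun (n : S) _ =>
      hU.abelMean_norm_sq_inner_le hW hT J hb0 hb hB (delta S n)).trans ?_
    simp only [norm_delta (Subtype.prop _), one_pow, mul_one, Finset.sum_const, nsmul_eq_mul]
    linarith
  have bound := hU.norm_sq_inner_le_abelMean hT orthonormal_delta F
    (W (indicatorConstLp 2 hB (measure_ne_top _ _) 1)) (norm_delta h1)
  rw [overlap, norm_sq, Complex.norm_real, Real.norm_of_nonneg hm0.le] at bound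
  simp only [← avgProb_eq_abelMean] at bound
  refine le_of_mul_le_mul_left (a := 2 * m) ?_ (by positivity)
  linarith

theorem ofReal_le_moment_of_cell_le {p b : ℝ} (hp : 0 ≤ p) (h1 : (1 : ℤ) ∈ S) (hT : 0 < T)
    (J : Finset ℤ) (hb0 : 0 ≤ b)
    (hb : ∀ j ∈ J, spectralMeasure S V (delta S 1) (cell T j) ≤ ENNReal.ofReal b) {m : ℝ}
    (hm0 : 0 < m) (hm : (spectralMeasure S V (delta S 1)).real (⋃ j ∈ J, cell T j) = m) (N : ℕ)
    (hN : 4 * strichartzConst * b * (2 * N + 1) ≤ m ^ 2) :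
    ENNReal.ofReal ((N : ℝ) ^ p * (m / 4)) ≤ moment S V p T := by
  classical
  set F : Finset S := Finset.subtype (· ∈ S) (Finset.Icc (-N : ℤ) N) with F_def
  have card_le : (F.card : ℝ) ≤ 2 * N + 1 := by
    have : F.card ≤ (Finset.Icc (-N : ℤ) N).card :=
      (Finset.card_subtype _ _).trans_le (Finset.card_filter_le _ _)
    rw [Int.card_Icc] at this
    have : F.card ≤ 2 * N + 1 := by omega
    exact_mod_cast this
  have outside (n : S) (hn : n ∉ F) : (N : ℝ) ≤ |((n : ℤ) : ℝ)| := by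
    have : (N : ℤ) ≤ |(n : ℤ)| := by
      rw [F_def, Finset.mem_subtype, Finset.mem_Icc] at hn
      grind
    exact_mod_cast this
  have const_nonneg := strichartzConst_pos
  refine le_trans (ENNReal.ofReal_le_ofReal ?_) (ofReal_le_moment hp N.cast_nonneg h1 hT F outside)
  gcongr
  exact quarter_measureReal_le_one_sub_sum_avgProb h1 hT J hb0 hb hm0 hm F
    (le_trans (by gcongr) hN)

end Moments

section GreenFunction

open MeasureTheory

variable {S : Set ℤ} {V : ℤ → ℝ} {T : ℝ}

/-- The Green function `⟨δₙ, (H - E - i/T)⁻¹ δ₁⟩`, encoded as the Fourier–Laplace transform of the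
amplitude `⟨δₙ, exp(-itH) δ₁⟩` so that no resolvent operator has to be constructed. -/
noncomputable def greenFunction (S : Set ℤ) (V : ℤ → ℝ) (T : ℝ) (n : ℤ) (E : ℝ) : ℂ :=
  Complex.I * fourierLaplace (fun t => inner ℂ (delta S n) (timeEvolution S V t (delta S 1)))
    (E + Complex.I * (1 / T : ℝ))

/-- The damped amplitude `exp(-t/T) ⟨δₙ, exp(-itH) δ₁⟩` for `t > 0`, extended by `0` to the line:
its Fourier transform is the Green function. -/
noncomputable def dampedAmplitude (S : Set ℤ) (V : ℤ → ℝ) (T : ℝ) (n : ℤ) : ℝ → ℂ :=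
  (Set.Ioi (0 : ℝ)).indicator fun t => Complex.exp (Complex.I * (Complex.I * (1 / T : ℝ)) * t) *
    inner ℂ (delta S n) (timeEvolution S V t (delta S 1))

theorem integrable_dampedAmplitude (hT : 0 < T) (n : ℤ) : Integrable (dampedAmplitude S V T n) := by
  have hU := isUnitaryGroup_timeEvolution S V
  exact (integrable_indicator_iff measurableSet_Ioi).2 (integrableOn_exp_I_mul_mul
    (hU.continuous_inner (delta S n) (delta S 1)) (hU.norm_inner_le _ _) (by simpa using hT))

theorem norm_dampedAmplitude_sq (n : ℤ) (t : ℝ) :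
    ‖dampedAmplitude S V T n t‖ ^ 2 = (Set.Ioi (0 : ℝ)).indicator (fun t => Real.exp (-2 * t / T) *
      ‖inner ℂ (delta S n) (timeEvolution S V t (delta S 1))‖ ^ 2) t := by
  unfold dampedAmplitude
  by_cases ht : t ∈ Set.Ioi (0 : ℝ)
  · rw [Set.indicator_of_mem ht, Set.indicator_of_mem ht, norm_mul, mul_pow,
      norm_exp_I_mul_mul_ofReal, ← Real.exp_nat_mul]
    congr 2
    simp only [Nat.cast_ofNat, Complex.mul_im, Complex.I_re, Complex.I_im, Complex.ofReal_re,
      Complex.ofReal_im]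
    ring
  · rw [Set.indicator_of_notMem ht, Set.indicator_of_notMem ht, norm_zero, zero_pow two_ne_zero]

theorem memLp_dampedAmplitude (hT : 0 < T) (n : ℤ) : MemLp (dampedAmplitude S V T n) 2 := by
  have amplitude_integrable := integrable_dampedAmplitude (S := S) (V := V) hT n
  refine (memLp_two_iff_integrable_sq_norm amplitude_integrable.aestronglyMeasurable).2 ?_
  simp_rw [norm_dampedAmplitude_sq]
  have hU := isUnitaryGroup_timeEvolution S V
  have decay : IntegrableOn (fun t => Real.exp (-2 * t / T)) (Set.Ioi 0) := by
    have := integrableOn_exp_mul_Ioi (div_neg_of_neg_of_pos (by norm_num : (-2 : ℝ) < 0) hT) 0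
    simpa only [div_mul_eq_mul_div] using this
  refine (integrable_indicator_iff measurableSet_Ioi).2 (decay.mul_bdd
    (c := (‖delta S n‖ * ‖delta S 1‖) ^ 2)
    ((hU.continuous_inner _ _).norm.pow 2).aestronglyMeasurable
    (Filter.Eventually.of_forall fun t => ?_))
  rw [norm_pow, norm_norm]
  gcongr
  exact hU.norm_inner_le _ _ t

theorem integral_norm_dampedAmplitude_sq (hT : 0 < T) (n : ℤ) :
    ∫ t, ‖dampedAmplitude S V T n t‖ ^ 2 = T / 2 * avgProb S V n T := by
  simp_rw [norm_dampedAmplitude_sq]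
  rw [integral_indicator measurableSet_Ioi, avgProb]
  field_simp

theorem greenFunction_eq_fourierStieltjes (S : Set ℤ) (V : ℤ → ℝ) (T : ℝ) (n : ℤ) (E : ℝ) :
    greenFunction S V T n E =
      Complex.I * fourierStieltjes volume (dampedAmplitude S V T n) E := by
  rw [greenFunction, fourierLaplace, fourierStieltjes, ← integral_indicator measurableSet_Ioi]
  congr 2 with t
  by_cases ht : t ∈ Set.Ioi (0 : ℝ)
  · rw [dampedAmplitude, Set.indicator_of_mem ht, Set.indicator_of_mem ht, ← mul_assoc,
      ← Complex.exp_add]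
    congr 2
    ring
  · rw [dampedAmplitude, Set.indicator_of_notMem ht, Set.indicator_of_notMem ht, mul_zero]

theorem norm_greenFunction (n : ℤ) (E : ℝ) : ‖greenFunction S V T n E‖ =
    ‖fourierStieltjes volume (dampedAmplitude S V T n) E‖ := by
  rw [greenFunction_eq_fourierStieltjes, norm_mul, Complex.norm_I, one_mul]

theorem integrable_norm_sq_greenFunction (hT : 0 < T) (n : ℤ) :
    Integrable fun E => ‖greenFunction S V T n E‖ ^ 2 := by
  simp only [norm_greenFunction]
  exact integrable_norm_sq_fourierStieltjes_volume (integrable_dampedAmplitude hT n)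
    (memLp_dampedAmplitude hT n)

theorem integral_norm_sq_greenFunction (hT : 0 < T) (n : ℤ) :
    ∫ E, ‖greenFunction S V T n E‖ ^ 2 = Real.pi * T * avgProb S V n T := by
  simp only [norm_greenFunction]
  rw [integral_norm_sq_fourierStieltjes_volume (integrable_dampedAmplitude hT n)
    (memLp_dampedAmplitude hT n), integral_norm_dampedAmplitude_sq hT]
  ring

theorem greenFunction_eq_zeroExt (hT : 0 < T) {E : ℝ} {ψ : (schrodinger S V).domain}
    (hψ : schrodinger S V ψ - (E + Complex.I * (1 / T : ℝ)) • (ψ : Ell2 S) = delta S 1) (n : ℤ) :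
    greenFunction S V T n E = zeroExt (ψ : Ell2 S) n := by
  rw [← inner_delta, (isUnitaryGroup_timeEvolution S V).inner_resolvent (delta S n) (delta S 1)
    (by simpa using hT) ψ hψ, greenFunction]

theorem greenFunction_one (hT : 0 < T) (E : ℝ) : greenFunction S V T 1 E =
    ∫ x : ℝ, 1 / ((x : ℂ) - (E + Complex.I * (1 / T : ℝ))) ∂spectralMeasure S V (delta S 1) := by
  obtain ⟨ψ, hψ, borel⟩ := (isSpectralMeasure_spectralMeasure S V (delta S 1)).borel
    (E + Complex.I * (1 / T : ℝ)) (by simp [hT.ne'])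
  rw [greenFunction_eq_zeroExt hT hψ, ← borel, inner_delta]

theorem zeroExt_delta_of_ne {m n : ℤ} (h : m ≠ n) : zeroExt (delta S m) n = 0 := by
  unfold zeroExt delta
  split_ifs with hn hm
  · exact lp.single_apply_ne _ _ _ fun heq => h.symm (congrArg Subtype.val heq)
  · rfl
  · rfl

theorem greenFunction_add_three (hS : Set.Ici 1 ⊆ S) (hT : 0 < T) (E : ℝ) (n : ℕ) :
    greenFunction S V T (n + 3) E =
      (E + Complex.I * (1 / T : ℝ) - V (n + 2)) * greenFunction S V T (n + 2) E -
        greenFunction S V T (n + 1) E := by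
  obtain ⟨ψ, hψ, -⟩ := (isSpectralMeasure_spectralMeasure S V (delta S 1)).borel
    (E + Complex.I * (1 / T : ℝ)) (by simp [hT.ne'])
  simp only [greenFunction_eq_zeroExt hT hψ]
  have mem : (n : ℤ) + 2 ∈ S := hS (by simp only [Set.mem_Ici]; omega)
  have at_site (φ : Ell2 S) : zeroExt φ ((n : ℤ) + 2) = φ ⟨(n : ℤ) + 2, mem⟩ := dif_pos mem
  have eigen := congrArg (fun φ : Ell2 S => zeroExt φ ((n : ℤ) + 2)) hψ
  rw [zeroExt_delta_of_ne (by omega), at_site, lp.coeFn_sub, Pi.sub_apply, lp.coeFn_smul,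
    Pi.smul_apply, smul_eq_mul, ← at_site ψ, schrodinger_apply, ← schrodingerExpr_eq,
    schrodingerExpr, ← at_site ψ, show (n : ℤ) + 2 + 1 = n + 3 by ring,
    show (n : ℤ) + 2 - 1 = n + 1 by ring] at eigen
  linear_combination eigen

end GreenFunction

section CellBounds

open MeasureTheory

variable {S : Set ℤ} {V : ℤ → ℝ} {T : ℝ}

theorem volume_real_cell (hT : 0 < T) (j : ℤ) : volume.real (cell T j) = 1 / T := by
  rw [cell, Real.volume_real_Ico_of_le (by gcongr; linarith)]
  ring

theorem sq_sub_le_of_mem_cell {j : ℤ} {x y : ℝ} (hx : x ∈ cell T j)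
    (hy : y ∈ cell T j) : (x - y) ^ 2 ≤ (1 / T) ^ 2 := by
  rw [cell, Set.mem_Ico, add_div] at hx hy
  exact sq_le_sq' (by linarith [hx.1, hy.2]) (by linarith [hx.2, hy.1])

theorem im_one_div_sub (x E : ℝ) (ε : ℝ) :
    (1 / ((x : ℂ) - (E + Complex.I * ε))).im = ε / ((x - E) ^ 2 + ε ^ 2) := by
  rw [one_div, Complex.inv_im, Complex.normSq_apply]
  simp only [Complex.sub_im, Complex.sub_re, Complex.add_im, Complex.add_re, Complex.ofReal_im,
    Complex.ofReal_re, Complex.mul_im, Complex.mul_re, Complex.I_re, Complex.I_im]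
  ring_nf

theorem integrable_one_div_sub (μ : Measure ℝ) [IsFiniteMeasure μ] {z : ℂ} (hz : z.im ≠ 0) :
    Integrable (fun x : ℝ => 1 / ((x : ℂ) - z)) μ := by
  have im_le (x : ℝ) : |z.im| ≤ ‖(x : ℂ) - z‖ := by
    simpa using Complex.abs_im_le_norm ((x : ℂ) - z)
  have ne_zero (x : ℝ) : (x : ℂ) - z ≠ 0 :=
    norm_pos_iff.1 ((abs_pos.2 hz).trans_le (im_le x))
  refine Integrable.of_bound (C := 1 / |z.im|)
    (Continuous.div continuous_const (by fun_prop) ne_zero).aestronglyMeasurable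
    (Filter.Eventually.of_forall fun x => ?_)
  rw [norm_div, norm_one]
  exact one_div_le_one_div_of_le (abs_pos.2 hz) (im_le x)

theorem mul_measureReal_cell_le_norm_integral (hT : 0 < T) {j : ℤ} {E : ℝ} (hE : E ∈ cell T j)
    (μ : Measure ℝ) [IsFiniteMeasure μ] :
    T / 2 * μ.real (cell T j) ≤ ‖∫ x : ℝ, 1 / ((x : ℂ) - (E + Complex.I * (1 / T : ℝ))) ∂μ‖ := by
  have kernel_integrable := integrable_one_div_sub μ (z := E + Complex.I * (1 / T : ℝ))
    (by simp [hT.ne'])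
  have poisson_integrable : Integrable (fun x => 1 / T / ((x - E) ^ 2 + (1 / T) ^ 2)) μ := by
    simpa only [RCLike.im_to_complex, im_one_div_sub] using kernel_integrable.im
  have poisson_ge (x : ℝ) (hx : x ∈ cell T j) : T / 2 ≤ 1 / T / ((x - E) ^ 2 + (1 / T) ^ 2) := by
    calc T / 2 = 1 / T / ((1 / T) ^ 2 + (1 / T) ^ 2) := by
          field_simp
          ring
      _ ≤ _ := by
          gcongr 1 / T / (?_ + (1 / T) ^ 2)
          exact sq_sub_le_of_mem_cell hx hE
  calc T / 2 * μ.real (cell T j) = ∫ _ in cell T j, T / 2 ∂μ := by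
        rw [setIntegral_const, smul_eq_mul, mul_comm]
    _ ≤ ∫ x in cell T j, 1 / T / ((x - E) ^ 2 + (1 / T) ^ 2) ∂μ :=
        setIntegral_mono_on (integrableOn_const (measure_ne_top _ _))
          poisson_integrable.integrableOn (measurableSet_cell T j) poisson_ge
    _ ≤ ∫ x, 1 / T / ((x - E) ^ 2 + (1 / T) ^ 2) ∂μ :=
        setIntegral_le_integral poisson_integrable
          (Filter.Eventually.of_forall fun x => by positivity)
    _ = (∫ x : ℝ, 1 / ((x : ℂ) - (E + Complex.I * (1 / T : ℝ))) ∂μ).im := by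
        simp_rw [← im_one_div_sub]
        exact integral_im kernel_integrable
    _ ≤ _ := (le_abs_self _).trans (Complex.abs_im_le_norm _)

theorem mul_measureReal_cell_sq_le_sum {p K : ℝ} (hT : 0 < T) (hK : 0 ≤ K) (N : ℕ) (j : ℤ)
    (hres : ∀ E ∈ cell T j, K * ‖greenFunction S V T 1 E‖ ^ 2 ≤
      ∑ n ∈ Finset.Icc 1 N, (n : ℝ) ^ p * ‖greenFunction S V T n E‖ ^ 2) :
    K * (T / 4) * (spectralMeasure S V (delta S 1)).real (cell T j) ^ 2 ≤
      ∑ n ∈ Finset.Icc 1 N, (n : ℝ) ^ p * ∫ E in cell T j, ‖greenFunction S V T n E‖ ^ 2 := by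
  have := (isSpectralMeasure_spectralMeasure S V (delta S 1)).finite
  set μ := spectralMeasure S V (delta S 1)
  have integrable_term (n : ℕ) :
      IntegrableOn (fun E => (n : ℝ) ^ p * ‖greenFunction S V T n E‖ ^ 2) (cell T j) :=
    ((integrable_norm_sq_greenFunction hT n).const_mul _).integrableOn
  calc _ = ∫ _ in cell T j, K * (T / 2 * μ.real (cell T j)) ^ 2 := by
        rw [setIntegral_const, volume_real_cell hT, smul_eq_mul]
        field_simp
        ring
    _ ≤ ∫ E in cell T j, ∑ n ∈ Finset.Icc 1 N, (n : ℝ) ^ p * ‖greenFunction S V T n E‖ ^ 2 := by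
        refine setIntegral_mono_on (integrableOn_const (by simp [cell]))
          (integrable_finsetSum _ fun n _ => integrable_term n) (measurableSet_cell T j)
          fun E hE => le_trans ?_ (hres E hE)
        rw [greenFunction_one hT]
        gcongr
        exact mul_measureReal_cell_le_norm_integral hT hE μ
    _ = _ := by
        rw [integral_finsetSum _ fun n _ => integrable_term n]
        exact Finset.sum_congr rfl fun n _ => integral_const_mul _ _

theorem sum_setIntegral_cell_norm_sq_greenFunction_le (hT : 0 < T) (J : Finset ℤ) (n : ℤ) :
    ∑ j ∈ J, ∫ E in cell T j, ‖greenFunction S V T n E‖ ^ 2 ≤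
      Real.pi * T * avgProb S V n T := by
  have integrable_green := integrable_norm_sq_greenFunction (S := S) (V := V) hT n
  rw [← integral_norm_sq_greenFunction hT, ← integral_biUnion_finset J
    (fun j _ => measurableSet_cell T j) ((pairwise_disjoint_cell hT).set_pairwise _)
    fun j _ => integrable_green.integrableOn]
  exact setIntegral_le_integral integrable_green
    (Filter.Eventually.of_forall fun E => sq_nonneg _)

theorem ofReal_sum_mul_avgProb_le_moment (p : ℝ) (hS : Set.Ici 1 ⊆ S) (hT : 0 < T) (N : ℕ) :
    ENNReal.ofReal (∑ n ∈ Finset.Icc 1 N, (n : ℝ) ^ p * avgProb S V n T) ≤ moment S V p T := by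
  have mem_S {n : ℕ} (hn : n ∈ Finset.Icc 1 N) : (n : ℤ) ∈ S :=
    hS (by simpa using (Finset.mem_Icc.1 hn).1)
  rw [moment, ENNReal.ofReal_sum_of_nonneg
    fun n _ => mul_nonneg (by positivity) (avgProb_nonneg hT _), ← Finset.tsum_subtype]
  have embed_injective :
      Function.Injective fun n : Finset.Icc 1 N => (⟨(n : ℕ), mem_S n.2⟩ : S) :=
    fun m n h => Subtype.ext (Int.natCast_inj.1 (congrArg Subtype.val h))
  simpa using ENNReal.tsum_comp_le_tsum_of_injective embed_injective
    fun n : S => ENNReal.ofReal (|((n : ℤ) : ℝ)| ^ p * avgProb S V n T)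

theorem ofReal_le_moment_of_greenFunction {p K : ℝ} (hS : Set.Ici 1 ⊆ S) (hT : 0 < T)
    (J : Finset ℤ) (hK : 0 ≤ K) (N : ℕ)
    (hres : ∀ j ∈ J, ∀ E ∈ cell T j, K * ‖greenFunction S V T 1 E‖ ^ 2 ≤
      ∑ n ∈ Finset.Icc 1 N, (n : ℝ) ^ p * ‖greenFunction S V T n E‖ ^ 2) :
    ENNReal.ofReal (K / (4 * Real.pi) *
      ∑ j ∈ J, (spectralMeasure S V (delta S 1)).real (cell T j) ^ 2) ≤ moment S V p T := by
  refine (ENNReal.ofReal_le_ofReal ?_).trans (ofReal_sum_mul_avgProb_le_moment p hS hT N)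
  refine le_of_mul_le_mul_left (a := Real.pi * T) ?_ (by positivity)
  calc _ = ∑ j ∈ J, K * (T / 4) * (spectralMeasure S V (delta S 1)).real (cell T j) ^ 2 := by
        rw [← Finset.mul_sum]
        have := Real.pi_pos
        field_simp
    _ ≤ ∑ j ∈ J, ∑ n ∈ Finset.Icc 1 N, (n : ℝ) ^ p *
          ∫ E in cell T j, ‖greenFunction S V T n E‖ ^ 2 :=
        Finset.sum_le_sum fun j hj => mul_measureReal_cell_sq_le_sum hT hK N j (hres j hj)
    _ = ∑ n ∈ Finset.Icc 1 N, (n : ℝ) ^ p *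
          ∑ j ∈ J, ∫ E in cell T j, ‖greenFunction S V T n E‖ ^ 2 := by
        rw [Finset.sum_comm]
        simp only [Finset.mul_sum]
    _ ≤ ∑ n ∈ Finset.Icc 1 N, (n : ℝ) ^ p * (Real.pi * T * avgProb S V n T) := by
        gcongr with n
        exact sum_setIntegral_cell_norm_sq_greenFunction_le hT J n
    _ = _ := by
        rw [Finset.mul_sum]
        exact Finset.sum_congr rfl fun n _ => by ring

end CellBounds

section ResolventGrowth

variable {S : Set ℤ} {V : ℤ → ℝ} {T : ℝ}

theorem norm_sub_add_I_div_sq_le {j : ℤ} {E E₀ : ℝ} (hE : E ∈ cell T j) (hE₀ : E₀ ∈ cell T j) :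
    ‖(E - E₀ + Complex.I * (1 / T : ℝ) : ℂ)‖ ^ 2 ≤ 2 / T ^ 2 := by
  have close := sq_sub_le_of_mem_cell hE hE₀
  calc _ = (E - E₀) ^ 2 + (1 / T) ^ 2 := by
        rw [mul_comm, ← Complex.ofReal_sub, Complex.sq_norm, Complex.normSq_add_mul_I]
    _ ≤ (1 / T) ^ 2 + (1 / T) ^ 2 := by gcongr
    _ = 2 / T ^ 2 := by ring

theorem mul_norm_sq_greenFunction_one_le {K p E₀ : ℝ} (hS : Set.Ici 1 ⊆ S) (hT : 0 < T)
    (hK : 0 ≤ K) {N : ℕ}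
    (hgrowth : ∀ (ζ : ℂ) (ψ : ℕ → ℂ), ‖ζ‖ ^ 2 ≤ 2 / T ^ 2 →
      (∀ n : ℕ, ψ (n + 2) = ((E₀ - V (n + 1 : ℕ) : ℝ) + ζ) * ψ (n + 1) - ψ n) →
      K * (‖ψ 0‖ ^ 2 + ‖ψ 1‖ ^ 2) ≤ ∑ n ∈ Finset.Icc 1 N, (n : ℝ) ^ p * ‖ψ n‖ ^ 2)
    {j : ℤ} (hE₀ : E₀ ∈ cell T j) {E : ℝ} (hE : E ∈ cell T j) :
    K * ‖greenFunction S V T 1 E‖ ^ 2 ≤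
      ∑ n ∈ Finset.Icc 1 N, (n : ℝ) ^ p * ‖greenFunction S V T n E‖ ^ 2 := by
  set ζ : ℂ := E - E₀ + Complex.I * (1 / T : ℝ) with ζ_def
  -- At the site `1` the equation has the source `δ₁`, so the value at `0` is redefined there.
  set ψ : ℕ → ℂ := fun
    | 0 => ((E₀ - V 1 : ℝ) + ζ) * greenFunction S V T 1 E - greenFunction S V T 2 E
    | n + 1 => greenFunction S V T (n + 1) E
  have recurrence (n : ℕ) :
      ψ (n + 2) = ((E₀ - V (n + 1 : ℕ) : ℝ) + ζ) * ψ (n + 1) - ψ n := by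
    rcases n with - | n
    · simp [ψ]
    · have := greenFunction_add_three (V := V) hS hT E n
      simp only [ψ, ζ_def, Complex.ofReal_sub, Nat.cast_add, Nat.cast_one, Nat.cast_ofNat]
      rw [show (n : ℤ) + 2 + 1 = n + 3 by ring, show (n : ℤ) + 1 + 1 = n + 2 by ring]
      linear_combination this
  calc K * ‖greenFunction S V T 1 E‖ ^ 2 ≤ K * (‖ψ 0‖ ^ 2 + ‖ψ 1‖ ^ 2) := by
        gcongr
        exact le_add_of_nonneg_left (sq_nonneg _)
    _ ≤ ∑ n ∈ Finset.Icc 1 N, (n : ℝ) ^ p * ‖ψ n‖ ^ 2 :=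
        hgrowth ζ ψ (norm_sub_add_I_div_sq_le hE hE₀) recurrence
    _ = _ := by
        refine Finset.sum_congr rfl fun n hn => ?_
        obtain ⟨m, rfl⟩ := Nat.exists_eq_add_of_le' (Finset.mem_Icc.1 hn).1
        simp [ψ]

theorem PowerLawLowerBound.exists_mul_norm_sq_greenFunction_le {A : Set ℝ} {α κ p : ℝ}
    (hlow : PowerLawLowerBound S V A κ) (ha : PowerLawUpperBound S V A α)
    (hb : ScalingLowerBound S V A) (hS : Set.Ici 1 ⊆ S) (hκ : 0 < κ) (hp : 0 < p)
    (hpα : p ≤ 2 * α + 1) :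
    ∃ c > 0, ∃ T₀, ∀ T > T₀, ∀ j, (cell T j ∩ A).Nonempty → ∃ N : ℕ, ∀ E ∈ cell T j,
      c * T ^ ((p + 2 * κ) / (α + κ + 1 / 2)) * ‖greenFunction S V T 1 E‖ ^ 2 ≤
        ∑ n ∈ Finset.Icc 1 N, (n : ℝ) ^ p * ‖greenFunction S V T n E‖ ^ 2 := by
  obtain ⟨C, hC, upper⟩ := ha
  obtain ⟨k, γ, L₀, hk, hk1, hγ, hγ1, hL₀, scale⟩ := hb
  obtain ⟨D, L₁, hD, hL₁, lower⟩ := hlow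
  refine ⟨k ^ p * (γ / 16) * min (D ^ 2) (γ ^ 2 / (4096 * C)), by positivity,
    64 * C * (max L₀ L₁) ^ (2 * α + 1) / γ, ?_⟩
  rintro T hT j ⟨E₀, hE₀, hA⟩
  have T_pos : 0 < T := lt_of_le_of_lt (by positivity) hT
  obtain ⟨N, growth⟩ := exists_moment_ge (q := fun m => E₀ - V m) hκ hC (pow_pos hD 2) hk hk1 hγ
    hγ1 hL₀ hp hpα hT
    (fun a b L hab hL => by
      rw [← normSqUpTo_lineSol V E₀ a b (by positivity)]
      exact upper E₀ hA _ (isSolution_lineSol S V E₀ a b) (isNormalized_lineSol hab) L hL)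
    (fun a b L hL => by
      rw [← normSqUpTo_lineSol V E₀ a b (by nlinarith), ← normSqUpTo_lineSol V E₀ a b (by linarith)]
      exact scale E₀ hA _ (isSolution_lineSol S V E₀ a b) L hL)
    (fun a b L hL => mul_rpow_mul_le_solNormSq hD.le (by linarith)
      (fun u hu hnorm => lower E₀ hA u hu hnorm L hL) a b)
  exact ⟨N, fun E hE =>
    mul_norm_sq_greenFunction_one_le hS T_pos (by positivity) growth hE₀ hE⟩

end ResolventGrowth

section Spreading

open MeasureTheory

variable {S : Set ℤ} {V : ℤ → ℝ} {T p : ℝ}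

theorem ofReal_le_moment_of_large_cells {K b m : ℝ} (hS : Set.Ici 1 ⊆ S) (hT : 0 < T)
    (hK : 0 ≤ K) (hb : 0 ≤ b) {J : Finset ℤ}
    (hres : ∀ j ∈ J, ∃ N : ℕ, ∀ E ∈ cell T j, K * ‖greenFunction S V T 1 E‖ ^ 2 ≤
      ∑ n ∈ Finset.Icc 1 N, (n : ℝ) ^ p * ‖greenFunction S V T n E‖ ^ 2)
    (hlarge : ∀ j ∈ J, b ≤ (spectralMeasure S V (delta S 1)).real (cell T j))
    (hm : m ≤ (spectralMeasure S V (delta S 1)).real (⋃ j ∈ J, cell T j)) :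
    ENNReal.ofReal (K / (4 * Real.pi) * (b * m)) ≤ moment S V p T := by
  have := (isSpectralMeasure_spectralMeasure S V (delta S 1)).finite
  set μ := spectralMeasure S V (delta S 1)
  choose! N hN using hres
  refine le_trans (ENNReal.ofReal_le_ofReal ?_) (ofReal_le_moment_of_greenFunction hS hT J hK
    (J.sup N) fun j hj E hE => (hN j hj E hE).trans ?_)
  · gcongr
    calc b * m ≤ b * ∑ j ∈ J, μ.real (cell T j) := by
          gcongr
          exact hm.trans (measureReal_biUnion_finset_le _ _)
      _ ≤ ∑ j ∈ J, μ.real (cell T j) ^ 2 := by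
          rw [Finset.mul_sum]
          refine Finset.sum_le_sum fun j hj => ?_
          rw [sq]
          exact mul_le_mul_of_nonneg_right (hlarge j hj) measureReal_nonneg
  · exact Finset.sum_le_sum_of_subset_of_nonneg
      (Finset.Icc_subset_Icc_right (Finset.le_sup hj)) fun n _ _ => by positivity

theorem ofReal_le_moment_of_small_cells {b m : ℝ} (h1 : (1 : ℤ) ∈ S) (hT : 0 < T) (hp : 0 ≤ p)
    (hb : 0 < b) {J : Finset ℤ}
    (hsmall : ∀ j ∈ J, (spectralMeasure S V (delta S 1)).real (cell T j) ≤ b) (hm0 : 0 < m)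
    (hm : m ≤ (spectralMeasure S V (delta S 1)).real (⋃ j ∈ J, cell T j))
    (hbm : 12 * strichartzConst * b ≤ m ^ 2) :
    ENNReal.ofReal ((m ^ 2 / (24 * strichartzConst * b)) ^ p * (m / 4)) ≤ moment S V p T := by
  have := (isSpectralMeasure_spectralMeasure S V (delta S 1)).finite
  set μ := spectralMeasure S V (delta S 1)
  have const_pos := strichartzConst_pos
  set x := m ^ 2 / (12 * strichartzConst * b) with x_def
  have one_le_x : 1 ≤ x := (one_le_div (by positivity)).2 hbm
  have floor_le : (⌊x⌋₊ : ℝ) ≤ x := Nat.floor_le (by positivity)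
  have le_floor : x / 2 ≤ ⌊x⌋₊ := by
    have : (1 : ℝ) ≤ ⌊x⌋₊ := by exact_mod_cast (Nat.one_le_floor_iff x).2 one_le_x
    linarith [Nat.lt_floor_add_one x]
  refine le_trans (ENNReal.ofReal_le_ofReal ?_) (ofReal_le_moment_of_cell_le hp h1 hT J hb.le
    (fun j hj => ?_) (hm0.trans_le hm) rfl ⌊x⌋₊ ?_)
  · calc _ = (x / 2) ^ p * (m / 4) := by
          rw [x_def]
          congr 2
          field_simp
          norm_num
      _ ≤ _ := by gcongr
  · rw [← ofReal_measureReal]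
    exact ENNReal.ofReal_le_ofReal (hsmall j hj)
  · calc _ ≤ 4 * strichartzConst * b * (3 * x) := by
          gcongr
          linarith
      _ = m ^ 2 := by
          rw [x_def]
          field_simp
          norm_num
      _ ≤ _ := by gcongr

theorem ofReal_min_le_moment {K b m : ℝ} (hS : Set.Ici 1 ⊆ S) (hT : 0 < T) (hp : 0 ≤ p)
    (hK : 0 ≤ K) (hb : 0 < b) {J : Finset ℤ}
    (hres : ∀ j ∈ J, ∃ N : ℕ, ∀ E ∈ cell T j, K * ‖greenFunction S V T 1 E‖ ^ 2 ≤
      ∑ n ∈ Finset.Icc 1 N, (n : ℝ) ^ p * ‖greenFunction S V T n E‖ ^ 2)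
    (hm0 : 0 < m) (hm : 2 * m ≤ (spectralMeasure S V (delta S 1)).real (⋃ j ∈ J, cell T j))
    (hbm : 12 * strichartzConst * b ≤ m ^ 2) :
    ENNReal.ofReal (min (K / (4 * Real.pi) * (b * m))
      ((m ^ 2 / (24 * strichartzConst * b)) ^ p * (m / 4))) ≤ moment S V p T := by
  have := (isSpectralMeasure_spectralMeasure S V (delta S 1)).finite
  set μ := spectralMeasure S V (delta S 1)
  set large := J.filter fun j => b ≤ μ.real (cell T j)
  set small := J.filter fun j => ¬ b ≤ μ.real (cell T j)
  have split : 2 * m ≤ μ.real (⋃ j ∈ large, cell T j) + μ.real (⋃ j ∈ small, cell T j) := by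
    refine hm.trans (le_trans (le_of_eq ?_) (measureReal_union_le _ _))
    rw [← Finset.set_biUnion_union, Finset.filter_union_filter_not_eq]
  rcases le_total m (μ.real (⋃ j ∈ large, cell T j)) with hlarge | hlarge
  · exact (ENNReal.ofReal_le_ofReal (min_le_left _ _)).trans <|
      ofReal_le_moment_of_large_cells hS hT hK hb.le
        (fun j hj => hres j (Finset.mem_filter.1 hj).1) (fun j hj => (Finset.mem_filter.1 hj).2)
        hlarge
  · exact (ENNReal.ofReal_le_ofReal (min_le_right _ _)).trans <|
      ofReal_le_moment_of_small_cells (hS Set.self_mem_Ici) hT hp hb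
        (fun j hj => (not_le.1 (Finset.mem_filter.1 hj).2).le) hm0 (by linarith) hbm

theorem exists_finset_subset_biUnion_cell (hT : 0 < T) {A : Set ℝ} {R : ℝ}
    (hR : ∀ E ∈ A, |E| ≤ R) :
    ∃ J : Finset ℤ, (∀ j ∈ J, (cell T j ∩ A).Nonempty) ∧ A ⊆ ⋃ j ∈ J, cell T j := by
  classical
  refine ⟨(Finset.Icc ⌊-R * T⌋ ⌊R * T⌋).filter fun j => (cell T j ∩ A).Nonempty,
    fun j hj => (Finset.mem_filter.1 hj).2, fun E hE => ?_⟩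
  have mem_own_cell : E ∈ cell T ⌊E * T⌋ := (mem_cell_iff_floor_eq hT).2 rfl
  obtain ⟨lower, upper⟩ := abs_le.1 (hR E hE)
  refine Set.mem_biUnion (Finset.mem_coe.2 (Finset.mem_filter.2
    ⟨Finset.mem_Icc.2 ⟨?_, ?_⟩, E, mem_own_cell, hE⟩)) mem_own_cell
  · gcongr
  · gcongr

theorem exists_eventually_ofReal_rpow_le_moment {A : Set ℝ} {s c T₀ R : ℝ} (hS : Set.Ici 1 ⊆ S)
    (hp : 0 < p) (hs : 0 < s) (hc : 0 < c) (hμ : 0 < spectralMeasure S V (delta S 1) A)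
    (hR : ∀ E ∈ A, |E| ≤ R)
    (hres : ∀ T > T₀, ∀ j, (cell T j ∩ A).Nonempty → ∃ N : ℕ, ∀ E ∈ cell T j,
      c * T ^ s * ‖greenFunction S V T 1 E‖ ^ 2 ≤
        ∑ n ∈ Finset.Icc 1 N, (n : ℝ) ^ p * ‖greenFunction S V T n E‖ ^ 2) :
    ∃ c' > 0, ∀ᶠ T in Filter.atTop,
      ENNReal.ofReal (c' * T ^ (s * p / (p + 1))) ≤ moment S V p T := by
  have := (isSpectralMeasure_spectralMeasure S V (delta S 1)).finite
  set μ := spectralMeasure S V (delta S 1)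
  set m := μ.real A / 2 with m_def
  have m_pos : 0 < m := half_pos (ENNReal.toReal_pos hμ.ne' (measure_ne_top _ _))
  have const_pos := strichartzConst_pos
  -- The threshold `T ^ (-q)` between large and small cells balances the two bounds.
  set q := s / (p + 1) with q_def
  have q_pos : 0 < q := by positivity
  have large_exponent : s - q = s * p / (p + 1) := by
    rw [q_def]
    field_simp
    ring
  have small_exponent : q * p = s * p / (p + 1) := by
    rw [q_def]
    field_simp
  set c₁ := c / (4 * Real.pi) * m
  set c₂ := (m ^ 2 / (24 * strichartzConst)) ^ p * (m / 4)
  refine ⟨min c₁ c₂, by positivity, ?_⟩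
  filter_upwards [Filter.eventually_gt_atTop T₀, Filter.eventually_gt_atTop 0,
    (tendsto_rpow_atTop q_pos).eventually_ge_atTop (12 * strichartzConst / m ^ 2)]
    with T hT₀ hT hTq
  obtain ⟨J, meets, covers⟩ := exists_finset_subset_biUnion_cell hT hR
  convert ofReal_min_le_moment hS hT hp.le (by positivity) (b := T ^ (-q)) (by positivity)
    (fun j hj => hres T hT₀ j (meets j hj)) m_pos ?_ ?_ using 2
  · rw [min_mul_of_nonneg _ _ (by positivity)]
    congr 1
    · rw [← large_exponent, sub_eq_add_neg, Real.rpow_add hT]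
      ring
    · rw [← small_exponent, Real.rpow_mul hT.le, Real.rpow_neg hT.le, mul_right_comm,
        ← Real.mul_rpow (by positivity) (by positivity)]
      congr 2
      field_simp
  · rw [m_def, mul_div_cancel₀ _ two_ne_zero]
    exact measureReal_mono covers (measure_ne_top _ _)
  · rw [Real.rpow_neg hT.le, ← div_eq_mul_inv, div_le_comm₀ (by positivity) (by positivity)]
    exact hTq

theorem PowerLawLowerBound.exists_eventually_le_moment {A : Set ℝ} {α κ : ℝ}
    (hlow : PowerLawLowerBound S V A κ) (ha : PowerLawUpperBound S V A α)
    (hb : ScalingLowerBound S V A) (hS : Set.Ici 1 ⊆ S)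
    (hμ : 0 < spectralMeasure S V (delta S 1) A) (hκ : 0 < κ) (hp : 0 < p)
    (hpα : p ≤ 2 * α + 1) :
    ∃ c > 0, ∀ᶠ T in Filter.atTop,
      ENNReal.ofReal (c * T ^ (p * (p + 2 * κ) / ((p + 1) * (α + κ + 1 / 2)))) ≤
        moment S V p T := by
  obtain ⟨c, hc, T₀, growth⟩ :=
    hlow.exists_mul_norm_sq_greenFunction_le ha hb hS hκ hp hpα
  obtain ⟨W, hW⟩ := ha.exists_abs_sub_le (hS Set.self_mem_Ici)
  have bounded (E : ℝ) (hE : E ∈ A) : |E| ≤ W + |V 1| := by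
    linarith [hW E hE, abs_sub_abs_le_abs_sub E (V 1)]
  have exponent : p * (p + 2 * κ) / ((p + 1) * (α + κ + 1 / 2)) =
      (p + 2 * κ) / (α + κ + 1 / 2) * p / (p + 1) := by
    field_simp
  rw [exponent]
  exact exists_eventually_ofReal_rpow_le_moment hS hp
    (div_pos (by positivity) (by linarith)) hc hμ bounded growth

end Spreading

section LowerExponent

open Filter

variable {S : Set ℤ} {V : ℤ → ℝ} {T p : ℝ}

theorem le_lowerExponent {s c : ℝ} (hc : 0 < c)
    (h : ∀ᶠ T in atTop, ENNReal.ofReal (c * T ^ s) ≤ moment S V p T) :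
    (s : EReal) ≤ lowerExponent S V p := by
  have tendsto_real : Tendsto (fun T : ℝ => Real.log c / Real.log T + s) atTop (nhds s) := by
    simpa using ((tendsto_const_nhds (x := Real.log c)).div_atTop
      Real.tendsto_log_atTop).add_const s
  have tendsto_ereal : Tendsto (fun T : ℝ => ((Real.log c / Real.log T + s : ℝ) : EReal)) atTop
      (nhds (s : EReal)) := (continuous_coe_real_ereal.tendsto s).comp tendsto_real
  rw [← tendsto_ereal.liminf_eq, lowerExponent]
  refine liminf_le_liminf ?_
  filter_upwards [h, eventually_gt_atTop 1] with T hT one_lt_T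
  have T_pos : 0 < T := one_pos.trans one_lt_T
  have log_pos := Real.log_pos one_lt_T
  calc ((Real.log c / Real.log T + s : ℝ) : EReal)
      = ENNReal.log (ENNReal.ofReal (c * T ^ s)) / (Real.log T : EReal) := by
        rw [ENNReal.log_ofReal_of_pos (by positivity), ← EReal.coe_div,
          Real.log_mul hc.ne' (by positivity), Real.log_rpow T_pos]
        congr 1
        field_simp
    _ ≤ _ := EReal.div_le_div_right_of_nonneg (by exact_mod_cast log_pos.le)
        (ENNReal.log_monotone hT)

theorem rpow_le_rpow_add_rpow_sub_mul_rpow {p₀ R x : ℝ} (hp₀ : 0 ≤ p₀) (hp : p₀ ≤ p) (hR : 0 < R)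
    (hx : 0 ≤ x) : x ^ p₀ ≤ R ^ p₀ + R ^ (p₀ - p) * x ^ p := by
  rcases le_total x R with hxR | hRx
  · exact le_add_of_le_of_nonneg (Real.rpow_le_rpow hx hxR hp₀) (by positivity)
  · refine le_add_of_nonneg_of_le (by positivity) ?_
    calc x ^ p₀ = x ^ (p₀ - p) * x ^ p := by
          rw [← Real.rpow_add (hR.trans_le hRx), sub_add_cancel]
      _ ≤ _ := by
          gcongr ?_ * x ^ p
          exact Real.rpow_le_rpow_of_nonpos hR hRx (by linarith)

theorem moment_le_add_mul_moment {p₀ R : ℝ} (hp₀ : 0 ≤ p₀) (hp : p₀ ≤ p) (h1 : (1 : ℤ) ∈ S)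
    (hT : 0 < T) (hR : 0 < R) : moment S V p₀ T ≤
      ENNReal.ofReal (R ^ p₀) + ENNReal.ofReal (R ^ (p₀ - p)) * moment S V p T := by
  calc moment S V p₀ T
      ≤ ∑' n : S, (ENNReal.ofReal (R ^ p₀) * ENNReal.ofReal (avgProb S V n T) +
          ENNReal.ofReal (R ^ (p₀ - p)) *
            ENNReal.ofReal (|((n : ℤ) : ℝ)| ^ p * avgProb S V n T)) := by
        refine ENNReal.tsum_le_tsum fun n => ?_
        have prob_nonneg := avgProb_nonneg (S := S) (V := V) hT n
        rw [← ENNReal.ofReal_mul (by positivity), ← ENNReal.ofReal_mul (by positivity),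
          ← ENNReal.ofReal_add (by positivity) (by positivity), ← mul_assoc, ← add_mul]
        gcongr
        exact rpow_le_rpow_add_rpow_sub_mul_rpow hp₀ hp hR (abs_nonneg _)
    _ = _ := by
        rw [ENNReal.tsum_add, ENNReal.tsum_mul_left, ENNReal.tsum_mul_left, tsum_avgProb h1 hT,
          mul_one, moment]

theorem ofReal_rpow_le_moment {p₀ R : ℝ} (hp₀ : 0 ≤ p₀) (hp : p₀ ≤ p) (h1 : (1 : ℤ) ∈ S)
    (hT : 0 < T) (hR : 0 < R) (h : ENNReal.ofReal (2 * R ^ p₀) ≤ moment S V p₀ T) :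
    ENNReal.ofReal (R ^ p) ≤ moment S V p T := by
  have tail : ENNReal.ofReal (R ^ p₀) ≤ ENNReal.ofReal (R ^ (p₀ - p)) * moment S V p T := by
    have doubled := h.trans (moment_le_add_mul_moment hp₀ hp h1 hT hR)
    rw [two_mul, ENNReal.ofReal_add (by positivity) (by positivity)] at doubled
    exact (ENNReal.add_le_add_iff_left ENNReal.ofReal_ne_top).1 doubled
  calc ENNReal.ofReal (R ^ p) = ENNReal.ofReal (R ^ (p - p₀)) * ENNReal.ofReal (R ^ p₀) := by
        rw [← ENNReal.ofReal_mul (by positivity), ← Real.rpow_add hR, sub_add_cancel]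
    _ ≤ ENNReal.ofReal (R ^ (p - p₀)) * (ENNReal.ofReal (R ^ (p₀ - p)) * moment S V p T) := by
        gcongr
    _ = moment S V p T := by
        rw [← mul_assoc, ← ENNReal.ofReal_mul (by positivity), ← Real.rpow_add hR]
        simp

theorem le_lowerExponent_of_eventually_le_moment {p₀ s c : ℝ} (h1 : (1 : ℤ) ∈ S) (hp₀ : 0 < p₀)
    (hp : p₀ ≤ p) (hc : 0 < c)
    (h : ∀ᶠ T in atTop, ENNReal.ofReal (c * T ^ s) ≤ moment S V p₀ T) :
    ((p * (s / p₀) : ℝ) : EReal) ≤ lowerExponent S V p := by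
  refine le_lowerExponent (c := ((c / 2) ^ (1 / p₀)) ^ p) (by positivity) ?_
  filter_upwards [h, eventually_gt_atTop 0] with T hT T_pos
  set R := (c / 2) ^ (1 / p₀) * T ^ (s / p₀) with R_def
  have doubled : 2 * R ^ p₀ = c * T ^ s := by
    rw [R_def, Real.mul_rpow (by positivity) (by positivity), ← Real.rpow_mul (by positivity),
      ← Real.rpow_mul T_pos.le, one_div_mul_cancel hp₀.ne', div_mul_cancel₀ _ hp₀.ne',
      Real.rpow_one]
    ring
  have bound := ofReal_rpow_le_moment hp₀.le hp h1 T_pos (by positivity) (doubled.symm ▸ hT)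
  rwa [R_def, Real.mul_rpow (by positivity) (by positivity), ← Real.rpow_mul T_pos.le,
    mul_comm (s / p₀)] at bound

end LowerExponent

theorem theorem3_general (S : Set ℤ) (hS : Set.Ici 1 ⊆ S) (V : ℤ → ℝ) (A : Set ℝ)
    (α : ℝ) (ha : PowerLawUpperBound S V A α) (hb : ScalingLowerBound S V A)
    (hμ : 0 < spectralMeasure S V (delta S 1) A) :
    (∃ κ : ℝ, 0 < κ ∧ PowerLawLowerBound S V A κ) ∧
    (∀ κ : ℝ, 0 < κ → PowerLawLowerBound S V A κ → ∀ p : ℝ, 0 < p → p ≤ 2 * α + 1 →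
      ((p * (p + 2 * κ) / ((p + 1) * (α + κ + 1 / 2)) : ℝ) : EReal) ≤ lowerExponent S V p) ∧
    (∀ p : ℝ, 2 * α + 1 < p → ((p / (α + 1) : ℝ) : EReal) ≤ lowerExponent S V p) := by
  have h1 : (1 : ℤ) ∈ S := hS Set.self_mem_Ici
  have exists_lower := hb.exists_powerLawLowerBound ha h1
  refine ⟨exists_lower, fun κ hκ hlow p hp hpα => ?_, fun p hp => ?_⟩
  · obtain ⟨c, hc, growth⟩ := hlow.exists_eventually_le_moment ha hb hS hμ hκ hp hpα
    exact le_lowerExponent hc growth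
  · obtain ⟨κ, hκ, hlow⟩ := exists_lower
    have p₀_pos := hlow.two_mul_add_one_pos ha hκ (MeasureTheory.nonempty_of_measure_ne_zero hμ.ne')
    obtain ⟨c, hc, growth⟩ := hlow.exists_eventually_le_moment ha hb hS hμ hκ p₀_pos le_rfl
    convert le_lowerExponent_of_eventually_le_moment h1 p₀_pos hp.le hc growth using 2
    have exponent : (2 * α + 1) * (2 * α + 1 + 2 * κ) /
        ((2 * α + 1 + 1) * (α + κ + 1 / 2)) = (2 * α + 1) / (α + 1) := by
      rw [div_eq_div_iff (mul_pos (by linarith) (by linarith)).ne' (by linarith)]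
      ring
    rw [exponent, div_div_cancel_left' p₀_pos.ne', div_eq_mul_inv]

theorem theorem3 (S : Set ℤ) (hS : S = Set.univ ∨ S = Set.Ici 1) (V : ℤ → ℝ) (A : Set ℝ)
    (α : ℝ) (hα : 0 < α) (ha : PowerLawUpperBound S V A α) (hb : ScalingLowerBound S V A)
    (hμ : 0 < spectralMeasure S V (delta S 1) A) :
    (∃ κ : ℝ, 0 < κ ∧ PowerLawLowerBound S V A κ) ∧
    (∀ κ : ℝ, 0 < κ → PowerLawLowerBound S V A κ → ∀ p : ℝ, 0 < p → p ≤ 2 * α + 1 →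
      ((p * (p + 2 * κ) / ((p + 1) * (α + κ + 1 / 2)) : ℝ) : EReal) ≤ lowerExponent S V p) ∧
    (∀ p : ℝ, 2 * α + 1 < p → ((p / (α + 1) : ℝ) : EReal) ≤ lowerExponent S V p) :=
  theorem3_general S (by rcases hS with rfl | rfl <;> simp) V A α ha hb hμ
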